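/- Let $N>n\ge 0$ be integers, $w_0,\dots,w_{N-1},\lambda_1,\dots,\lambda_n\in\mathbb{C}$, and for $x\in\mathbb{C}^*$ consider on the universal covering of $(\mathbb{C}^*)^{N-1}\times(\mathbb{C}^*)^n$ the potential $$W(u,v;x)=\sum_{i=1}^{N-1}(u_i+w_i\log u_i)-\sum_{a=1}^n(v_a+\lambda_a\log v_a)+\frac{v_1\cdots v_n}{u_1\cdots u_{N-1}}x+w_0\log\Bigl(\frac{v_1\cdots v_n}{u_1\cdots u_{N-1}}x\Bigr)$$ (the value of $\log x$ being chosen, i.e. $x=e^t$ with $t\in\mathbb{C}$, so that $x^{1/(N-n)}=e^{t/(N-n)}$). Let $\mathrm{Hess}(u,v)$ be the determinant of the matrix of second partial derivatives of $W$ in the coordinates $(u,v)$. Let $x$ tend to infinity in any manner, and let $(u^{(c)},v^{(c)})=(u^{(c)}(x),v^{(c)}(x))$ be a family of critical points of $W(\cdot;x)$, of one of the following types. Type (i): for some $p\in\{1,\dots,N-n\}$, with $\zeta=e^{2\pi i/(N-n)}$, one has for all $i$ and $a$ $$u^{(c)}_i=\zeta^p x^{\frac1{N-n}}\bigl(1+O(x^{-\frac1{N-n}})\bigr),\qquad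 v^{(c)}_a=\zeta^p x^{\frac1{N-n}}\bigl(1+O(x^{-\frac1{N-n}})\bigr).$$ Type (ii): for some $b\in\{1,\dots,n\}$ with $\lambda_a\ne\lambda_b$ for all $a\neq b$, and $c_b=\prod_{i=0}^{N-1}(\lambda_b-w_i)\big/\prod_{a\ne b}(\lambda_b-\lambda_a)$, one has for all $i$ and $a$ $$u^{(c)}_i=(\lambda_b-w_i)+c_bx^{-1}+O(x^{-2}),\qquad v^{(c)}_a=(\lambda_b-\lambda_a)+c_bx^{-1}+O(x^{-2}).$$ For each such $x$ let $\theta\in\mathbb{R}$ be a phase (which may depend on $x$), and let $\Gamma$ be a Lefschetz thimble of the critical point for $\arg\hbar=\theta$: an embedded smooth copy of $\mathbb{R}^{N+n-1}$ with parameter $s$ through the critical point $s=0$, on which $W=W(u^{(c)},v^{(c)};x)+e^{i(\pi+\theta)}|s|^2$. Assume that the oscillatory integral $$\mathcal{I}(x)=\int_\Gamma e^{W(u,v;x)/\hbar}\,\prod_{i=1}^{N-1}\frac{du_i}{u_i}\prod_{a=1}^n dv_a$$ converges absolutely for all sufficiently small $\hbar$ with $\arg\hbar=\theta$. Then the following hold.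 (1) For all sufficiently large $x$ the Hessian at the critical point is nonzero, and, for any choice of the square root, $$\frac{1}{u^{(c)}_1\cdots u^{(c)}_{N-1}\sqrt{\mathrm{Hess}(u^{(c)},v^{(c)})}}=\begin{cases}O\bigl(x^{-\frac{N-n-1}{2(N-n)}}\bigr)&\text{for type (i)},\\ O(x^{-1})&\text{for type (ii)}.\end{cases}$$ (This part does not involve the thimbles.) (2) For all sufficiently large $x$, the integral has, as $\hbar\to0$ with $\arg\hbar=\theta$ and for suitable signs of the square roots, an asymptotic expansion $$\mathcal{I}(x)\sim e^{\frac1\hbar W(u^{(c)},v^{(c)};x)}\,\frac{(-2\pi\hbar)^{\frac{N+n-1}{2}}}{u^{(c)}_1\cdots u^{(c)}_{N-1}\sqrt{\mathrm{Hess}(u^{(c)},v^{(c)})}}\Bigl(1+\sum_{m=1}^\infty\hbar^m\mathcal{I}_m(x)\Bigr),$$ and for each $m\ge1$ its coefficient satisfies, as $x\to\infty$, $$\mathcal{I}_m(x)=\begin{cases}O\bigl(x^{-\frac1{2(N-n)}}\bigr)&\text{for type (i)},\\ O(1)&\text{for type (ii)}.\end{cases}$$ -/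

import Mathlib

open Filter Topology Asymptotics MeasureTheory

namespace DegreeOneMirror

/-- Labels of the variables `(u_1, …, u_{N-1}, v_1, …, v_n)`. -/
abbrev Vars (N n : ℕ) : Type := Fin (N - 1) ⊕ Fin n

/-- A point of `(ℂ^*)^{N-1} × (ℂ^*)^n` lifted to the universal covering is recorded by its
logarithms `P`; its coordinates are the exponentials: `u_i = exp (P (inl i))`,
`v_a = exp (P (inr a))`. -/
noncomputable def coords {N n : ℕ} (P : Vars N n → ℂ) (j : Vars N n) : ℂ :=
  Complex.exp (P j)

/-- The product `u_1 ⋯ u_{N-1}`. -/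
noncomputable def uProd {N n : ℕ} (P : Vars N n → ℂ) : ℂ :=
  ∏ i : Fin (N - 1), coords P (Sum.inl i)

/-- `log (v_1 ⋯ v_n / (u_1 ⋯ u_{N-1}) * x)` on the universal covering, where `x = exp t`. -/
def logMonomial {N n : ℕ} (t : ℂ) (P : Vars N n → ℂ) : ℂ :=
  (∑ a : Fin n, P (Sum.inr a)) - (∑ i : Fin (N - 1), P (Sum.inl i)) + t

/-- The mirror Landau-Ginzburg potential on the universal covering, for `x = exp t`:
`∑ (u_i + w_i log u_i) - ∑ (v_a + λ_a log v_a) + Q + w_0 log Q`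
with `Q = v_1 ⋯ v_n / (u_1 ⋯ u_{N-1}) * x`. -/
noncomputable def potential {N n : ℕ} (w₀ : ℂ) (w : Fin (N - 1) → ℂ) (lam : Fin n → ℂ)
    (t : ℂ) (P : Vars N n → ℂ) : ℂ :=
  (∑ i : Fin (N - 1), (coords P (Sum.inl i) + w i * P (Sum.inl i)))
    - (∑ a : Fin n, (coords P (Sum.inr a) + lam a * P (Sum.inr a)))
    + Complex.exp (logMonomial t P) + w₀ * logMonomial t P

/-- The local section of the covering through `P`: the point near `P` whose coordinates are
`z`, for `z` near `coords P`. -/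
noncomputable def lift {N n : ℕ} (P : Vars N n → ℂ) (z : Vars N n → ℂ) : Vars N n → ℂ :=
  fun j => P j + Complex.log (z j / coords P j)

/-- The potential near `P` as a function of the coordinates `(u, v)`. -/
noncomputable def localPotential {N n : ℕ} (w₀ : ℂ) (w : Fin (N - 1) → ℂ) (lam : Fin n → ℂ)
    (t : ℂ) (P : Vars N n → ℂ) (z : Vars N n → ℂ) : ℂ :=
  potential w₀ w lam t (lift P z)

/-- The complex partial derivative in the `j`-th coordinate. -/
noncomputable def pderiv {N n : ℕ} (j : Vars N n) (f : (Vars N n → ℂ) → ℂ)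
    (z : Vars N n → ℂ) : ℂ :=
  deriv (fun h : ℂ => f (Function.update z j h)) (z j)

/-- `P` is a critical point of the potential for `x = exp t`. -/
def IsCriticalPoint {N n : ℕ} (w₀ : ℂ) (w : Fin (N - 1) → ℂ) (lam : Fin n → ℂ)
    (t : ℂ) (P : Vars N n → ℂ) : Prop :=
  ∀ j, pderiv j (localPotential w₀ w lam t P) (coords P) = 0

/-- The Hessian determinant of the potential at `P` in the coordinates `(u, v)`. -/
noncomputable def hess {N n : ℕ} (w₀ : ℂ) (w : Fin (N - 1) → ℂ) (lam : Fin n → ℂ)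
    (t : ℂ) (P : Vars N n → ℂ) : ℂ :=
  (Matrix.of fun i j : Vars N n =>
    pderiv i (pderiv j (localPotential w₀ w lam t P)) (coords P)).det

/-- `γ` parametrizes the Lefschetz thimble of the critical point `P` for the phase
`θ = arg ħ`: an embedded copy of `ℝ^{N+n-1}` through `P` whose sphere `∑ s_j ^ 2 = r` (the
vanishing cycle) lies in the fibre of the potential over the point
`W(P) + r exp (i (π + θ))`, for every `r ≥ 0`. Properness is automatic, since
`|W(γ s) - W(P)| = ∑ s_j ^ 2`. -/
structure IsLefschetzThimble {N n : ℕ} (w₀ : ℂ) (w : Fin (N - 1) → ℂ) (lam : Fin n → ℂ)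
    (t : ℂ) (P : Vars N n → ℂ) (θ : ℝ) (γ : (Vars N n → ℝ) → (Vars N n → ℂ)) : Prop where
  smooth : ContDiff ℝ (⊤ : ℕ∞) γ
  injective : Function.Injective γ
  immersion : ∀ s, Function.Injective (fderiv ℝ γ s)
  base : γ 0 = P
  fibre : ∀ s, potential w₀ w lam t (γ s)
    = potential w₀ w lam t P + ((∑ j, s j ^ 2 : ℝ) : ℂ) * Complex.exp (Complex.I * (Real.pi + θ))

/-- The integrand of the oscillatory integral over `γ`, that is, the pull-back by `γ` of
`exp (W / ħ) du_1/u_1 ⋯ du_{N-1}/u_{N-1} dv_1 ⋯ dv_n`. -/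
noncomputable def oscIntegrand {N n : ℕ} (w₀ : ℂ) (w : Fin (N - 1) → ℂ) (lam : Fin n → ℂ)
    (t : ℂ) (γ : (Vars N n → ℝ) → (Vars N n → ℂ)) (ħ : ℂ) (s : Vars N n → ℝ) : ℂ :=
  Complex.exp (potential w₀ w lam t (γ s) / ħ) * (uProd (γ s))⁻¹
    * (Matrix.of fun i j : Vars N n =>
        fderiv ℝ (fun s' => coords (γ s') i) s (Pi.single j (1 : ℝ))).det

/-- The oscillatory integral over `γ`. -/
noncomputable def oscIntegral {N n : ℕ} (w₀ : ℂ) (w : Fin (N - 1) → ℂ) (lam : Fin n → ℂ)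
    (t : ℂ) (γ : (Vars N n → ℝ) → (Vars N n → ℂ)) (ħ : ℂ) : ℂ :=
  ∫ s : Vars N n → ℝ, oscIntegrand w₀ w lam t γ ħ s

/-- The point of modulus `ε` on the ray of phase `θ`. -/
noncomputable def hbar (θ ε : ℝ) : ℂ := ε * Complex.exp (Complex.I * θ)

/-- The oscillatory integral over `γ` converges absolutely for all small `ħ` of phase `θ`. -/
def Converges {N n : ℕ} (w₀ : ℂ) (w : Fin (N - 1) → ℂ) (lam : Fin n → ℂ)
    (t : ℂ) (θ : ℝ) (γ : (Vars N n → ℝ) → (Vars N n → ℂ)) : Prop :=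
  ∀ᶠ ε : ℝ in 𝓝[>] 0, Integrable (oscIntegrand w₀ w lam t γ (hbar θ ε))

/-- Saddle point expansion with coefficients `I 1, I 2, …`: as `ħ → 0` with `arg ħ = θ`,
the oscillatory integral is asymptotic, to all orders, to
`exp (W(P) / ħ) (-2 π ħ)^{(N+n-1)/2} / (u_1 ⋯ u_{N-1} √Hess) * (1 + ∑_{m ≥ 1} ħ^m I m)`.
The square roots `q` of `-2 π exp (i θ)` and `r` of the Hessian are determined up to a sign,
which reflects the orientation of the thimble. -/
def HasSaddleExpansion {N n : ℕ} (w₀ : ℂ) (w : Fin (N - 1) → ℂ) (lam : Fin n → ℂ)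
    (t : ℂ) (P : Vars N n → ℂ) (θ : ℝ) (γ : (Vars N n → ℝ) → (Vars N n → ℂ))
    (I : ℕ → ℂ) : Prop :=
  ∃ q r : ℂ, q ^ 2 = -2 * Real.pi * Complex.exp (Complex.I * θ) ∧
    r ^ 2 = hess w₀ w lam t P ∧ r ≠ 0 ∧
    ∀ M : ℕ,
      (fun ε : ℝ =>
        Complex.exp (-(potential w₀ w lam t P / hbar θ ε))
            * oscIntegral w₀ w lam t γ (hbar θ ε)
          - (q * (Real.sqrt ε : ℂ)) ^ (N - 1 + n) / (uProd P * r)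
            * (1 + ∑ m ∈ Finset.Icc 1 M, hbar θ ε ^ m * I m))
        =o[𝓝[>] 0] fun ε : ℝ => Real.sqrt ε ^ (N - 1 + n) * ε ^ M

/-- The family `P` of critical points is of the first type: every coordinate is
`ζ^p x^{1/(N-n)} (1 + O(x^{-1/(N-n)}))`, where `ζ = exp (2 π i / (N - n))`, `x = exp t`. -/
def IsTypeOne {N n : ℕ} (l : Filter ℂ) (P : ℂ → Vars N n → ℂ) (p : ℕ) : Prop :=
  ∀ j, (fun t : ℂ =>
      coords (P t) j
        / (Complex.exp (2 * Real.pi * Complex.I / ((N : ℂ) - n)) ^ p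
            * Complex.exp (t / ((N : ℂ) - n))) - 1)
    =O[l] fun t : ℂ => ‖Complex.exp t‖ ^ (-1 / ((N : ℝ) - n))

/-- `c_b = ∏_{i=0}^{N-1} (λ_b - w_i) / ∏_{a ≠ b} (λ_b - λ_a)`. -/
noncomputable def cCoeff {N n : ℕ} (w₀ : ℂ) (w : Fin (N - 1) → ℂ) (lam : Fin n → ℂ)
    (b : Fin n) : ℂ :=
  ((lam b - w₀) * ∏ i, (lam b - w i)) / ∏ a ∈ Finset.univ.erase b, (lam b - lam a)

/-- The family `P` of critical points is of the second type:
`u_i = (λ_b - w_i) + c_b x^{-1} + O(x^{-2})` and `v_a = (λ_b - λ_a) + c_b x^{-1} + O(x^{-2})`. -/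
def IsTypeTwo {N n : ℕ} (w₀ : ℂ) (w : Fin (N - 1) → ℂ) (lam : Fin n → ℂ)
    (l : Filter ℂ) (P : ℂ → Vars N n → ℂ) (b : Fin n) : Prop :=
  (∀ i : Fin (N - 1), (fun t : ℂ =>
      coords (P t) (Sum.inl i) - ((lam b - w i) + cCoeff w₀ w lam b * (Complex.exp t)⁻¹))
    =O[l] fun t : ℂ => ‖Complex.exp t‖ ^ (-2 : ℝ)) ∧
  (∀ a : Fin n, (fun t : ℂ =>
      coords (P t) (Sum.inr a) - ((lam b - lam a) + cCoeff w₀ w lam b * (Complex.exp t)⁻¹))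
    =O[l] fun t : ℂ => ‖Complex.exp t‖ ^ (-2 : ℝ))

/-- The prefactor `(u_1 ⋯ u_{N-1} √Hess)⁻¹` is `O(|x|^α)`, whatever square roots of the
Hessian are taken; the Hessian does not vanish for large `x`. -/
def PrefactorBound {N n : ℕ} (w₀ : ℂ) (w : Fin (N - 1) → ℂ) (lam : Fin n → ℂ)
    (l : Filter ℂ) (P : ℂ → Vars N n → ℂ) (α : ℝ) : Prop :=
  (∀ᶠ t in l, hess w₀ w lam t (P t) ≠ 0) ∧
  ∀ r : ℂ → ℂ, (∀ᶠ t in l, r t ^ 2 = hess w₀ w lam t (P t)) →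
    (fun t => (uProd (P t) * r t)⁻¹) =O[l] fun t : ℂ => ‖Complex.exp t‖ ^ α

/-- For all Lefschetz thimbles of the critical points `P t` with convergent oscillatory
integrals, the saddle point expansion exists, and each of its coefficients `I_m(x)`, `m ≥ 1`,
is `O(|x|^β)`. -/
def CoefficientBound {N n : ℕ} (w₀ : ℂ) (w : Fin (N - 1) → ℂ) (lam : Fin n → ℂ)
    (l : Filter ℂ) (P : ℂ → Vars N n → ℂ) (β : ℝ) : Prop :=
  ∀ (θ : ℂ → ℝ) (γ : ℂ → (Vars N n → ℝ) → (Vars N n → ℂ)),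
    (∀ᶠ t in l, IsLefschetzThimble w₀ w lam t (P t) (θ t) (γ t)
      ∧ Converges w₀ w lam t (θ t) (γ t)) →
    (∃ I : ℕ → ℂ → ℂ,
      ∀ᶠ t in l, HasSaddleExpansion w₀ w lam t (P t) (θ t) (γ t) (fun m => I m t)) ∧
    ∀ I : ℕ → ℂ → ℂ,
      (∀ᶠ t in l, HasSaddleExpansion w₀ w lam t (P t) (θ t) (γ t) (fun m => I m t)) →
      ∀ m : ℕ, 1 ≤ m → I m =O[l] fun t : ℂ => ‖Complex.exp t‖ ^ β

end DegreeOneMirror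

/-! In logarithmic coordinates `p` centred at a critical point `P`, the critical equations eliminate
`w` and `λ`: W(P + p) - W(P) equals F(p) = ∑ c_j (exp p_j - 1 - p_j) + Q (exp(e·p) - 1 - e·p), where
c_j is u_i or -v_a, Q is the monomial at `P`, and e_j is -1 or 1 (`phase_eq`). Its quadratic part
has the matrix A = diag(c) + Q e eᵀ (`quadMatrix`). The Hessian in (u, v), multiplied by the square
of the product of all coordinates, is det A (`hess_mul`), and the volume form is v_1 ⋯ v_n dp, with
the v_a varying.

On the thimble F = -exp(iθ)|s|², so the integral is Gaussian and Watson's lemma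
(`hasGaussExpansion`) gives the expansion. Its leading coefficient comes from the determinant of
JᵀAJ = -2 exp(iθ), where J is the Jacobian at the origin.

Nothing controls the parametrization of the thimble as x varies, so the bounds on the coefficients
rest on relations in which it does not appear. Let B_m(h) be the normalized m-th coefficient of the
integral of a polynomial h(p). Integration by parts gives B_{m+1}(η ∂_k F) = -B_m(∂_k η). Since
B_{m+1} kills high orders of vanishing and A is invertible, this determines B_{m+1} on polynomials
without constant term. The value at 1 follows from F being a multiple of |s|²: m B_m(1) = -B_{m+1}(F
- ½ ∑ p_k ∂_k F), whose argument starts in degree 3. Hence all B_m(h) stay bounded when c, Q and A⁻¹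
do (`expansion_bounded`).

Dividing F by a scale y turns this into I_m = y^{-m} · O(1) (`saddleCoeff_eq`). For type (i), y is
the leading term of the coordinates, and c/y, Q/y tend to -e and 1, a nondegenerate limit because N
≠ n. For type (ii), y = 1, and the limit of c vanishes only in the entry of v_b; this needs λ_b to
differ from every w_i, which the existence of the critical points forces (`IsTypeTwo.lam_ne`). The
square of the prefactor is (v_1 ⋯ v_n)² / det A, which gives its size in both cases. -/

namespace GaussianExpansion
open scoped Nat ContDiff

/-! ### Gaussian integrals, Taylor terms and Watson's lemma -/

variable {ι : Type*} [Fintype ι]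

/-- The sum of the squares of the coordinates. -/
def sumSq (s : ι → ℝ) : ℝ := ∑ j, s j ^ 2

lemma sumSq_nonneg (s : ι → ℝ) : 0 ≤ sumSq s := Finset.sum_nonneg fun _ _ => sq_nonneg _

/-- The norm on `ι → ℝ` is the sup norm, so it is only dominated by the Euclidean one. This
direction suffices to turn Gaussian decay into decay in ‖s‖. -/
lemma norm_sq_le_sumSq (s : ι → ℝ) : ‖s‖ ^ 2 ≤ sumSq s := by
  have h : ‖s‖ ≤ Real.sqrt (sumSq s) := by
    refine (pi_norm_le_iff_of_nonneg (Real.sqrt_nonneg _)).2 fun j => ?_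
    refine Real.le_sqrt_of_sq_le ?_
    rw [Real.norm_eq_abs, sq_abs]
    exact Finset.single_le_sum (f := fun j => s j ^ 2) (fun _ _ => sq_nonneg _) (Finset.mem_univ j)
  calc ‖s‖ ^ 2 ≤ Real.sqrt (sumSq s) ^ 2 := by gcongr
    _ = sumSq s := Real.sq_sqrt (sumSq_nonneg s)

lemma contDiff_sumSq : ContDiff ℝ ∞ (sumSq : (ι → ℝ) → ℝ) := by
  unfold sumSq; fun_prop

@[fun_prop]
lemma continuous_sumSq : Continuous (sumSq : (ι → ℝ) → ℝ) := contDiff_sumSq.continuous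

lemma sumSq_smul (c : ℝ) (s : ι → ℝ) : sumSq (c • s) = c ^ 2 * sumSq s := by
  simp [sumSq, mul_pow, Finset.mul_sum]

/-- The Gaussian `exp (-|s|² / ε)`. -/
noncomputable def gauss (ε : ℝ) (s : ι → ℝ) : ℝ := Real.exp (-(sumSq s / ε))

lemma gauss_pos (ε : ℝ) (s : ι → ℝ) : 0 < gauss ε s := Real.exp_pos _

@[fun_prop]
lemma continuous_gauss (ε : ℝ) : Continuous (gauss ε : (ι → ℝ) → ℝ) := by
  unfold gauss; fun_prop

lemma integrable_gauss {ε : ℝ} (hε : 0 < ε) : Integrable (gauss ε : (ι → ℝ) → ℝ) := by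
  have h : (gauss ε : (ι → ℝ) → ℝ) = fun s => ∏ j, Real.exp (-(ε⁻¹) * s j ^ 2) := by
    funext s
    rw [← Real.exp_sum, gauss, sumSq, Finset.sum_div, ← Finset.sum_neg_distrib]
    congr 1
    refine Finset.sum_congr rfl fun j _ => ?_
    ring
  rw [h]
  exact Integrable.fintype_prod (f := fun _ x => Real.exp (-(ε⁻¹) * x ^ 2))
    fun _ => integrable_exp_neg_mul_sq (inv_pos.2 hε)

lemma integral_gauss_one : ∫ s : ι → ℝ, gauss 1 s = Real.sqrt Real.pi ^ Fintype.card ι := by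
  have h : (gauss 1 : (ι → ℝ) → ℝ) = fun s => ∏ j, Real.exp (-1 * s j ^ 2) := by
    funext s
    rw [← Real.exp_sum, gauss, sumSq, Finset.sum_div, ← Finset.sum_neg_distrib]
    congr 1
    refine Finset.sum_congr rfl fun j _ => ?_
    ring
  rw [h, integral_fintype_prod_volume_eq_pow (fun x : ℝ => Real.exp (-1 * x ^ 2)),
    integral_gaussian, div_one]

/-- The Gaussian is the square of the one of width 2ε: one factor absorbs the power of ‖s‖ through
x^k / k! ≤ exp x, the other remains integrable. -/
lemma integrable_gauss_mul_norm_pow {ε : ℝ} (hε : 0 < ε) (k : ℕ) :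
    Integrable (fun s : ι → ℝ => gauss ε s * ‖s‖ ^ k) := by
  have hb : ∀ s : ι → ℝ, gauss ε s * ‖s‖ ^ k ≤ (1 + k ! * (2 * ε) ^ k) * gauss (2 * ε) s := by
    intro s
    have h1 : gauss ε s = gauss (2 * ε) s * gauss (2 * ε) s := by
      rw [gauss, gauss, ← Real.exp_add]; congr 1; field_simp; ring
    have h2 : gauss (2 * ε) s ≤ 1 := by
      rw [gauss, Real.exp_le_one_iff, neg_nonpos]
      have := sumSq_nonneg s; positivity
    have h3 : ‖s‖ ^ k ≤ 1 + (‖s‖ ^ 2) ^ k := by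
      rw [← pow_mul, mul_comm 2 k, pow_mul]
      nlinarith [sq_nonneg (‖s‖ ^ k - 1), pow_nonneg (norm_nonneg s) k]
    have h4 : (‖s‖ ^ 2) ^ k * gauss (2 * ε) s ≤ k ! * (2 * ε) ^ k := by
      have h5 := Real.pow_div_factorial_le_exp (x := sumSq s / (2 * ε))
        (by have := sumSq_nonneg s; positivity) k
      rw [gauss, Real.exp_neg, ← div_eq_mul_inv, div_le_iff₀ (Real.exp_pos _)]
      calc (‖s‖ ^ 2) ^ k ≤ sumSq s ^ k := by gcongr; exact norm_sq_le_sumSq s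
        _ = k ! * (2 * ε) ^ k * ((sumSq s / (2 * ε)) ^ k / k !) := by
          have : (k ! : ℝ) ≠ 0 := by positivity
          rw [div_pow]
          field_simp
        _ ≤ _ := by gcongr
    have hg := gauss_pos (2 * ε) s
    calc gauss ε s * ‖s‖ ^ k ≤ gauss ε s * (1 + (‖s‖ ^ 2) ^ k) := by
          gcongr; exact (gauss_pos _ _).le
      _ = (gauss (2 * ε) s + (‖s‖ ^ 2) ^ k * gauss (2 * ε) s) * gauss (2 * ε) s := by
          rw [h1]; ring
      _ ≤ _ := by gcongr
  refine ((integrable_gauss (by positivity : 0 < 2 * ε)).const_mul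
    (1 + k ! * (2 * ε) ^ k)).mono' (by fun_prop) (Eventually.of_forall fun s => ?_)
  rw [Real.norm_of_nonneg (mul_nonneg (gauss_pos _ _).le (by positivity))]
  exact hb s

lemma integrable_gauss_mul_of_bound {ε : ℝ} (hε : 0 < ε) {g : (ι → ℝ) → ℂ} (hg : Continuous g)
    {C : ℝ} {k : ℕ} (hC : ∀ s, ‖g s‖ ≤ C * ‖s‖ ^ k) :
    Integrable (fun s : ι → ℝ => (gauss ε s : ℂ) * g s) := by
  refine ((integrable_gauss_mul_norm_pow hε k).const_mul C).mono' (by fun_prop)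
    (Eventually.of_forall fun s => ?_)
  rw [norm_mul, Complex.norm_real, Real.norm_of_nonneg (gauss_pos _ _).le]
  calc gauss ε s * ‖g s‖ ≤ gauss ε s * (C * ‖s‖ ^ k) := by
        gcongr
        · exact (gauss_pos _ _).le
        · exact hC s
    _ = _ := by ring

lemma gauss_sqrt_smul {ε : ℝ} (hε : 0 < ε) (s : ι → ℝ) :
    gauss ε (Real.sqrt ε • s) = gauss 1 s := by
  rw [gauss, gauss, sumSq_smul, Real.sq_sqrt hε.le, mul_div_cancel_left₀ _ hε.ne', div_one]

/-- Rescaling a Gaussian integral. -/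
lemma integral_gauss_eq {ε : ℝ} (hε : 0 < ε) (g : (ι → ℝ) → ℂ) :
    ∫ s, (gauss ε s : ℂ) * g s
      = (Real.sqrt ε : ℂ) ^ Fintype.card ι * ∫ s, (gauss 1 s : ℂ) * g (Real.sqrt ε • s) := by
  have h := Measure.integral_comp_smul_of_nonneg (volume : Measure (ι → ℝ))
    (fun s => (gauss ε s : ℂ) * g s) (Real.sqrt ε) (hR := Real.sqrt_nonneg _)
  simp only [gauss_sqrt_smul hε, Module.finrank_fintype_fun_eq_card] at h
  have h0 : (Real.sqrt ε : ℂ) ≠ 0 := by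
    exact_mod_cast (Real.sqrt_pos.2 hε).ne'
  rw [h, Complex.real_smul]
  push_cast
  rw [mul_inv_cancel_left₀ (pow_ne_zero _ h0)]

/-- The homogeneous part of degree `k` of the Taylor expansion at `0`. -/
noncomputable def taylorTerm (f : (ι → ℝ) → ℂ) (k : ℕ) (s : ι → ℝ) : ℂ :=
  (k ! : ℝ)⁻¹ • iteratedFDeriv ℝ k f 0 (fun _ => s)

@[fun_prop]
lemma continuous_taylorTerm (f : (ι → ℝ) → ℂ) (k : ℕ) : Continuous (taylorTerm f k) := by
  have : Continuous fun s : ι → ℝ => iteratedFDeriv ℝ k f 0 (fun _ => s) :=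
    (iteratedFDeriv ℝ k f 0).cont.comp (continuous_pi fun _ => continuous_id)
  exact this.const_smul ((k ! : ℝ)⁻¹)

lemma norm_taylorTerm_le (f : (ι → ℝ) → ℂ) (k : ℕ) (s : ι → ℝ) :
    ‖taylorTerm f k s‖ ≤ ((k ! : ℝ)⁻¹ * ‖iteratedFDeriv ℝ k f 0‖) * ‖s‖ ^ k := by
  rw [taylorTerm, norm_smul, Real.norm_of_nonneg (by positivity), mul_assoc]
  gcongr
  simpa using (iteratedFDeriv ℝ k f 0).le_opNorm (fun _ => s)

lemma taylorTerm_smul (f : (ι → ℝ) → ℂ) (k : ℕ) (c : ℝ) (s : ι → ℝ) :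
    taylorTerm f k (c • s) = (c : ℂ) ^ k * taylorTerm f k s := by
  have h := (iteratedFDeriv ℝ k f 0).map_smul_univ (fun _ => c) (fun _ => s)
  simp only [Finset.prod_const, Finset.card_univ, Fintype.card_fin] at h
  rw [taylorTerm, h, smul_comm, Complex.real_smul, ← taylorTerm, Complex.ofReal_pow]

lemma integrable_gauss_mul_taylorTerm {ε : ℝ} (hε : 0 < ε) (f : (ι → ℝ) → ℂ) (k : ℕ) :
    Integrable (fun s => (gauss ε s : ℂ) * taylorTerm f k s) :=
  integrable_gauss_mul_of_bound hε (by fun_prop) (norm_taylorTerm_le f k)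

/-- The `m`-th coefficient of the expansion of `∫ exp (-|s|² / ε) f(s) ds` as `ε → 0`. -/
noncomputable def gaussCoeff (f : (ι → ℝ) → ℂ) (m : ℕ) : ℂ :=
  ∫ s, (gauss 1 s : ℂ) * taylorTerm f (2 * m) s

lemma integral_gauss_taylorTerm {ε : ℝ} (hε : 0 < ε) (f : (ι → ℝ) → ℂ) (k : ℕ) :
    ∫ s, (gauss ε s : ℂ) * taylorTerm f k s
      = (Real.sqrt ε : ℂ) ^ Fintype.card ι * ((Real.sqrt ε : ℂ) ^ k
        * ∫ s, (gauss 1 s : ℂ) * taylorTerm f k s) := by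
  rw [integral_gauss_eq hε, ← integral_const_mul (_ ^ k)]
  simp_rw [taylorTerm_smul, mul_left_comm]

/-- By the symmetry s ↦ -s. This is why only integral powers of ε follow the factor √ε^d. -/
lemma integral_gauss_taylorTerm_odd (f : (ι → ℝ) → ℂ) (m : ℕ) :
    ∫ s, (gauss 1 s : ℂ) * taylorTerm f (2 * m + 1) s = 0 := by
  have h := integral_neg_eq_self (fun s => (gauss 1 s : ℂ) * taylorTerm f (2 * m + 1) s) volume
  have h1 : ∀ s : ι → ℝ, (gauss 1 (-s) : ℂ) * taylorTerm f (2 * m + 1) (-s)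
      = -((gauss 1 s : ℂ) * taylorTerm f (2 * m + 1) s) := by
    intro s
    have h2 : taylorTerm f (2 * m + 1) (-s) = -taylorTerm f (2 * m + 1) s := by
      have := taylorTerm_smul f (2 * m + 1) (-1) s
      rw [neg_one_smul] at this
      rw [this]
      simp [pow_succ, pow_mul]
    have h3 : gauss 1 (-s) = gauss 1 s := by simp [gauss, sumSq]
    rw [h2, h3, mul_neg]
  simp_rw [h1, integral_neg] at h
  have : (2 : ℂ) * ∫ s, (gauss 1 s : ℂ) * taylorTerm f (2 * m + 1) s = 0 := by
    linear_combination -h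
  simpa using this

/-- The sum of the Taylor terms of degree at most `2 M + 1`, integrated against a Gaussian. -/
lemma integral_gauss_taylor {ε : ℝ} (hε : 0 < ε) (f : (ι → ℝ) → ℂ) (M : ℕ) :
    ∫ s, (gauss ε s : ℂ) * ∑ k ∈ Finset.range (2 * (M + 1)), taylorTerm f k s
      = (Real.sqrt ε : ℂ) ^ Fintype.card ι
        * ∑ m ∈ Finset.range (M + 1), (ε : ℂ) ^ m * gaussCoeff f m := by
  simp_rw [Finset.mul_sum]
  rw [integral_finsetSum _ fun k _ => integrable_gauss_mul_taylorTerm hε f k]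
  simp_rw [integral_gauss_taylorTerm hε]
  rw [← Finset.mul_sum, ← Finset.mul_sum]
  congr 1
  -- Each step adds the degrees 2n and 2n + 1, of which the odd one integrates to zero.
  induction M + 1 with
  | zero => simp
  | succ n ih =>
    rw [mul_add, mul_one, Finset.sum_range_succ, Finset.sum_range_succ, ih, Finset.sum_range_succ,
      integral_gauss_taylorTerm_odd, mul_zero, add_zero, gaussCoeff, pow_mul]
    congr 3
    rw [← Complex.ofReal_pow, Real.sq_sqrt hε.le]

/-- The integral form of the remainder, with the derivative of order K + 1 bounded on the compact
unit ball. -/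
lemma exists_taylor_bound {f : (ι → ℝ) → ℂ} (hf : ContDiff ℝ ∞ f) (K : ℕ) :
    ∃ C, 0 ≤ C ∧ ∀ s : ι → ℝ, ‖s‖ ≤ 1 →
      ‖f s - ∑ k ∈ Finset.range (K + 1), taylorTerm f k s‖ ≤ C * ‖s‖ ^ (K + 1) := by
  have hcont : Continuous (iteratedFDeriv ℝ (K + 1) f) :=
    hf.continuous_iteratedFDeriv (by exact_mod_cast le_top)
  obtain ⟨C, hC⟩ := (isCompact_closedBall (0 : ι → ℝ) 1).exists_bound_of_continuousOn
    hcont.continuousOn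
  have hC0 : 0 ≤ C := (norm_nonneg _).trans (hC 0 (by simp))
  refine ⟨(K ! : ℝ)⁻¹ * C, by positivity, fun s hs => ?_⟩
  have h := map_add_eq_sum_add_integral_iteratedFDeriv (f := f) (x := 0) (y := s) (n := K)
    (fun t _ => (hf.of_le (by exact_mod_cast le_top)).contDiffAt)
  rw [zero_add] at h
  rw [h]
  simp only [taylorTerm, add_sub_cancel_left, zero_add]
  rw [norm_smul, Real.norm_of_nonneg (by positivity), mul_assoc]
  gcongr
  have := intervalIntegral.norm_integral_le_of_norm_le_const (a := (0 : ℝ)) (b := 1)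
    (f := fun t : ℝ => (1 - t) ^ K • iteratedFDeriv ℝ (K + 1) f (t • s) (fun _ => s))
    (C := C * ‖s‖ ^ (K + 1)) ?_
  · simpa using this
  intro t ht
  rw [Set.uIoc_of_le zero_le_one] at ht
  have h1 : ‖(1 - t) ^ K‖ ≤ 1 := by
    rw [norm_pow]
    refine pow_le_one₀ (norm_nonneg _) ?_
    rw [Real.norm_eq_abs, abs_le]; constructor <;> linarith [ht.1, ht.2]
  have h2 : ‖iteratedFDeriv ℝ (K + 1) f (t • s) (fun _ => s)‖ ≤ C * ‖s‖ ^ (K + 1) := by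
    refine ((iteratedFDeriv ℝ (K + 1) f (t • s)).le_opNorm _).trans ?_
    simp only [Finset.prod_const, Finset.card_univ, Fintype.card_fin]
    gcongr
    refine hC _ ?_
    rw [mem_closedBall_zero_iff, norm_smul, Real.norm_of_nonneg ht.1.le]
    exact mul_le_one₀ ht.2 (norm_nonneg _) hs
  rw [norm_smul]
  calc _ ≤ 1 * (C * ‖s‖ ^ (K + 1)) := by gcongr
    _ = _ := one_mul _

/-- `Φ ε` is asymptotic to `ε^{d/2} ∑ ε^m a_m` to all orders as `ε → 0+`. -/
def HasGaussExpansion (d : ℕ) (Φ : ℝ → ℂ) (a : ℕ → ℂ) : Prop :=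
  ∀ M : ℕ, (fun ε : ℝ => Φ ε - (Real.sqrt ε : ℂ) ^ d
      * ∑ m ∈ Finset.range (M + 1), (ε : ℂ) ^ m * a m)
    =o[𝓝[>] 0] fun ε : ℝ => Real.sqrt ε ^ d * ε ^ M

/-- Once the earlier coefficients vanish, the term √ε^d ε^j a_j is itself o(√ε^d ε^j), so a_j = 0.
Knowing the function to the finite order M is enough for the coefficients up to M. -/
lemma HasGaussExpansion.eq_zero {d : ℕ} {Φ : ℝ → ℂ} {a : ℕ → ℂ}
    (ha : HasGaussExpansion d Φ a) {M : ℕ}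
    (hΦ : Φ =o[𝓝[>] 0] fun ε : ℝ => Real.sqrt ε ^ d * ε ^ M) : ∀ j ≤ M, a j = 0 := by
  intro j
  induction j using Nat.strong_induction_on with
  | _ j ih =>
    intro hj
    have hle : (fun ε : ℝ => Real.sqrt ε ^ d * ε ^ M)
        =O[𝓝[>] 0] fun ε : ℝ => Real.sqrt ε ^ d * ε ^ j := by
      refine IsBigO.of_bound 1 ?_
      have h1 : ∀ᶠ ε : ℝ in 𝓝[>] 0, ε ≤ 1 :=
        mem_nhdsWithin_of_mem_nhds (Iic_mem_nhds one_pos)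
      filter_upwards [h1, self_mem_nhdsWithin] with ε h1 (h0 : 0 < ε)
      rw [Real.norm_of_nonneg (by positivity), Real.norm_of_nonneg (by positivity), one_mul]
      exact mul_le_mul_of_nonneg_left (pow_le_pow_of_le_one h0.le h1 hj) (by positivity)
    have h := (hΦ.trans_isBigO hle).sub (ha j)
    have h1 : (fun ε : ℝ => (Real.sqrt ε : ℂ) ^ d * (ε : ℂ) ^ j * a j)
        =o[𝓝[>] 0] fun ε : ℝ => (Real.sqrt ε : ℂ) ^ d * (ε : ℂ) ^ j := by
      refine (h.congr_left fun ε => ?_).trans_isBigO (isBigO_of_le _ fun ε => by simp)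
      have : ∑ m ∈ Finset.range j, (ε : ℂ) ^ m * a m = 0 :=
        Finset.sum_eq_zero fun m hm => by
          have hm := Finset.mem_range.1 hm
          rw [ih m hm (by omega), mul_zero]
      rw [Finset.sum_range_succ, this]
      ring
    rw [isLittleO_iff] at h1
    by_contra hne
    have hpos : 0 < ‖a j‖ := norm_pos_iff.2 hne
    obtain ⟨ε, hε, hε0⟩ := ((h1 (half_pos hpos)).and self_mem_nhdsWithin).exists
    have hε0 : 0 < ε := hε0
    rw [norm_mul, mul_comm] at hε
    have h2 : 0 < ‖(Real.sqrt ε : ℂ) ^ d * (ε : ℂ) ^ j‖ := by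
      rw [norm_pos_iff]
      have : (Real.sqrt ε : ℂ) ≠ 0 := by exact_mod_cast (Real.sqrt_pos.2 hε0).ne'
      have : (ε : ℂ) ≠ 0 := by exact_mod_cast hε0.ne'
      positivity
    have := le_of_mul_le_mul_right hε h2
    linarith

lemma HasGaussExpansion.unique {d : ℕ} {Φ : ℝ → ℂ} {a b : ℕ → ℂ}
    (ha : HasGaussExpansion d Φ a) (hb : HasGaussExpansion d Φ b) : a = b := by
  have h : HasGaussExpansion d (fun _ => 0) (a - b) := fun M => by
    refine ((ha M).sub (hb M)).congr_left fun ε => ?_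
    simp only [Pi.sub_apply, mul_sub, Finset.sum_sub_distrib]
    ring
  funext j
  exact sub_eq_zero.1 (h.eq_zero (isLittleO_zero _ _) j le_rfl)

/-- `exp (-c / ε)` is smaller than every power of `ε`. -/
lemma exp_neg_div_isLittleO {c : ℝ} (hc : 0 < c) (d M : ℕ) :
    (fun ε : ℝ => Real.exp (-(c / ε))) =o[𝓝[>] 0] fun ε : ℝ => Real.sqrt ε ^ d * ε ^ M := by
  have h := (isLittleO_exp_neg_mul_rpow_atTop hc (-((d + M : ℕ) : ℝ))).comp_tendsto
    tendsto_inv_nhdsGT_zero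
  refine (h.congr_left fun ε => ?_).trans_isBigO ?_
  · simp [div_eq_mul_inv]
  · refine IsBigO.of_bound 1 ?_
    have h1 : ∀ᶠ ε : ℝ in 𝓝[>] 0, ε ≤ 1 :=
      mem_nhdsWithin_of_mem_nhds (Iic_mem_nhds one_pos)
    filter_upwards [h1, self_mem_nhdsWithin] with ε h1 (h0 : 0 < ε)
    simp only [Function.comp_apply]
    rw [Real.rpow_neg (inv_nonneg.2 h0.le), Real.rpow_natCast, inv_pow, inv_inv, one_mul,
      Real.norm_of_nonneg (by positivity), Real.norm_of_nonneg (by positivity), pow_add]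
    have : ε ≤ Real.sqrt ε := Real.le_sqrt_of_sq_le (by nlinarith)
    gcongr

/-- Separates a fixed Gaussian of width ε₀, against which convergence is known, from a factor that
is exponentially small away from the origin as ε → 0. -/
lemma gauss_eq_mul {ε ε₀ : ℝ} (s : ι → ℝ) :
    gauss ε s = Real.exp (-(sumSq s * (1 / ε - 1 / ε₀))) * gauss ε₀ s := by
  rw [gauss, gauss, ← Real.exp_add]
  congr 1
  ring

/-- If `g` is bounded by `C ‖s‖ ^ K` near `0` and integrable against some
Gaussian, then its Gaussian integrals are `O(ε^{(d + K) / 2})`. -/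
lemma integral_gauss_isBigO {g : (ι → ℝ) → ℂ} {K : ℕ}
    (hg : g =O[𝓝 0] fun s => ‖s‖ ^ K) {ε₀ : ℝ} (hε₀ : 0 < ε₀)
    (hint : Integrable fun s => (gauss ε₀ s : ℂ) * g s) :
    (fun ε : ℝ => ∫ s, (gauss ε s : ℂ) * g s)
      =O[𝓝[>] 0] fun ε : ℝ => Real.sqrt ε ^ (Fintype.card ι + K) := by
  obtain ⟨C, hC0, hC⟩ := hg.exists_nonneg
  obtain ⟨ρ, hρ, hball⟩ := Metric.eventually_nhds_iff.1 hC.bound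
  set A : ℝ := ∫ s, ‖(gauss ε₀ s : ℂ) * g s‖
  set B : ℝ := ∫ s : ι → ℝ, gauss 1 s * ‖s‖ ^ K
  have key : ∀ᶠ ε : ℝ in 𝓝[>] 0, ‖∫ s, (gauss ε s : ℂ) * g s‖
      ≤ C * (Real.sqrt ε ^ (Fintype.card ι + K) * B)
        + Real.exp (-(ρ ^ 2 / ε)) * (Real.exp (ρ ^ 2 / ε₀) * A) := by
    have h1 : ∀ᶠ ε : ℝ in 𝓝[>] 0, ε ≤ ε₀ :=
      mem_nhdsWithin_of_mem_nhds (Iic_mem_nhds hε₀)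
    filter_upwards [h1, self_mem_nhdsWithin] with ε h1 (h0 : 0 < ε)
    -- Inside the ball of radius ρ the local bound on `g` applies; outside it |s|² ≥ ρ², and
    -- integrability at ε₀ leaves an exponentially small error.
    have hpt : ∀ s : ι → ℝ, ‖(gauss ε s : ℂ) * g s‖ ≤ C * (gauss ε s * ‖s‖ ^ K)
        + Real.exp (-(ρ ^ 2 * (1 / ε - 1 / ε₀))) * ‖(gauss ε₀ s : ℂ) * g s‖ := by
      intro s
      simp only [norm_mul, Complex.norm_real, Real.norm_of_nonneg (gauss_pos _ _).le]
      by_cases hs : ‖s‖ < ρ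
      · have h2 := hball (y := s) (by simpa using hs)
        rw [norm_pow, norm_norm] at h2
        have h3 : gauss ε s * ‖g s‖ ≤ gauss ε s * (C * ‖s‖ ^ K) := by
          gcongr; exact (gauss_pos _ _).le
        have h4 := gauss_pos ε₀ s
        have h5 : 0 ≤ Real.exp (-(ρ ^ 2 * (1 / ε - 1 / ε₀))) * (gauss ε₀ s * ‖g s‖) := by
          positivity
        nlinarith
      · have h2 : ρ ^ 2 ≤ sumSq s :=
          (pow_le_pow_left₀ hρ.le (not_lt.1 hs) 2).trans (norm_sq_le_sumSq s)
        have h3 : 0 ≤ 1 / ε - 1 / ε₀ := sub_nonneg.2 (one_div_le_one_div_of_le h0 h1)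
        have h4 := gauss_pos ε₀ s
        have h5 := gauss_pos ε s
        have h6 : gauss ε s * ‖g s‖
            ≤ Real.exp (-(ρ ^ 2 * (1 / ε - 1 / ε₀))) * (gauss ε₀ s * ‖g s‖) := by
          rw [gauss_eq_mul (ε₀ := ε₀), mul_assoc]
          gcongr
        have h7 : 0 ≤ C * (gauss ε s * ‖s‖ ^ K) := by positivity
        linarith
    have hi1 := (integrable_gauss_mul_norm_pow (ι := ι) h0 K).const_mul C
    have hi2 := hint.norm.const_mul (Real.exp (-(ρ ^ 2 * (1 / ε - 1 / ε₀))))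
    refine (norm_integral_le_of_norm_le (hi1.add hi2) (Eventually.of_forall hpt)).trans ?_
    simp only [Pi.add_apply]
    rw [integral_add hi1 hi2, integral_const_mul, integral_const_mul]
    refine le_of_eq ?_
    congr 1
    · congr 1
      have h2 := integral_gauss_eq h0 (fun s : ι → ℝ => ((‖s‖ ^ K : ℝ) : ℂ))
      simp only [norm_smul, Real.norm_of_nonneg (Real.sqrt_nonneg ε)] at h2
      norm_cast at h2
      rw [h2, pow_add, mul_assoc]
      congr 1
      rw [← integral_const_mul]
      congr 1
      funext s
      rw [mul_pow]
      ring
    · rw [← mul_assoc, ← Real.exp_add]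
      congr 2
      ring
  refine (IsBigO.of_bound 1 (key.mono fun ε h => ?_)).trans
    ((IsBigO.add ?_ ?_ : (fun ε => C * (Real.sqrt ε ^ (Fintype.card ι + K) * B)
        + Real.exp (-(ρ ^ 2 / ε)) * (Real.exp (ρ ^ 2 / ε₀) * A)) =O[𝓝[>] 0] _))
  · rw [one_mul]; exact h.trans (le_abs_self _)
  · refine IsBigO.const_mul_left ?_ _
    simpa [mul_comm] using (isBigO_refl (fun ε : ℝ => Real.sqrt ε ^ (Fintype.card ι + K))
      (𝓝[>] 0)).const_mul_left B
  · have := (exp_neg_div_isLittleO (pow_pos hρ 2) (Fintype.card ι + K) 0).isBigO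
    simpa [mul_comm] using this.const_mul_left (Real.exp (ρ ^ 2 / ε₀) * A)

/-- Watson's lemma: the expansion of the Gaussian integrals of a smooth function. -/
theorem hasGaussExpansion {f : (ι → ℝ) → ℂ} (hf : ContDiff ℝ ∞ f) {ε₀ : ℝ} (hε₀ : 0 < ε₀)
    (hint : Integrable fun s => (gauss ε₀ s : ℂ) * f s) :
    HasGaussExpansion (Fintype.card ι) (fun ε => ∫ s, (gauss ε s : ℂ) * f s) (gaussCoeff f) := by
  intro M
  -- Stopping at the odd degree 2M + 1 leaves a remainder O(‖s‖^(2M+2)), whose Gaussian integral is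
  -- smaller than √ε^d ε^M by a factor ε.
  obtain ⟨C, hC0, hC⟩ := exists_taylor_bound hf (2 * M + 1)
  set T : (ι → ℝ) → ℂ := fun s => ∑ k ∈ Finset.range (2 * (M + 1)), taylorTerm f k s with hT
  have hTint : ∀ ε : ℝ, 0 < ε → Integrable fun s => (gauss ε s : ℂ) * T s := by
    intro ε hε
    simp only [hT, Finset.mul_sum]
    exact integrable_finsetSum _ fun k _ => integrable_gauss_mul_taylorTerm hε f k
  have hO : (fun s => f s - T s) =O[𝓝 0] fun s => ‖s‖ ^ (2 * M + 2) := by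
    refine IsBigO.of_bound C ?_
    filter_upwards [Metric.closedBall_mem_nhds (0 : ι → ℝ) one_pos] with s hs
    rw [norm_pow, norm_norm]
    exact hC s (by simpa using hs)
  have hmain := integral_gauss_isBigO hO hε₀ (by
    simp only [mul_sub]
    exact hint.sub (hTint ε₀ hε₀))
  have h1 : ∀ᶠ ε : ℝ in 𝓝[>] 0, Integrable fun s => (gauss ε s : ℂ) * f s := by
    have h1 : ∀ᶠ ε : ℝ in 𝓝[>] 0, ε ≤ ε₀ :=
      mem_nhdsWithin_of_mem_nhds (Iic_mem_nhds hε₀)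
    filter_upwards [h1, self_mem_nhdsWithin] with ε h1 (h0 : 0 < ε)
    refine hint.mono (by have := hf.continuous; fun_prop) (Eventually.of_forall fun s => ?_)
    simp only [norm_mul, Complex.norm_real, Real.norm_of_nonneg (gauss_pos _ _).le]
    refine mul_le_mul_of_nonneg_right ?_ (norm_nonneg _)
    have := sumSq_nonneg s
    unfold gauss
    gcongr
  refine (hmain.congr' ?_ EventuallyEq.rfl).trans_isLittleO ?_
  · filter_upwards [h1, self_mem_nhdsWithin] with ε h1 (h0 : 0 < ε)
    rw [← integral_gauss_taylor h0, ← integral_sub h1 (hTint ε h0)]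
    simp only [mul_sub, hT]
  · have h2 : (fun ε : ℝ => Real.sqrt ε ^ 2) =o[𝓝[>] 0] fun _ => (1 : ℝ) := by
      rw [isLittleO_one_iff]
      have : Tendsto (fun ε : ℝ => Real.sqrt ε ^ 2) (𝓝 0) (𝓝 (Real.sqrt 0 ^ 2)) :=
        (Real.continuous_sqrt.pow 2).tendsto 0
      simpa using this.mono_left nhdsWithin_le_nhds
    have h3 := (isBigO_refl (fun ε : ℝ => Real.sqrt ε ^ Fintype.card ι * ε ^ M)
      (𝓝[>] 0)).mul_isLittleO h2
    refine h3.congr' ?_ (by simp)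
    filter_upwards [self_mem_nhdsWithin] with ε (h0 : 0 < ε)
    rw [pow_add, pow_add, pow_mul, Real.sq_sqrt h0.le, mul_assoc, ← Real.sq_sqrt h0.le]

end GaussianExpansion

/-! ### Rules for expansion coefficients: locality, integration by parts, Euler's identity -/

namespace GaussianExpansion
open scoped ContDiff

variable {ι : Type*} [Fintype ι]

lemma sqrt_pow_isLittleO (d M : ℕ) :
    (fun ε : ℝ => Real.sqrt ε ^ (d + (2 * M + 1))) =o[𝓝[>] 0]
      fun ε : ℝ => Real.sqrt ε ^ d * ε ^ M := by
  have h2 : (fun ε : ℝ => Real.sqrt ε) =o[𝓝[>] 0] fun _ => (1 : ℝ) := by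
    rw [isLittleO_one_iff]
    simpa using (Real.continuous_sqrt.tendsto 0).mono_left nhdsWithin_le_nhds
  have h3 := (isBigO_refl (fun ε : ℝ => Real.sqrt ε ^ d * ε ^ M) (𝓝[>] 0)).mul_isLittleO h2
  refine h3.congr' ?_ (by simp)
  filter_upwards [self_mem_nhdsWithin] with ε (h0 : 0 < ε)
  rw [pow_add, pow_add, pow_mul, Real.sq_sqrt h0.le, pow_one, mul_assoc]

lemma integrable_gauss_mul_of_hasCompactSupport (ε : ℝ) {f : (ι → ℝ) → ℂ} (hf : Continuous f)
    (hs : HasCompactSupport f) : Integrable fun s => (gauss ε s : ℂ) * f s :=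
  Continuous.integrable_of_hasCompactSupport (by fun_prop) hs.mul_left

lemma taylorTerm_congr {f g : (ι → ℝ) → ℂ} (h : f =ᶠ[𝓝 0] g) (k : ℕ) :
    taylorTerm f k = taylorTerm g k := by
  funext s
  rw [taylorTerm, taylorTerm, (h.iteratedFDeriv ℝ k).eq_of_nhds]

lemma gaussCoeff_congr {f g : (ι → ℝ) → ℂ} (h : f =ᶠ[𝓝 0] g) (m : ℕ) :
    gaussCoeff f m = gaussCoeff g m := by
  rw [gaussCoeff, gaussCoeff, taylorTerm_congr h]

lemma gaussCoeff_add {f g : (ι → ℝ) → ℂ} (hf : ContDiff ℝ ∞ f) (hg : ContDiff ℝ ∞ g) (m : ℕ) :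
    gaussCoeff (fun s => f s + g s) m = gaussCoeff f m + gaussCoeff g m := by
  rw [gaussCoeff, gaussCoeff, gaussCoeff,
    ← integral_add (integrable_gauss_mul_taylorTerm one_pos _ _)
      (integrable_gauss_mul_taylorTerm one_pos _ _)]
  congr 1
  funext s
  have h : iteratedFDeriv ℝ (2 * m) (fun s => f s + g s) 0
      = iteratedFDeriv ℝ (2 * m) f 0 + iteratedFDeriv ℝ (2 * m) g 0 :=
    iteratedFDeriv_add_apply (contDiff_infty.1 hf (2 * m)).contDiffAt
      (contDiff_infty.1 hg (2 * m)).contDiffAt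
  rw [taylorTerm, taylorTerm, taylorTerm, h, add_apply, smul_add, mul_add]

lemma gaussCoeff_const_mul {f : (ι → ℝ) → ℂ} (hf : ContDiff ℝ ∞ f) (c : ℂ) (m : ℕ) :
    gaussCoeff (fun s => c * f s) m = c * gaussCoeff f m := by
  rw [gaussCoeff, gaussCoeff, ← integral_const_mul]
  congr 1
  funext s
  have h : iteratedFDeriv ℝ (2 * m) (fun s => c * f s) 0
      = c • iteratedFDeriv ℝ (2 * m) f 0 :=
    iteratedFDeriv_const_smul_apply (a := c) (f := f) (contDiff_infty.1 hf (2 * m)).contDiffAt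
  rw [taylorTerm, taylorTerm, h, smul_apply, smul_comm, smul_eq_mul]
  ring

lemma gaussCoeff_zero (m : ℕ) : gaussCoeff (fun _ : ι → ℝ => 0) m = 0 := by
  simpa using gaussCoeff_const_mul (contDiff_const (c := (0 : ℂ)) (E := ι → ℝ)) 0 m

lemma gaussCoeff_sum {α : Type*} (S : Finset α) {f : α → (ι → ℝ) → ℂ}
    (hf : ∀ i, ContDiff ℝ ∞ (f i)) (m : ℕ) :
    gaussCoeff (fun s => ∑ i ∈ S, f i s) m = ∑ i ∈ S, gaussCoeff (f i) m := by
  classical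
  induction S using Finset.induction_on with
  | empty => simp [gaussCoeff_zero]
  | insert i S hi ih =>
    simp only [Finset.sum_insert hi]
    rw [gaussCoeff_add (hf i) (ContDiff.sum fun i _ => hf i), ih]

lemma gaussCoeff_apply_zero (f : (ι → ℝ) → ℂ) :
    gaussCoeff f 0 = (Real.sqrt Real.pi : ℂ) ^ Fintype.card ι * f 0 := by
  have h : ∀ s : ι → ℝ, taylorTerm f (2 * 0) s = f 0 := fun s => by
    simp [taylorTerm]
  simp only [gaussCoeff, h]
  rw [integral_mul_const, integral_complex_ofReal, integral_gauss_one, Complex.ofReal_pow]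

/-- Every germ of a smooth function at `0` is represented by one with compact support. -/
lemma exists_cutoff {f : (ι → ℝ) → ℂ} (hf : ContDiff ℝ ∞ f) :
    ∃ g : (ι → ℝ) → ℂ, ContDiff ℝ ∞ g ∧ HasCompactSupport g ∧ g =ᶠ[𝓝 0] f := by
  let χ : ContDiffBump (0 : ι → ℝ) := ⟨1, 2, one_pos, one_lt_two⟩
  refine ⟨fun s => (χ s : ℂ) * f s, ?_, ?_, ?_⟩
  · have : ContDiff ℝ ∞ (fun s => (χ s : ℂ)) := Complex.ofRealCLM.contDiff.comp χ.contDiff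
    exact this.mul hf
  · have : HasCompactSupport (fun s => (χ s : ℂ)) :=
      χ.hasCompactSupport.comp_left (g := fun x : ℝ => (x : ℂ)) Complex.ofReal_zero
    exact this.mul_right
  · filter_upwards [χ.eventuallyEq_one] with s hs
    simp [hs]

/-- The coefficient depends only on the germ at 0, so `f` may be cut off to make its Gaussian
integral converge. That integral is then o(√ε^d ε^m), and the coefficients up to m vanish. -/
lemma gaussCoeff_eq_zero_of_isBigO {f : (ι → ℝ) → ℂ} (hf : ContDiff ℝ ∞ f) {m : ℕ}
    (hO : f =O[𝓝 0] fun s => ‖s‖ ^ (2 * m + 1)) : gaussCoeff f m = 0 := by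
  obtain ⟨g, hg, hgs, hgf⟩ := exists_cutoff hf
  rw [← gaussCoeff_congr hgf]
  have hint := integrable_gauss_mul_of_hasCompactSupport 1 hg.continuous hgs
  refine (hasGaussExpansion hg one_pos hint).eq_zero ?_ m le_rfl
  exact (integral_gauss_isBigO (hO.congr' hgf.symm EventuallyEq.rfl) one_pos hint).trans_isLittleO
    (sqrt_pow_isLittleO _ _)

/-- Restriction to the ray through s reduces identities between homogeneous parts to calculus in one
variable. -/
lemma taylorTerm_eq_iteratedDeriv {f : (ι → ℝ) → ℂ} (hf : ContDiff ℝ ∞ f) (k : ℕ) (s : ι → ℝ) :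
    taylorTerm f k s = (k.factorial : ℝ)⁻¹ • iteratedDeriv k (fun τ : ℝ => f (τ • s)) 0 := by
  have h := ContinuousLinearMap.iteratedFDeriv_comp_right
    (ContinuousLinearMap.toSpanSingleton ℝ s) hf (0 : ℝ) (i := k) (by exact_mod_cast le_top)
  rw [taylorTerm, iteratedDeriv_eq_iteratedFDeriv]
  have h2 : (f ∘ ContinuousLinearMap.toSpanSingleton ℝ s) = fun τ : ℝ => f (τ • s) := rfl
  rw [← h2, h]
  simp

/-- Leibniz' rule for the product with the coordinate. -/
lemma iteratedDeriv_id_mul {g : ℝ → ℂ} (hg : ContDiff ℝ ∞ g) (k : ℕ) :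
    iteratedDeriv k (fun τ : ℝ => (τ : ℂ) * deriv g τ)
      = fun τ : ℝ => (τ : ℂ) * iteratedDeriv (k + 1) g τ + k * iteratedDeriv k g τ := by
  induction k with
  | zero => simp [iteratedDeriv_one]
  | succ k ih =>
    funext τ
    rw [iteratedDeriv_succ, ih]
    have hd : ∀ k : ℕ, HasDerivAt (iteratedDeriv k g) (iteratedDeriv (k + 1) g τ) τ := fun k => by
      rw [iteratedDeriv_succ]
      exact ((hg.differentiable_iteratedDeriv k (by exact_mod_cast ENat.natCast_lt_top k)) τ).hasDerivAt
    have h1 : HasDerivAt (fun τ : ℝ => (τ : ℂ)) 1 τ := Complex.ofRealCLM.hasDerivAt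
    rw [((h1.fun_mul (hd (k + 1))).fun_add ((hd k).const_mul (k : ℂ))).deriv]
    push_cast
    ring

variable [DecidableEq ι]

/-- The partial derivative in the `j`-th coordinate. -/
noncomputable def pd (j : ι) (f : (ι → ℝ) → ℂ) (s : ι → ℝ) : ℂ :=
  fderiv ℝ f s (Pi.single j 1)

lemma contDiff_pd {f : (ι → ℝ) → ℂ} (hf : ContDiff ℝ ∞ f) (j : ι) : ContDiff ℝ ∞ (pd j f) :=
  (hf.fderiv_right (m := ∞) le_rfl).clm_apply contDiff_const

lemma fderiv_gauss_apply (ε : ℝ) (s : ι → ℝ) (j : ι) :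
    fderiv ℝ (fun s : ι → ℝ => (gauss ε s : ℂ)) s (Pi.single j 1)
      = -(2 / ε * s j * gauss ε s : ℝ) := by
  have h1 : HasFDerivAt (sumSq : (ι → ℝ) → ℝ)
      (∑ i, (2 * s i) • ContinuousLinearMap.proj (R := ℝ) (φ := fun _ : ι => ℝ) i) s := by
    unfold sumSq
    refine HasFDerivAt.fun_sum fun i _ => ?_
    simpa using (ContinuousLinearMap.proj (R := ℝ) (φ := fun _ : ι => ℝ) i).hasFDerivAt.pow 2
      (x := s)
  have h2 := ((h1.mul_const ε⁻¹).neg.exp)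
  have h3 := Complex.ofRealCLM.hasFDerivAt.comp s h2
  have h4 : (Complex.ofRealCLM ∘ fun x => Real.exp ((-fun y => sumSq y * ε⁻¹) x))
      = fun s : ι → ℝ => (gauss ε s : ℂ) := by
    funext s; simp [gauss, div_eq_mul_inv]
  rw [h4] at h3
  rw [h3.fderiv]
  simp [Pi.single_apply, gauss, div_eq_mul_inv]
  ring

/-- Since s_j exp(-|s|²/ε) = -(ε/2) ∂_j exp(-|s|²/ε), this is integration by parts; compact support
gives the integrability it requires. -/
lemma integral_gauss_coord_mul {ε : ℝ} (hε : 0 < ε) {f : (ι → ℝ) → ℂ} (hf : ContDiff ℝ ∞ f)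
    (hs : HasCompactSupport f) (j : ι) :
    ∫ s, (gauss ε s : ℂ) * ((s j : ℂ) * f s)
      = (ε / 2 : ℂ) * ∫ s, (gauss ε s : ℂ) * pd j f s := by
  have hg : ContDiff ℝ ∞ (fun s : ι → ℝ => (gauss ε s : ℂ)) := by
    exact Complex.ofRealCLM.contDiff.comp ((contDiff_sumSq.div_const ε).neg).exp
  have hps : HasCompactSupport (pd j f) := hs.fderiv_apply (𝕜 := ℝ) _
  have h := integral_mul_fderiv_eq_neg_fderiv_mul_of_integrable (μ := (volume : Measure (ι → ℝ)))
    (f := fun s : ι → ℝ => (gauss ε s : ℂ)) (g := f) (v := Pi.single j 1)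
    (Continuous.integrable_of_hasCompactSupport
      ((contDiff_pd hg j).continuous.mul hf.continuous) hs.mul_left)
    (integrable_gauss_mul_of_hasCompactSupport ε (contDiff_pd hf j).continuous hps)
    (integrable_gauss_mul_of_hasCompactSupport ε hf.continuous hs)
    (fun x _ => (hg.differentiable (by simp)) x) (fun x _ => (hf.differentiable (by simp)) x)
  simp only [fderiv_gauss_apply] at h
  change ∫ s, (gauss ε s : ℂ) * pd j f s = _ at h
  rw [h, ← integral_neg, ← integral_const_mul]
  congr 1
  funext s
  have : (ε : ℂ) ≠ 0 := by exact_mod_cast hε.ne'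
  push_cast
  field_simp

/-- The factor ε/2 from integration by parts shifts the index by one. After a cutoff both sides
expand the same integral, and uniqueness of expansions identifies the coefficients. -/
lemma gaussCoeff_coord_mul {f : (ι → ℝ) → ℂ} (hf : ContDiff ℝ ∞ f) (j : ι) :
    gaussCoeff (fun s => (s j : ℂ) * f s) 0 = 0 ∧
    ∀ m, gaussCoeff (fun s => (s j : ℂ) * f s) (m + 1) = 1 / 2 * gaussCoeff (pd j f) m := by
  obtain ⟨g, hg, hgs, hgf⟩ := exists_cutoff hf
  have e1 : (fun s => (s j : ℂ) * g s) =ᶠ[𝓝 0] fun s => (s j : ℂ) * f s := by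
    filter_upwards [hgf] with s hs
    rw [hs]
  have e2 : pd j g =ᶠ[𝓝 0] pd j f := by
    filter_upwards [hgf.fderiv (𝕜 := ℝ)] with s hs
    rw [pd, pd, hs]
  simp only [← gaussCoeff_congr e1, ← gaussCoeff_congr e2]
  have hgc : ContDiff ℝ ∞ (fun s : ι → ℝ => (s j : ℂ) * g s) := by
    have : ContDiff ℝ ∞ (fun s : ι → ℝ => (s j : ℂ)) :=
      Complex.ofRealCLM.contDiff.comp (contDiff_apply ℝ ℝ j)
    exact this.mul hg
  refine ⟨by rw [gaussCoeff_apply_zero]; simp, fun m => ?_⟩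
  have hA := hasGaussExpansion hgc one_pos
    (integrable_gauss_mul_of_hasCompactSupport 1 hgc.continuous hgs.mul_left)
  have hB := hasGaussExpansion (contDiff_pd hg j) one_pos
    (integrable_gauss_mul_of_hasCompactSupport 1 (contDiff_pd hg j).continuous
      (hgs.fderiv_apply (𝕜 := ℝ) _))
  have hC : HasGaussExpansion (Fintype.card ι)
      (fun ε => ∫ s, (gauss ε s : ℂ) * ((s j : ℂ) * g s))
      (fun k => if k = 0 then 0 else 1 / 2 * gaussCoeff (pd j g) (k - 1)) := by
    intro M
    cases M with
    | zero =>
      have hε : (fun ε : ℝ => (ε / 2 : ℂ)) =o[𝓝[>] 0] fun ε : ℝ => (1 : ℝ) := by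
        rw [isLittleO_one_iff]
        have : Tendsto (fun ε : ℝ => (ε / 2 : ℂ)) (𝓝 0) (𝓝 ((0 : ℝ) / 2 : ℂ)) :=
          Continuous.tendsto (by fun_prop) 0
        simpa using this.mono_left nhdsWithin_le_nhds
      have hO : (fun ε : ℝ => ∫ s, (gauss ε s : ℂ) * pd j g s)
          =O[𝓝[>] 0] fun ε : ℝ => Real.sqrt ε ^ Fintype.card ι := by
        refine integral_gauss_isBigO (K := 0) ?_ one_pos
          (integrable_gauss_mul_of_hasCompactSupport 1 (contDiff_pd hg j).continuous
            (hgs.fderiv_apply (𝕜 := ℝ) _))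
        simpa using ((contDiff_pd hg j).continuous.tendsto 0).isBigO_one ℝ
      refine (hε.mul_isBigO hO).congr' ?_ (by simp)
      filter_upwards [self_mem_nhdsWithin] with ε (h0 : 0 < ε)
      rw [integral_gauss_coord_mul h0 hg hgs]
      simp
    | succ M =>
      have hε : (fun ε : ℝ => (ε / 2 : ℂ)) =O[𝓝[>] 0] fun ε : ℝ => ε := by
        refine IsBigO.of_bound 1 (Eventually.of_forall fun ε => ?_)
        rw [norm_div, Complex.norm_real, one_mul, Complex.norm_two]
        linarith [norm_nonneg ε]
      refine (hε.mul_isLittleO (hB M)).congr' ?_ (by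
        filter_upwards with ε; ring)
      filter_upwards [self_mem_nhdsWithin] with ε (h0 : 0 < ε)
      rw [integral_gauss_coord_mul h0 hg hgs, Finset.sum_range_succ' _ (M + 1)]
      have e : ∑ k ∈ Finset.range (M + 1), (ε : ℂ) ^ (k + 1) * (1 / 2 * gaussCoeff (pd j g) k)
          = ε / 2 * ∑ k ∈ Finset.range (M + 1), (ε : ℂ) ^ k * gaussCoeff (pd j g) k := by
        rw [Finset.mul_sum]
        exact Finset.sum_congr rfl fun k _ => by ring
      simp only [Nat.add_eq_zero_iff, one_ne_zero, and_false, if_false, Nat.add_sub_cancel,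
        if_true, mul_zero, add_zero]
      rw [e]
      ring
  simp [hA.unique hC]

/-- Euler's identity for the homogeneous parts of the Taylor expansion. -/
lemma taylorTerm_euler {f : (ι → ℝ) → ℂ} (hf : ContDiff ℝ ∞ f) (k : ℕ) :
    taylorTerm (fun s => ∑ j, (s j : ℂ) * pd j f s) k = fun s => k * taylorTerm f k s := by
  funext s
  have hc : ∀ j, ContDiff ℝ ∞ (fun s : ι → ℝ => (s j : ℂ)) := fun j =>
    Complex.ofRealCLM.contDiff.comp (contDiff_apply ℝ ℝ j)
  have hg : ContDiff ℝ ∞ (fun τ : ℝ => f (τ • s)) :=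
    hf.comp (contDiff_id.smul contDiff_const)
  rw [taylorTerm_eq_iteratedDeriv (ContDiff.sum fun j _ => (hc j).mul (contDiff_pd hf j)),
    taylorTerm_eq_iteratedDeriv hf]
  have h : (fun τ : ℝ => ∑ j, ((τ • s) j : ℂ) * pd j f (τ • s))
      = fun τ : ℝ => (τ : ℂ) * deriv (fun τ : ℝ => f (τ • s)) τ := by
    funext τ
    have h1 : HasDerivAt (fun τ : ℝ => f (τ • s)) (fderiv ℝ f (τ • s) s) τ := by
      have h2 : HasDerivAt (fun τ : ℝ => τ • s) s τ := by
        simpa using (hasDerivAt_id τ).smul_const s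
      exact ((hf.differentiable (by simp)) (τ • s)).hasFDerivAt.comp_hasDerivAt τ h2
    rw [h1.deriv]
    conv_rhs => rw [pi_eq_sum_univ' s]
    rw [map_sum, Finset.mul_sum]
    refine Finset.sum_congr rfl fun j _ => ?_
    rw [map_smul, pd, Complex.real_smul, Pi.smul_apply, smul_eq_mul, Complex.ofReal_mul, mul_assoc]
    congr 3
    congr 1
    funext i
    simp [Pi.single_apply]
  rw [h, iteratedDeriv_id_mul hg]
  simp only [Complex.ofReal_zero, zero_mul, zero_add, Complex.real_smul]
  ring

/-- The m-th coefficient only sees the Taylor term of degree 2m, on which the Euler field acts as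
multiplication by 2m. -/
lemma gaussCoeff_euler {f : (ι → ℝ) → ℂ} (hf : ContDiff ℝ ∞ f) (m : ℕ) :
    gaussCoeff (fun s => ∑ j, (s j : ℂ) * pd j f s) m = 2 * m * gaussCoeff f m := by
  rw [gaussCoeff, gaussCoeff, taylorTerm_euler hf, ← integral_const_mul]
  congr 1
  funext s
  push_cast
  ring

lemma pd_coord_mul {f : (ι → ℝ) → ℂ} (hf : ContDiff ℝ ∞ f) (j : ι) (s : ι → ℝ) :
    pd j (fun s => (s j : ℂ) * f s) s = f s + s j * pd j f s := by
  have h1 : HasFDerivAt (fun s : ι → ℝ => (s j : ℂ))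
      (Complex.ofRealCLM.comp (ContinuousLinearMap.proj (R := ℝ) (φ := fun _ : ι => ℝ) j)) s :=
    (Complex.ofRealCLM.comp
      (ContinuousLinearMap.proj (R := ℝ) (φ := fun _ : ι => ℝ) j)).hasFDerivAt
  have h2 := h1.fun_mul ((hf.differentiable (by simp)) s).hasFDerivAt
  rw [pd, HasFDerivAt.fderiv h2]
  simp [pd]
  ring

/-- Integration by parts applied to s_j · (s_j f), summed over j, produces half of d·f plus the
Euler field applied to f, that is (d + 2m)/2 on coefficients. -/
lemma gaussCoeff_sumSq_mul {f : (ι → ℝ) → ℂ} (hf : ContDiff ℝ ∞ f) (m : ℕ) :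
    gaussCoeff (fun s => (sumSq s : ℂ) * f s) (m + 1)
      = (Fintype.card ι / 2 + m) * gaussCoeff f m := by
  have hc : ∀ j, ContDiff ℝ ∞ (fun s : ι → ℝ => (s j : ℂ)) := fun j =>
    Complex.ofRealCLM.contDiff.comp (contDiff_apply ℝ ℝ j)
  have h1 : (fun s : ι → ℝ => (sumSq s : ℂ) * f s)
      = fun s => ∑ j, (s j : ℂ) * ((s j : ℂ) * f s) := by
    funext s
    simp only [sumSq]
    push_cast
    rw [Finset.sum_mul]
    exact Finset.sum_congr rfl fun j _ => by ring
  rw [h1, gaussCoeff_sum _ fun j => (hc j).mul ((hc j).mul hf)]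
  simp_rw [fun j => (gaussCoeff_coord_mul ((hc j).mul hf) j).2 m]
  rw [← Finset.mul_sum, ← gaussCoeff_sum _ fun j => contDiff_pd ((hc j).mul hf) j]
  simp_rw [pd_coord_mul hf, Finset.sum_add_distrib]
  simp only [Finset.sum_const, Finset.card_univ, nsmul_eq_mul]
  rw [gaussCoeff_add (contDiff_const.mul hf) (ContDiff.sum fun j _ => (hc j).mul (contDiff_pd hf j)),
    gaussCoeff_euler hf, gaussCoeff_const_mul hf]
  ring

end GaussianExpansion

/-! ### Jacobians, the Piola identity and integration by parts in the target -/

namespace GaussianExpansion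
open scoped ContDiff

variable {ι : Type*} [Fintype ι] [DecidableEq ι]

lemma contDiff_det {M : (ι → ℝ) → Matrix ι ι ℂ} (h : ∀ i j, ContDiff ℝ ∞ fun s => M s i j) :
    ContDiff ℝ ∞ fun s => (M s).det := by
  simp only [Matrix.det_apply']
  exact ContDiff.sum fun σ _ => contDiff_const.mul (contDiff_prod fun i _ => h _ _)

lemma contDiff_adjugate {M : (ι → ℝ) → Matrix ι ι ℂ} (h : ∀ i j, ContDiff ℝ ∞ fun s => M s i j)
    (i j : ι) : ContDiff ℝ ∞ fun s => (M s).adjugate i j := by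
  simp only [Matrix.adjugate_apply]
  refine contDiff_det fun k l => ?_
  by_cases hk : k = j
  · subst hk
    simp only [Matrix.updateRow_self]
    exact contDiff_const
  · simp only [Matrix.updateRow_ne hk]
    exact h k l

lemma det_updateRow_eq_sum {R : Type*} [CommRing R] (A : Matrix ι ι R) (i : ι) (b : ι → R) :
    (A.updateRow i b).det = ∑ j, b j * A.adjugate j i := by
  rw [Matrix.det_eq_sum_mul_adjugate_row _ i]
  refine Finset.sum_congr rfl fun j _ => ?_
  rw [Matrix.updateRow_self, Matrix.adjugate_apply, Matrix.adjugate_apply, Matrix.updateRow_idem]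

/-- Jacobi's formula for the derivative of a determinant. -/
lemma pd_det {M : (ι → ℝ) → Matrix ι ι ℂ} (h : ∀ i j, ContDiff ℝ ∞ fun s => M s i j)
    (l : ι) (s : ι → ℝ) :
    pd l (fun s => (M s).det) s
      = ∑ i, ∑ j, pd l (fun s => M s i j) s * (M s).adjugate j i := by
  -- The determinant as a multilinear function of the rows: its derivative is a sum over replaced
  -- rows, which Laplace expansion turns into adjugate entries.
  let D : ContinuousMultilinearMap ℂ (fun _ : ι => ι → ℂ) ℂ :=
    { toMultilinearMap := (Matrix.detRowAlternating (R := ℂ) (n := ι)).toMultilinearMap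
      cont := Continuous.matrix_det (A := fun A : Matrix ι ι ℂ => A) continuous_id }
  have hM : HasFDerivAt (fun s => (M s : ι → ι → ℂ))
      (ContinuousLinearMap.pi fun i => ContinuousLinearMap.pi fun j =>
        fderiv ℝ (fun s => M s i j) s) s :=
    hasFDerivAt_pi.2 fun i => hasFDerivAt_pi.2 fun j =>
      (((h i j).differentiable (by simp)) s).hasFDerivAt
  have hD := ((D.hasFDerivAt (M s)).restrictScalars ℝ).comp s hM
  have hf : (fun s => (M s).det) = D ∘ fun s => (M s : ι → ι → ℂ) := rfl
  rw [pd, hf, hD.fderiv]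
  refine (D.linearDeriv_apply _ _).trans (Finset.sum_congr rfl fun i _ => ?_)
  exact det_updateRow_eq_sum (M s) i _

lemma pd_mul {f g : (ι → ℝ) → ℂ} (hf : ContDiff ℝ ∞ f) (hg : ContDiff ℝ ∞ g) (j : ι)
    (s : ι → ℝ) : pd j (fun s => f s * g s) s = pd j f s * g s + f s * pd j g s := by
  have h := ((hf.differentiable (by simp)) s).hasFDerivAt.fun_mul
    ((hg.differentiable (by simp)) s).hasFDerivAt
  rw [pd, h.fderiv]
  simp [pd]
  ring

lemma pd_add {f g : (ι → ℝ) → ℂ} (hf : ContDiff ℝ ∞ f) (hg : ContDiff ℝ ∞ g) (j : ι)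
    (s : ι → ℝ) : pd j (fun s => f s + g s) s = pd j f s + pd j g s := by
  have h := ((hf.differentiable (by simp)) s).hasFDerivAt.fun_add
    ((hg.differentiable (by simp)) s).hasFDerivAt
  rw [pd, h.fderiv]
  simp [pd]

lemma pd_sum {α : Type*} (S : Finset α) {f : α → (ι → ℝ) → ℂ} (hf : ∀ i, ContDiff ℝ ∞ (f i))
    (j : ι) (s : ι → ℝ) : pd j (fun s => ∑ i ∈ S, f i s) s = ∑ i ∈ S, pd j (f i) s := by
  have h := HasFDerivAt.fun_sum (u := S)
    fun i _ => (((hf i).differentiable (by simp)) s).hasFDerivAt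
  rw [pd, h.fderiv]
  simp [pd]

lemma pd_pd_comm {f : (ι → ℝ) → ℂ} (hf : ContDiff ℝ ∞ f) (i j : ι) (s : ι → ℝ) :
    pd i (pd j f) s = pd j (pd i f) s := by
  have h1 : ∀ i j : ι, pd i (pd j f) s
      = fderiv ℝ (fderiv ℝ f) s (Pi.single i 1) (Pi.single j 1) := by
    intro i j
    have h2 : HasFDerivAt (fderiv ℝ f) (fderiv ℝ (fderiv ℝ f) s) s :=
      (((hf.fderiv_right (m := ∞) le_rfl).differentiable (by simp)) s).hasFDerivAt
    have h3 := h2.clm_apply (hasFDerivAt_const (Pi.single j (1 : ℝ) : ι → ℝ) s)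
    have h4 : pd j f = fun y => fderiv ℝ f y (Pi.single j 1) := rfl
    rw [pd, h4, h3.fderiv]
    simp
  rw [h1, h1]
  refine second_derivative_symmetric (f := f) (f' := fderiv ℝ f) (x := s) (fun y => ?_) ?_ _ _
  · exact ((hf.differentiable (by simp)) y).hasFDerivAt
  · exact (((hf.fderiv_right (m := ∞) le_rfl).differentiable (by simp)) s).hasFDerivAt

/-- The Jacobian matrix of a map `ℝ^ι → ℂ^ι`. -/
noncomputable def jac (γ : (ι → ℝ) → (ι → ℂ)) (s : ι → ℝ) : Matrix ι ι ℂ :=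
  Matrix.of fun i j => pd j (fun s => γ s i) s

variable {γ : (ι → ℝ) → (ι → ℂ)}

lemma contDiff_jac (hγ : ContDiff ℝ ∞ γ) (i j : ι) : ContDiff ℝ ∞ fun s => jac γ s i j :=
  contDiff_pd (contDiff_pi.1 hγ i) j

/-- The Piola identity: the rows of the adjugate of a Jacobian are divergence free. -/
lemma piola (hγ : ContDiff ℝ ∞ γ) {s : ι → ℝ} (hs : (jac γ s).det ≠ 0) (k : ι) :
    ∑ j, pd j (fun s => (jac γ s).adjugate j k) s = 0 := by
  have hJ := contDiff_jac hγ
  have hA := contDiff_adjugate hJ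
  set v : ι → ℂ := fun k => ∑ j, pd j (fun s => (jac γ s).adjugate j k) s with hv
  suffices h : v = 0 from congrFun h k
  -- Since J is invertible at s, it suffices that v J = 0. The divergence of adj(J) J = (det J)·1 is
  -- ∂_l det J; the terms that differentiate J already account for all of it, by Jacobi's formula
  -- and the symmetry of second derivatives.
  refine Matrix.eq_zero_of_vecMul_eq_zero hs ?_
  funext l
  have h1 : ∀ j, pd j (fun s => ∑ k, (jac γ s).adjugate j k * jac γ s k l) s
      = if j = l then pd l (fun s => (jac γ s).det) s else 0 := by
    intro j
    have h2 : (fun s => ∑ k, (jac γ s).adjugate j k * jac γ s k l)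
        = fun s => if j = l then (jac γ s).det else 0 := by
      funext s
      rw [← Matrix.mul_apply, Matrix.adjugate_mul, Matrix.smul_apply, Matrix.one_apply]
      simp
    rw [h2]
    split_ifs with hjl
    · rw [hjl]
    · simp [pd]
  have h3 : ∑ j, pd j (fun s => ∑ k, (jac γ s).adjugate j k * jac γ s k l) s
      = pd l (fun s => (jac γ s).det) s := by
    simp [h1]
  simp_rw [pd_sum Finset.univ fun k => (hA _ k).mul (hJ k l), pd_mul (hA _ _) (hJ _ l),
    pd_det hJ, Finset.sum_add_distrib] at h3
  have h4 : ∑ j, ∑ k, (jac γ s).adjugate j k * pd j (fun s => jac γ s k l) s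
      = ∑ k, ∑ j, pd l (fun s => jac γ s k j) s * (jac γ s).adjugate j k := by
    rw [Finset.sum_comm]
    refine Finset.sum_congr rfl fun k _ => Finset.sum_congr rfl fun j _ => ?_
    rw [mul_comm]
    congr 1
    exact pd_pd_comm (contDiff_pi.1 hγ k) j l s
  rw [h4, add_eq_right, Finset.sum_comm] at h3
  simp only [Matrix.vecMul, dotProduct, hv, Finset.sum_mul, Pi.zero_apply]
  exact h3

omit [DecidableEq ι] in
lemma contDiff_eval (hγ : ContDiff ℝ ∞ γ) (h : MvPolynomial ι ℂ) :
    ContDiff ℝ ∞ fun s => MvPolynomial.eval (γ s) h := by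
  induction h using MvPolynomial.induction_on with
  | C a => simpa using contDiff_const
  | add p q hp hq => simpa using hp.add hq
  | mul_X p i hp => simpa using hp.mul (contDiff_pi.1 hγ i)

lemma pd_eval (hγ : ContDiff ℝ ∞ γ) (h : MvPolynomial ι ℂ) (j : ι) (s : ι → ℝ) :
    pd j (fun s => MvPolynomial.eval (γ s) h) s
      = ∑ l, jac γ s l j * MvPolynomial.eval (γ s) (MvPolynomial.pderiv l h) := by
  induction h using MvPolynomial.induction_on with
  | C a => simp [pd]
  | add p q hp hq =>
    simp only [map_add]
    rw [pd_add (contDiff_eval hγ p) (contDiff_eval hγ q), hp, hq, ← Finset.sum_add_distrib]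
    exact Finset.sum_congr rfl fun l _ => by ring
  | mul_X p i hp =>
    simp only [map_mul, MvPolynomial.eval_X]
    rw [pd_mul (contDiff_eval hγ p) (contDiff_pi.1 hγ i), hp, Finset.sum_mul]
    simp only [Derivation.leibniz, smul_eq_mul, map_add, map_mul, MvPolynomial.eval_X,
      MvPolynomial.pderiv_X, mul_add, Finset.sum_add_distrib]
    rw [add_comm]
    congr 1
    · rw [Finset.sum_eq_single i]
      · simp [jac, mul_comm]
      · intro l _ hl
        simp [Ne.symm hl]
      · simp
    · exact Finset.sum_congr rfl fun l _ => by ring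

/-- Integration by parts in the target coordinates: if `∑_k G_k dγ_k = -2κ ∑_j s_j ds_j`, then the
expansion coefficients of `G_k η` are those of `-κ ∂_k η`, shifted by one. -/
lemma gaussCoeff_gradient_mul (hγ : ContDiff ℝ ∞ γ) (h0 : (jac γ 0).det ≠ 0) {κ : ℂ}
    {G : ι → (ι → ℝ) → ℂ} (hG : ∀ s j, ∑ k, G k s * jac γ s k j = -2 * κ * s j)
    (η : MvPolynomial ι ℂ) (k : ι) (m : ℕ) :
    gaussCoeff (fun s => (jac γ s).det * (G k s * MvPolynomial.eval (γ s) η)) (m + 1)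
      = -κ * gaussCoeff (fun s => (jac γ s).det
          * MvPolynomial.eval (γ s) (MvPolynomial.pderiv k η)) m := by
  have hJ := contDiff_jac hγ
  have hA := contDiff_adjugate hJ
  have hη := contDiff_eval hγ η
  have hc : ∀ j, ContDiff ℝ ∞ (fun s : ι → ℝ => (s j : ℂ)) := fun j =>
    Complex.ofRealCLM.contDiff.comp (contDiff_apply ℝ ℝ j)
  -- Cramer's rule solves the relation for `G k`, which exhibits the factors s_j needed for
  -- integration by parts.
  have h1 : (fun s => (jac γ s).det * (G k s * MvPolynomial.eval (γ s) η))
      = fun s => (-2 * κ) * ∑ j, (s j : ℂ)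
          * ((jac γ s).adjugate j k * MvPolynomial.eval (γ s) η) := by
    funext s
    have h2 : (jac γ s).det * G k s = ∑ j, (-2 * κ * s j) * (jac γ s).adjugate j k := by
      simp_rw [← hG s, Finset.sum_mul, mul_assoc]
      rw [Finset.sum_comm]
      simp_rw [← Finset.mul_sum, ← Matrix.mul_apply, Matrix.mul_adjugate, Matrix.smul_apply,
        Matrix.one_apply]
      simp [mul_comm]
    rw [← mul_assoc, h2, Finset.sum_mul, Finset.mul_sum]
    exact Finset.sum_congr rfl fun j _ => by ring
  rw [h1, gaussCoeff_const_mul (ContDiff.sum fun j _ => (hc j).mul ((hA j k).mul hη)),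
    gaussCoeff_sum _ fun j => (hc j).mul ((hA j k).mul hη)]
  simp_rw [fun j => (gaussCoeff_coord_mul ((hA j k).mul hη) j).2 m]
  rw [← Finset.mul_sum, ← gaussCoeff_sum _ fun j => contDiff_pd ((hA j k).mul hη) j]
  -- The Piola identity removes the derivative of the adjugate, and J adj(J) = (det J)·1 collapses
  -- the chain rule to ∂_k η. Equality near 0, where det J ≠ 0, is enough because coefficients
  -- depend only on germs.
  have h3 : (fun s => ∑ j, pd j (fun s => (jac γ s).adjugate j k * MvPolynomial.eval (γ s) η) s)
      =ᶠ[𝓝 0] fun s => (jac γ s).det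
          * MvPolynomial.eval (γ s) (MvPolynomial.pderiv k η) := by
    have hne : ∀ᶠ s in 𝓝 0, (jac γ s).det ≠ 0 :=
      (contDiff_det hJ).continuous.continuousAt.eventually_ne h0
    filter_upwards [hne] with s hs
    simp_rw [pd_mul (hA _ k) hη, Finset.sum_add_distrib, ← Finset.sum_mul, piola hγ hs k, zero_mul,
      zero_add, pd_eval hγ, Finset.mul_sum]
    rw [Finset.sum_comm]
    simp_rw [← mul_assoc, ← Finset.sum_mul]
    rw [Finset.sum_eq_single k]
    · congr 1
      have := congrFun (congrFun (Matrix.mul_adjugate (jac γ s)) k) k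
      rw [Matrix.mul_apply] at this
      simpa [mul_comm] using this
    · intro l _ hl
      have := congrFun (congrFun (Matrix.mul_adjugate (jac γ s)) l) k
      rw [Matrix.mul_apply] at this
      simp only [Matrix.smul_apply, Matrix.one_apply_ne hl, smul_zero] at this
      simp_rw [mul_comm ((jac γ s).adjugate _ k)]
      rw [this, zero_mul]
    · simp
  rw [gaussCoeff_congr h3]
  ring

end GaussianExpansion

/-! ### The algebraic recursion and the bounds it implies -/

namespace GaussianExpansion

section Algebra

variable {ι : Type*}

/-- The ideal of polynomials vanishing at the origin. -/
noncomputable def originIdeal (ι : Type*) : Ideal (MvPolynomial ι ℂ) := Ideal.span (Set.range MvPolynomial.X)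

local notation "𝔪" => originIdeal ι

lemma X_mem_originIdeal (i : ι) : (MvPolynomial.X i : MvPolynomial ι ℂ) ∈ 𝔪 :=
  Ideal.subset_span ⟨i, rfl⟩

lemma exists_eq_C_add (h : MvPolynomial ι ℂ) : ∃ a : ℂ, ∃ g ∈ 𝔪, h = MvPolynomial.C a + g := by
  induction h using MvPolynomial.induction_on with
  | C a => exact ⟨a, 0, Ideal.zero_mem _, by simp⟩
  | add p q hp hq =>
    obtain ⟨a, g, hg, rfl⟩ := hp
    obtain ⟨b, g', hg', rfl⟩ := hq
    exact ⟨a + b, g + g', Ideal.add_mem _ hg hg', by rw [map_add]; ring⟩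
  | mul_X p i hp => exact ⟨0, p * MvPolynomial.X i,
      Ideal.mul_mem_left _ _ (X_mem_originIdeal i), by simp⟩

/-- Products X_i η with η in 𝔪^k generate 𝔪^(k+1) additively, as scalars can be moved into η. -/
lemma pow_succ_induction {k : ℕ} {p : MvPolynomial ι ℂ → Prop}
    (hX : ∀ i, ∀ η ∈ 𝔪 ^ k, p (MvPolynomial.X i * η)) (h0 : p 0)
    (hadd : ∀ g h, p g → p h → p (g + h)) : ∀ h ∈ 𝔪 ^ (k + 1), p h := by
  intro h hh
  rw [pow_succ'] at hh
  refine Submodule.mul_induction_on hh (fun a ha b hb => ?_) hadd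
  revert b
  refine Submodule.span_induction (p := fun a _ => ∀ b ∈ 𝔪 ^ k, p (a * b)) ?_ ?_ ?_ ?_ ha
  · rintro _ ⟨i, rfl⟩ b hb
    exact hX i b hb
  · intro b _
    rwa [zero_mul]
  · intro x y _ _ hx hy b hb
    rw [add_mul]
    exact hadd _ _ (hx b hb) (hy b hb)
  · intro r x _ hx b hb
    rw [smul_eq_mul, mul_assoc, mul_left_comm]
    exact hx _ (Ideal.mul_mem_left _ _ hb)

lemma pderiv_mem_originIdeal {h : MvPolynomial ι ℂ} (hh : h ∈ 𝔪 ^ 2) (k : ι) :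
    MvPolynomial.pderiv k h ∈ 𝔪 := by
  refine pow_succ_induction (k := 1) (p := fun h => MvPolynomial.pderiv k h ∈ 𝔪) ?_ ?_ ?_ h hh
  · intro i η hη
    rw [pow_one] at hη
    rw [Derivation.leibniz, smul_eq_mul, smul_eq_mul]
    exact Ideal.add_mem _ (Ideal.mul_mem_right _ _ (X_mem_originIdeal i))
      (Ideal.mul_mem_right _ _ hη)
  · simp
  · intro g h hg hh
    rw [map_add]
    exact Ideal.add_mem _ hg hh

/-- The sum of the terms of degree `2, …, K - 1` of the exponential series. -/
noncomputable def expTail {A : Type*} [CommRing A] [Algebra ℂ A] (K : ℕ) (z : A) : A :=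
  ∑ r ∈ Finset.Ico 2 K, ((r.factorial : ℂ)⁻¹) • z ^ r

/-- The truncation of `exp z - 1 - z - z (exp z - 1) / 2`, which starts in degree `3`. -/
noncomputable def cubicTail {A : Type*} [CommRing A] [Algebra ℂ A] (K : ℕ) (z : A) : A :=
  expTail K z - (1 / 2 : ℂ) • z ^ 2 - (1 / 2 : ℂ) • (z * expTail K z)

lemma expTail_mem {z : MvPolynomial ι ℂ} (hz : z ∈ 𝔪) (K : ℕ) : expTail K z ∈ 𝔪 ^ 2 := by
  refine Ideal.sum_mem _ fun r hr => ?_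
  rw [MvPolynomial.smul_eq_C_mul]
  exact Ideal.mul_mem_left _ _ (Ideal.pow_le_pow_right (Finset.mem_Ico.1 hr).1
    (Ideal.pow_mem_pow hz r))

/-- For f(z) = exp z - 1 - z the combination f - z f'/2 loses its quadratic term. This gain of one
order makes the Euler relation usable in the recursion. -/
lemma cubicTail_mem {z : MvPolynomial ι ℂ} (hz : z ∈ 𝔪) {K : ℕ} (hK : 3 ≤ K) :
    cubicTail K z ∈ 𝔪 ^ 3 := by
  have h : expTail K z - (1 / 2 : ℂ) • z ^ 2
      = ∑ r ∈ Finset.Ico 3 K, ((r.factorial : ℂ)⁻¹) • z ^ r := by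
    rw [expTail, Finset.sum_eq_sum_Ico_succ_bot (by omega : 2 < K)]
    simp
  rw [cubicTail, h]
  refine Ideal.sub_mem _ (Ideal.sum_mem _ fun r hr => ?_) ?_
  · rw [MvPolynomial.smul_eq_C_mul]
    exact Ideal.mul_mem_left _ _ (Ideal.pow_le_pow_right (Finset.mem_Ico.1 hr).1
      (Ideal.pow_mem_pow hz r))
  · rw [MvPolynomial.smul_eq_C_mul, pow_succ' _ 2]
    exact Ideal.mul_mem_left _ _ (Ideal.mul_mem_mul hz (expTail_mem hz K))

variable [Fintype ι]

/-- The linear form `∑ e_j X_j`. -/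
noncomputable def linearForm (e : ι → ℂ) : MvPolynomial ι ℂ :=
  ∑ j, MvPolynomial.C (e j) * MvPolynomial.X j

lemma linearForm_mem (e : ι → ℂ) : linearForm e ∈ 𝔪 :=
  Ideal.sum_mem _ fun j _ => Ideal.mul_mem_left _ _ (X_mem_originIdeal j)

variable [DecidableEq ι]

/-- The quadratic form of `∑ c_j (exp p_j - 1 - p_j) + Q (exp (e · p) - 1 - e · p)`. -/
def quadMatrix (c : ι → ℂ) (Q : ℂ) (e : ι → ℂ) : Matrix ι ι ℂ :=
  Matrix.diagonal c + Matrix.of fun i j => Q * e i * e j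

/-- The relations between the expansion coefficients of the integrals of polynomials. -/
structure IsExpansionFunctional (c : ι → ℂ) (Q : ℂ) (e : ι → ℂ)
    (B : ℕ → MvPolynomial ι ℂ →ₗ[ℂ] ℂ) : Prop where
  vanish : ∀ m, ∀ h ∈ 𝔪 ^ (2 * m + 1), B m h = 0
  one : B 0 1 = 1
  parts : ∀ m K, 2 * m + 3 ≤ K → ∀ η k,
    ∑ j, quadMatrix c Q e k j * B (m + 1) (MvPolynomial.X j * η)
      + c k * B (m + 1) (expTail K (MvPolynomial.X k) * η)
      + Q * e k * B (m + 1) (expTail K (linearForm e) * η)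
    = -B m (MvPolynomial.pderiv k η)
  euler : ∀ m K, 2 * m + 3 ≤ K →
    m * B m 1 = -(∑ j, c j * B (m + 1) (cubicTail K (MvPolynomial.X j))
      + Q * B (m + 1) (cubicTail K (linearForm e)))

variable {α : Type*} {l : Filter α} {c : α → ι → ℂ} {Q : α → ℂ} {e : ι → ℂ}
  {B : α → ℕ → MvPolynomial ι ℂ →ₗ[ℂ] ℂ}

lemma isBigO_one_mul {f g : α → ℂ} (hf : f =O[l] fun _ => (1 : ℝ))
    (hg : g =O[l] fun _ => (1 : ℝ)) : (fun t => f t * g t) =O[l] fun _ => (1 : ℝ) := by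
  simpa using hf.mul hg

/-- Descending induction on the order of vanishing: the relation `parts` expresses the value on X_i
η through the level m and through polynomials of higher order, while sufficiently high orders are
killed by `vanish`. -/
lemma bounded_pow_succ (hB : ∀ᶠ t in l, IsExpansionFunctional (c t) (Q t) e (B t))
    (hc : ∀ j, (fun t => c t j) =O[l] fun _ => (1 : ℝ)) (hQ : Q =O[l] fun _ => (1 : ℝ))
    (hdet : ∀ᶠ t in l, IsUnit (quadMatrix (c t) (Q t) e).det)
    (hinv : ∀ i j, (fun t => (quadMatrix (c t) (Q t) e)⁻¹ i j) =O[l] fun _ => (1 : ℝ))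
    {m k₀ : ℕ} (hη : ∀ η ∈ 𝔪 ^ k₀, ∀ k,
      (fun t => B t m (MvPolynomial.pderiv k η)) =O[l] fun _ => (1 : ℝ)) :
    ∀ h ∈ 𝔪 ^ (k₀ + 1), (fun t => B t (m + 1) h) =O[l] fun _ => (1 : ℝ) := by
  -- Here n bounds the distance from k to 2m + 3; at n = 0 the order k + 1 exceeds 2(m + 1), so the
  -- functional vanishes.
  suffices H : ∀ n k, k₀ ≤ k → 2 * m + 3 ≤ k + n → ∀ h ∈ 𝔪 ^ (k + 1),
      (fun t => B t (m + 1) h) =O[l] fun _ => (1 : ℝ) from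
    H (2 * m + 3) k₀ le_rfl (by omega)
  intro n
  induction n with
  | zero =>
    intro k _ hk h hh
    refine (isBigO_zero _ l).congr' ?_ EventuallyEq.rfl
    filter_upwards [hB] with t ht
    exact (ht.vanish (m + 1) h (Ideal.pow_le_pow_right (by omega) hh)).symm
  | succ n ih =>
    intro k hk hkn
    refine pow_succ_induction ?_ ?_ ?_
    · intro i η hη'
      have hlin : ∀ z ∈ 𝔪, (fun t => B t (m + 1) (expTail (2 * m + 3) z * η))
          =O[l] fun _ => (1 : ℝ) := fun z hz =>
        ih (k + 1) (by omega) (by omega) _ (by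
          rw [show k + 1 + 1 = 2 + k by omega, pow_add]
          exact Ideal.mul_mem_mul (expTail_mem hz _) hη')
      -- The right-hand side of the linear system for the values on X_j η, multiplied by the bounded
      -- inverse of the quadratic form.
      have hsum : (fun t => ∑ k, (quadMatrix (c t) (Q t) e)⁻¹ i k
          * (-B t m (MvPolynomial.pderiv k η)
            - c t k * B t (m + 1) (expTail (2 * m + 3) (MvPolynomial.X k) * η)
            - Q t * e k * B t (m + 1) (expTail (2 * m + 3) (linearForm e) * η)))
          =O[l] fun _ => (1 : ℝ) := by
        refine IsBigO.fun_sum fun k _ => isBigO_one_mul (hinv i k) ?_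
        refine ((hη η (Ideal.pow_le_pow_right hk hη') k).neg_left.sub
          (isBigO_one_mul (hc k) (hlin _ (X_mem_originIdeal k)))).sub ?_
        exact isBigO_one_mul (isBigO_one_mul hQ (isBigO_const_const _ one_ne_zero _))
          (hlin _ (linearForm_mem e))
      refine hsum.congr' ?_ EventuallyEq.rfl
      filter_upwards [hB, hdet] with t ht hd
      have h1 : ∀ k, -B t m (MvPolynomial.pderiv k η)
            - c t k * B t (m + 1) (expTail (2 * m + 3) (MvPolynomial.X k) * η)
            - Q t * e k * B t (m + 1) (expTail (2 * m + 3) (linearForm e) * η)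
          = ∑ j, quadMatrix (c t) (Q t) e k j * B t (m + 1) (MvPolynomial.X j * η) := fun k => by
        rw [← ht.parts m (2 * m + 3) le_rfl η k]; ring
      simp_rw [h1, Finset.mul_sum]
      rw [Finset.sum_comm]
      simp_rw [← mul_assoc, ← Finset.sum_mul, ← Matrix.mul_apply, Matrix.nonsing_inv_mul _ hd]
      simp [Matrix.one_apply]
    · simp only [map_zero]
      exact isBigO_zero _ l
    · intro g h hg hh
      simp only [map_add]
      exact hg.add hh

/-- The expansion coefficients are bounded when the coefficients of the phase and the inverse of
its quadratic part are bounded. -/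
theorem expansion_bounded (hB : ∀ᶠ t in l, IsExpansionFunctional (c t) (Q t) e (B t))
    (hc : ∀ j, (fun t => c t j) =O[l] fun _ => (1 : ℝ)) (hQ : Q =O[l] fun _ => (1 : ℝ))
    (hdet : ∀ᶠ t in l, IsUnit (quadMatrix (c t) (Q t) e).det)
    (hinv : ∀ i j, (fun t => (quadMatrix (c t) (Q t) e)⁻¹ i j) =O[l] fun _ => (1 : ℝ))
    (m : ℕ) (h : MvPolynomial ι ℂ) : (fun t => B t m h) =O[l] fun _ => (1 : ℝ) := by
  have hone : ∀ m, (fun t => B t m 1) =O[l] (fun _ => (1 : ℝ)) →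
      (∀ g ∈ 𝔪, (fun t => B t m g) =O[l] fun _ => (1 : ℝ)) → ∀ h,
      (fun t => B t m h) =O[l] fun _ => (1 : ℝ) := by
    intro m h1 hg h
    obtain ⟨a, g, hgm, rfl⟩ := exists_eq_C_add h
    have h2 : ∀ t, B t m (MvPolynomial.C a + g) = a * B t m 1 + B t m g := fun t => by
      rw [map_add, ← mul_one (MvPolynomial.C a), ← MvPolynomial.smul_eq_C_mul, map_smul,
        smul_eq_mul]
    simp_rw [h2]
    exact (h1.const_mul_left a).add (hg g hgm)
  induction m generalizing h with
  | zero =>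
    refine hone 0 ?_ (fun g hg => ?_) h
    · refine (isBigO_const_const (1 : ℂ) one_ne_zero l).congr' ?_ EventuallyEq.rfl
      filter_upwards [hB] with t ht
      exact ht.one.symm
    · refine (isBigO_zero _ l).congr' ?_ EventuallyEq.rfl
      filter_upwards [hB] with t ht
      exact (ht.vanish 0 g (by simpa using hg)).symm
  | succ m ih =>
    -- Integration by parts does not reach the value at 1. The Euler relation expresses it through
    -- level m + 2 on 𝔪³, which needs level m + 1 only on 𝔪, because derivatives of elements of 𝔪²
    -- lie in 𝔪. So `ha` feeds `hb` without circularity.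
    have ha := bounded_pow_succ hB hc hQ hdet hinv (m := m) (k₀ := 0) fun η _ k => ih _
    have hb := bounded_pow_succ hB hc hQ hdet hinv (m := m + 1) (k₀ := 2) fun η hη k =>
      ha _ (by simpa using pderiv_mem_originIdeal hη k)
    refine hone (m + 1) ?_ (fun g hg => ha g (by simpa using hg)) h
    have hK : 2 * (m + 1) + 3 ≤ 2 * (m + 1) + 3 := le_rfl
    have hsum : (fun t => -(∑ j, c t j * B t (m + 1 + 1)
          (cubicTail (2 * (m + 1) + 3) (MvPolynomial.X j))
        + Q t * B t (m + 1 + 1) (cubicTail (2 * (m + 1) + 3) (linearForm e))))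
        =O[l] fun _ => (1 : ℝ) := by
      refine ((IsBigO.fun_sum fun j _ => isBigO_one_mul (hc j) ?_).add
        (isBigO_one_mul hQ ?_)).neg_left
      · exact hb _ (cubicTail_mem (X_mem_originIdeal j) (by omega))
      · exact hb _ (cubicTail_mem (linearForm_mem e) (by omega))
    refine (hsum.const_mul_left ((m + 1 : ℕ) : ℂ)⁻¹).congr' ?_ EventuallyEq.rfl
    filter_upwards [hB] with t ht
    rw [← ht.euler (m + 1) _ hK, inv_mul_cancel_left₀]
    exact_mod_cast Nat.succ_ne_zero m

end Algebra

end GaussianExpansion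

/-! ### Pull-back of the phase and the relations for its coefficients -/

namespace GaussianExpansion

section Pullback
open scoped ContDiff

variable {ι : Type*} [Fintype ι]

/-- The exponential series without its terms of degree less than `K`, for `2 ≤ K`. -/
noncomputable def expRem (K : ℕ) (z : ℂ) : ℂ := Complex.exp z - 1 - z - expTail K z

lemma expRem_eq {K : ℕ} (hK : 2 ≤ K) (z : ℂ) :
    expRem K z = Complex.exp z - ∑ m ∈ Finset.range K, z ^ m / m.factorial := by
  rw [expRem, expTail, ← Finset.sum_range_add_sum_Ico _ hK]
  simp [Finset.sum_range_succ, div_eq_inv_mul]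
  ring

lemma expRem_isBigO {f : (ι → ℝ) → ℂ} (hf : f =O[𝓝 0] fun s => ‖s‖) (hc : Continuous f)
    {K : ℕ} (hK : 2 ≤ K) : (fun s => expRem K (f s)) =O[𝓝 0] fun s => ‖s‖ ^ K := by
  have h1 : (fun s => expRem K (f s)) =O[𝓝 0] fun s => ‖f s‖ ^ K * Real.exp ‖f s‖ := by
    refine isBigO_of_le _ fun s => ?_
    rw [expRem_eq hK, Real.norm_of_nonneg (by positivity)]
    exact Complex.norm_exp_sub_sum_le_norm_mul_exp _ _
  have h2 : (fun s => Real.exp ‖f s‖) =O[𝓝 0] fun _ => (1 : ℝ) :=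
    ((Real.continuous_exp.comp hc.norm).tendsto 0).isBigO_one ℝ
  simpa using h1.trans ((hf.norm_left.pow K).mul h2)

lemma gaussCoeff_eq_of_sub_isBigO {f g : (ι → ℝ) → ℂ} (hf : ContDiff ℝ ∞ f)
    (hg : ContDiff ℝ ∞ g) {m : ℕ}
    (hO : (fun s => f s - g s) =O[𝓝 0] fun s => ‖s‖ ^ (2 * m + 1)) :
    gaussCoeff f m = gaussCoeff g m := by
  have h1 := gaussCoeff_add hg (hf.sub hg) m
  rw [gaussCoeff_eq_zero_of_isBigO (hf.sub hg) hO, add_zero] at h1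
  rw [← h1]
  congr 1
  funext s
  ring

lemma norm_pow_isBigO {k K : ℕ} (h : k ≤ K) :
    (fun s : ι → ℝ => ‖s‖ ^ K) =O[𝓝 0] fun s => ‖s‖ ^ k := by
  refine IsBigO.of_bound 1 ?_
  filter_upwards [Metric.closedBall_mem_nhds (0 : ι → ℝ) one_pos] with s hs
  rw [one_mul, norm_pow, norm_pow, norm_norm]
  exact pow_le_pow_of_le_one (norm_nonneg _) (by simpa using hs) h

lemma isBigO_mul_left {f g : (ι → ℝ) → ℂ} (hf : Continuous f) {K : ℕ}
    (hg : g =O[𝓝 0] fun s => ‖s‖ ^ K) : (fun s => f s * g s) =O[𝓝 0] fun s => ‖s‖ ^ K := by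
  simpa using ((hf.tendsto 0).isBigO_one ℝ).mul hg

lemma isBigO_mul_right {f g : (ι → ℝ) → ℂ} (hf : Continuous f) {K : ℕ}
    (hg : g =O[𝓝 0] fun s => ‖s‖ ^ K) : (fun s => g s * f s) =O[𝓝 0] fun s => ‖s‖ ^ K := by
  simpa using hg.mul ((hf.tendsto 0).isBigO_one ℝ)

omit [Fintype ι] in
lemma eval_expTail (p : ι → ℂ) (K : ℕ) (z : MvPolynomial ι ℂ) :
    MvPolynomial.eval p (expTail K z) = expTail K (MvPolynomial.eval p z) := by
  simp [expTail, MvPolynomial.smul_eval]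

omit [Fintype ι] in
lemma eval_cubicTail (p : ι → ℂ) (K : ℕ) (z : MvPolynomial ι ℂ) :
    MvPolynomial.eval p (cubicTail K z) = cubicTail K (MvPolynomial.eval p z) := by
  simp [cubicTail, MvPolynomial.smul_eval, eval_expTail]

lemma eval_linearForm (p e : ι → ℂ) :
    MvPolynomial.eval p (linearForm e) = ∑ j, e j * p j := by
  simp [linearForm]

/-- The phase `∑ c_j (exp p_j - 1 - p_j) + Q (exp (e · p) - 1 - e · p)`. -/
noncomputable def phase (c : ι → ℂ) (Q : ℂ) (e p : ι → ℂ) : ℂ :=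
  ∑ j, c j * (Complex.exp (p j) - 1 - p j)
    + Q * (Complex.exp (∑ j, e j * p j) - 1 - ∑ j, e j * p j)

/-- The partial derivatives of the phase. -/
noncomputable def phaseGrad (c : ι → ℂ) (Q : ℂ) (e p : ι → ℂ) (k : ι) : ℂ :=
  c k * (Complex.exp (p k) - 1) + Q * e k * (Complex.exp (∑ j, e j * p j) - 1)

variable {γ : (ι → ℝ) → (ι → ℂ)} {c : ι → ℂ} {Q : ℂ} {e : ι → ℂ} {κ : ℂ}

lemma isBigO_norm_of_contDiff {f : (ι → ℝ) → ℂ} (hf : ContDiff ℝ ∞ f) (h0 : f 0 = 0) :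
    f =O[𝓝 0] fun s => ‖s‖ := by
  have h := ((hf.differentiable (by simp)) 0).isBigO_sub
  simpa [h0] using h.norm_right

lemma contDiff_linear (hγ : ContDiff ℝ ∞ γ) : ContDiff ℝ ∞ fun s => ∑ j, e j * γ s j :=
  ContDiff.sum fun j _ => contDiff_const.mul (contDiff_pi.1 hγ j)

lemma contDiff_phaseGrad (hγ : ContDiff ℝ ∞ γ) (k : ι) :
    ContDiff ℝ ∞ fun s => phaseGrad c Q e (γ s) k :=
  (contDiff_const.mul ((contDiff_pi.1 hγ k).cexp.sub contDiff_const)).add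
    (contDiff_const.mul ((contDiff_linear hγ).cexp.sub contDiff_const))

variable [DecidableEq ι]

lemma pd_exp {f : (ι → ℝ) → ℂ} (hf : ContDiff ℝ ∞ f) (j : ι) (s : ι → ℝ) :
    pd j (fun s => Complex.exp (f s)) s = Complex.exp (f s) * pd j f s := by
  rw [pd, ((hf.differentiable (by simp)) s).hasFDerivAt.cexp.fderiv]
  simp [pd]

lemma pd_const_mul {f : (ι → ℝ) → ℂ} (hf : ContDiff ℝ ∞ f) (a : ℂ) (j : ι) (s : ι → ℝ) :
    pd j (fun s => a * f s) s = a * pd j f s := by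
  rw [pd_mul contDiff_const hf]
  simp [pd]

lemma pd_sub_const {f : (ι → ℝ) → ℂ} (a : ℂ) (j : ι) (s : ι → ℝ) :
    pd j (fun s => f s - a) s = pd j f s := by
  rw [pd, pd, fderiv_sub_const]

lemma pd_exp_sub {f : (ι → ℝ) → ℂ} (hf : ContDiff ℝ ∞ f) (j : ι) (s : ι → ℝ) :
    pd j (fun s => Complex.exp (f s) - 1 - f s) s = (Complex.exp (f s) - 1) * pd j f s := by
  have h : (fun s => Complex.exp (f s) - 1 - f s)
      = fun s => (Complex.exp (f s) - 1) + (-1) * f s := by funext s; ring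
  rw [h, pd_add (hf.cexp.sub contDiff_const) (contDiff_const.mul hf), pd_sub_const, pd_exp hf,
    pd_const_mul hf]
  ring

omit [DecidableEq ι] in
lemma contDiff_coord (j : ι) : ContDiff ℝ ∞ (fun s : ι → ℝ => (s j : ℂ)) :=
  Complex.ofRealCLM.contDiff.comp (contDiff_apply ℝ ℝ j)

omit [Fintype ι] in
lemma pd_coord (i j : ι) (s : ι → ℝ) :
    pd j (fun s => (s i : ℂ)) s = if i = j then 1 else 0 := by
  have h1 : HasFDerivAt (fun s : ι → ℝ => (s i : ℂ))
      (Complex.ofRealCLM.comp (ContinuousLinearMap.proj (R := ℝ) (φ := fun _ : ι => ℝ) i)) s :=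
    (Complex.ofRealCLM.comp
      (ContinuousLinearMap.proj (R := ℝ) (φ := fun _ : ι => ℝ) i)).hasFDerivAt
  rw [pd, h1.fderiv]
  simp [Pi.single_apply, apply_ite]

lemma pd_sumSq (j : ι) (s : ι → ℝ) : pd j (fun s => (sumSq s : ℂ)) s = 2 * s j := by
  have h : (fun s : ι → ℝ => (sumSq s : ℂ)) = fun s => ∑ i, (s i : ℂ) * (s i : ℂ) := by
    funext s; simp [sumSq, sq]
  rw [h, pd_sum _ fun i => (contDiff_coord i).mul (contDiff_coord i)]
  simp_rw [pd_mul (contDiff_coord _) (contDiff_coord _), pd_coord]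
  simp only [ite_mul, mul_ite, one_mul, zero_mul, mul_one, mul_zero, Finset.sum_add_distrib,
    Finset.sum_ite_eq', Finset.mem_univ, if_true]
  ring

lemma pd_linear (hγ : ContDiff ℝ ∞ γ) (j : ι) (s : ι → ℝ) :
    pd j (fun s => ∑ k, e k * γ s k) s = ∑ k, e k * jac γ s k j := by
  rw [pd_sum _ fun k => contDiff_const.mul (contDiff_pi.1 hγ k)]
  exact Finset.sum_congr rfl fun k _ => pd_const_mul (contDiff_pi.1 hγ k) _ _ _

/-- The differential of the phase along a map on which it is `-κ |s|²`. -/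
lemma sum_phaseGrad_mul_jac (hγ : ContDiff ℝ ∞ γ)
    (hF : ∀ s, phase c Q e (γ s) = -κ * sumSq s) (s : ι → ℝ) (j : ι) :
    ∑ k, phaseGrad c Q e (γ s) k * jac γ s k j = -2 * κ * s j := by
  have hsq : ContDiff ℝ ∞ fun s : ι → ℝ => (sumSq s : ℂ) :=
    Complex.ofRealCLM.contDiff.comp contDiff_sumSq
  have hφ : ∀ {f : (ι → ℝ) → ℂ}, ContDiff ℝ ∞ f →
      ContDiff ℝ ∞ fun s => Complex.exp (f s) - 1 - f s :=
    fun hf => (hf.cexp.sub contDiff_const).sub hf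
  have hk := contDiff_pi.1 hγ
  have h : pd j (fun s => phase c Q e (γ s)) s = pd j (fun s => -κ * sumSq s) s := by
    simp_rw [hF]
  rw [pd_const_mul hsq, pd_sumSq] at h
  simp only [phase] at h
  rw [pd_add (ContDiff.sum fun k _ => contDiff_const.mul (hφ (hk k)))
      (contDiff_const.mul (hφ (contDiff_linear hγ))),
    pd_sum _ fun k => contDiff_const.mul (hφ (hk k)),
    pd_const_mul (hφ (contDiff_linear hγ)), pd_exp_sub (contDiff_linear hγ), pd_linear hγ] at h
  simp_rw [pd_const_mul (hφ (hk _)), pd_exp_sub (hk _)] at h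
  rw [show -2 * κ * (s j : ℂ) = -κ * (2 * s j) by ring, ← h, Finset.mul_sum, Finset.mul_sum,
    ← Finset.sum_add_distrib]
  refine Finset.sum_congr rfl fun k _ => ?_
  simp only [phaseGrad, jac, Matrix.of_apply]
  ring

lemma quadMatrix_sum (k : ι) (p : ι → ℂ) :
    ∑ j, quadMatrix c Q e k j * p j = c k * p k + Q * e k * ∑ j, e j * p j := by
  simp only [quadMatrix, Matrix.add_apply, Matrix.of_apply, add_mul, Finset.sum_add_distrib,
    Matrix.diagonal_apply, ite_mul, zero_mul, Finset.sum_ite_eq, Finset.mem_univ, if_true,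
    Finset.mul_sum, mul_assoc]

lemma pd_phaseGrad_zero (hγ : ContDiff ℝ ∞ γ) (h0 : γ 0 = 0) (i k : ι) :
    pd i (fun s => phaseGrad c Q e (γ s) k) 0 = ∑ j, quadMatrix c Q e k j * jac γ 0 j i := by
  have hk := contDiff_pi.1 hγ
  simp only [phaseGrad]
  rw [pd_add (contDiff_const.mul ((hk k).cexp.sub contDiff_const))
      (contDiff_const.mul ((contDiff_linear hγ).cexp.sub contDiff_const)),
    pd_const_mul ((hk k).cexp.sub contDiff_const),
    pd_const_mul ((contDiff_linear hγ).cexp.sub contDiff_const), pd_sub_const, pd_sub_const,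
    pd_exp (hk k), pd_exp (contDiff_linear hγ), pd_linear hγ, quadMatrix_sum]
  simp [h0, jac]

/-- The Jacobian at the critical point diagonalizes the quadratic part of the phase. -/
lemma jac_transpose_mul_quadMatrix_mul_jac (hγ : ContDiff ℝ ∞ γ) (h0 : γ 0 = 0)
    (hF : ∀ s, phase c Q e (γ s) = -κ * sumSq s) :
    (jac γ 0).transpose * quadMatrix c Q e * jac γ 0 = (-2 * κ) • 1 := by
  ext j i
  -- The differential of the phase is differentiated once more at the origin; the gradient vanishes
  -- there, so second derivatives of γ do not contribute.
  have h1 : pd i (fun s => ∑ k, phaseGrad c Q e (γ s) k * jac γ s k j) 0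
      = pd i (fun s => -2 * κ * s j) 0 := by
    simp_rw [sum_phaseGrad_mul_jac hγ hF]
  rw [pd_const_mul (contDiff_coord j), pd_coord,
    pd_sum _ fun k => (contDiff_phaseGrad hγ k).mul (contDiff_jac hγ k j)] at h1
  have h2 : ∀ k, phaseGrad c Q e (γ 0) k = 0 := fun k => by simp [phaseGrad, h0]
  simp_rw [pd_mul (contDiff_phaseGrad hγ _) (contDiff_jac hγ _ _), pd_phaseGrad_zero hγ h0, h2,
    zero_mul, add_zero] at h1
  rw [Matrix.mul_assoc, Matrix.mul_apply, Matrix.smul_apply, Matrix.one_apply, smul_eq_mul, ← h1]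
  refine Finset.sum_congr rfl fun k _ => ?_
  rw [Matrix.mul_apply, Matrix.transpose_apply, mul_comm]

/-- It serves twice: for κ ≠ 0 it shows that the Jacobian is invertible at 0, and it relates the
leading coefficient to the Hessian. -/
lemma det_jac_sq_mul (hγ : ContDiff ℝ ∞ γ) (h0 : γ 0 = 0)
    (hF : ∀ s, phase c Q e (γ s) = -κ * sumSq s) :
    (jac γ 0).det ^ 2 * (quadMatrix c Q e).det = (-2 * κ) ^ Fintype.card ι := by
  have h := congrArg Matrix.det (jac_transpose_mul_quadMatrix_mul_jac hγ h0 hF)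
  rw [Matrix.det_mul, Matrix.det_mul, Matrix.det_transpose, Matrix.det_smul, Matrix.det_one,
    mul_one] at h
  rw [← h]
  ring

lemma det_jac_ne_zero (hγ : ContDiff ℝ ∞ γ) (h0 : γ 0 = 0)
    (hF : ∀ s, phase c Q e (γ s) = -κ * sumSq s) (hκ : κ ≠ 0) : (jac γ 0).det ≠ 0 := by
  intro h
  have h1 := det_jac_sq_mul hγ h0 hF
  rw [h, zero_pow two_ne_zero, zero_mul] at h1
  exact pow_ne_zero _ (mul_ne_zero (by norm_num) hκ) h1.symm

/-- The coefficients of `∫ exp (-|s|² / ε) h(γ(s)) dγ_1 ⋯ dγ_d` for a polynomial `h`. -/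
noncomputable def polyCoeff (γ : (ι → ℝ) → (ι → ℂ)) (hγ : ContDiff ℝ ∞ γ) (m : ℕ) :
    MvPolynomial ι ℂ →ₗ[ℂ] ℂ where
  toFun h := gaussCoeff (fun s => (jac γ s).det * MvPolynomial.eval (γ s) h) m
  map_add' g h := by
    have hD := contDiff_det (contDiff_jac hγ)
    rw [← gaussCoeff_add (hD.mul (contDiff_eval hγ g)) (hD.mul (contDiff_eval hγ h))]
    simp only [map_add, mul_add]
  map_smul' a h := by
    have hD := contDiff_det (contDiff_jac hγ)
    rw [RingHom.id_apply, smul_eq_mul,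
      ← gaussCoeff_const_mul (hD.mul (contDiff_eval hγ h))]
    simp only [MvPolynomial.smul_eval, mul_left_comm]

omit [DecidableEq ι] in
lemma eval_isBigO (hγ : ContDiff ℝ ∞ γ) (h0 : γ 0 = 0) (k : ℕ) :
    ∀ h ∈ originIdeal ι ^ k,
      (fun s => MvPolynomial.eval (γ s) h) =O[𝓝 0] fun s => ‖s‖ ^ k := by
  induction k with
  | zero =>
    intro h _
    simpa using ((contDiff_eval hγ h).continuous.tendsto 0).isBigO_one ℝ
  | succ k ih =>
    refine pow_succ_induction (fun i η hη => ?_) ?_ ?_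
    · simp only [map_mul, MvPolynomial.eval_X, pow_succ']
      exact (isBigO_norm_of_contDiff (contDiff_pi.1 hγ i) (by rw [h0]; rfl)).mul (ih η hη)
    · simpa using isBigO_zero (E' := ℂ) (fun s : ι → ℝ => ‖s‖ ^ (k + 1)) (𝓝 0)
    · intro g h hg hh
      simpa using hg.add hh

/-- Functions which agree to high order have the same expansion coefficients. -/
lemma gaussCoeff_det_mul_congr (hγ : ContDiff ℝ ∞ γ) {f : (ι → ℝ) → ℂ} (hf : ContDiff ℝ ∞ f)
    {m K : ℕ} (hK : 2 * m + 1 ≤ K) (h : MvPolynomial ι ℂ)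
    (hO : (fun s => f s - MvPolynomial.eval (γ s) h) =O[𝓝 0] fun s => ‖s‖ ^ K) :
    gaussCoeff (fun s => (jac γ s).det * f s) m = polyCoeff γ hγ m h := by
  have hD := contDiff_det (contDiff_jac hγ)
  refine gaussCoeff_eq_of_sub_isBigO (hD.mul hf) (hD.mul (contDiff_eval hγ h)) ?_
  simp only [← mul_sub]
  exact isBigO_mul_left hD.continuous (hO.trans (norm_pow_isBigO hK))

/-- This is `gaussCoeff_gradient_mul` with the exponentials in the gradient truncated. The error is
of order K ≥ 2(m + 1) + 1, which the coefficient of index m + 1 does not see. -/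
lemma polyCoeff_parts (hγ : ContDiff ℝ ∞ γ) (h0 : γ 0 = 0)
    (hF : ∀ s, phase c Q e (γ s) = -κ * sumSq s) (hκ : κ ≠ 0) {m K : ℕ} (hK : 2 * m + 3 ≤ K)
    (η : MvPolynomial ι ℂ) (k : ι) :
    ∑ j, quadMatrix c Q e k j * polyCoeff γ hγ (m + 1) (MvPolynomial.X j * η)
      + c k * polyCoeff γ hγ (m + 1) (expTail K (MvPolynomial.X k) * η)
      + Q * e k * polyCoeff γ hγ (m + 1) (expTail K (linearForm e) * η)
    = -κ * polyCoeff γ hγ m (MvPolynomial.pderiv k η) := by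
  have h1 := gaussCoeff_gradient_mul hγ (det_jac_ne_zero hγ h0 hF hκ)
    (sum_phaseGrad_mul_jac hγ hF) η k m
  have hk := contDiff_pi.1 hγ
  have hlin := contDiff_linear (e := e) hγ
  rw [gaussCoeff_det_mul_congr hγ ((contDiff_phaseGrad hγ k).mul (contDiff_eval hγ η))
    (K := K) (by omega)
    (∑ j, quadMatrix c Q e k j • (MvPolynomial.X j * η)
      + c k • (expTail K (MvPolynomial.X k) * η)
      + (Q * e k) • (expTail K (linearForm e) * η))] at h1
  · simp only [map_add, map_sum, map_smul, smul_eq_mul] at h1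
    exact h1
  · have h2 : ∀ s, phaseGrad c Q e (γ s) k * MvPolynomial.eval (γ s) η
        - MvPolynomial.eval (γ s) (∑ j, quadMatrix c Q e k j • (MvPolynomial.X j * η)
          + c k • (expTail K (MvPolynomial.X k) * η)
          + (Q * e k) • (expTail K (linearForm e) * η))
        = (c k * expRem K (γ s k) + Q * e k * expRem K (∑ j, e j * γ s j))
          * MvPolynomial.eval (γ s) η := by
      intro s
      simp only [map_add, map_sum, map_mul, MvPolynomial.smul_eval, MvPolynomial.eval_X,
        eval_expTail, eval_linearForm, ← mul_assoc, ← Finset.sum_mul, quadMatrix_sum, phaseGrad,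
        expRem]
      ring
    simp_rw [h2]
    refine isBigO_mul_right (contDiff_eval hγ η).continuous ?_
    exact ((expRem_isBigO (isBigO_norm_of_contDiff (hk k) (by rw [h0]; rfl))
      (hk k).continuous (by omega)).const_mul_left _).add
      ((expRem_isBigO (isBigO_norm_of_contDiff hlin (by simp [h0]))
      hlin.continuous (by omega)).const_mul_left _)

/-- As F = -κ|s|², multiplication by F gives -κ(d/2 + m) times the coefficient of 1, while ½ ∑ p_k
∂_k F gives -κ d/2 times it by parts. In the difference the dimension cancels and only m remains. -/
lemma polyCoeff_euler (hγ : ContDiff ℝ ∞ γ) (h0 : γ 0 = 0)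
    (hF : ∀ s, phase c Q e (γ s) = -κ * sumSq s) (hκ : κ ≠ 0) {m K : ℕ} (hK : 2 * m + 3 ≤ K) :
    -κ * (m * polyCoeff γ hγ m 1)
      = ∑ j, c j * polyCoeff γ hγ (m + 1) (cubicTail K (MvPolynomial.X j))
        + Q * polyCoeff γ hγ (m + 1) (cubicTail K (linearForm e)) := by
  have hD := contDiff_det (contDiff_jac hγ)
  have hk := contDiff_pi.1 hγ
  have hlin := contDiff_linear (e := e) hγ
  have hG := fun k => contDiff_phaseGrad (c := c) (Q := Q) (e := e) hγ k
  have hone : polyCoeff γ hγ m 1 = gaussCoeff (fun s => (jac γ s).det) m := by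
    simp [polyCoeff]
  have hgrad : ∀ k, gaussCoeff (fun s => (jac γ s).det * (phaseGrad c Q e (γ s) k * γ s k)) (m + 1)
      = -κ * polyCoeff γ hγ m 1 := by
    intro k
    have h := gaussCoeff_gradient_mul hγ (det_jac_ne_zero hγ h0 hF hκ)
      (sum_phaseGrad_mul_jac hγ hF) (MvPolynomial.X k) k m
    simp only [MvPolynomial.eval_X, MvPolynomial.pderiv_X_self, map_one, mul_one] at h
    rw [h, hone]
  -- τ is F - ½ ∑ p_k ∂_k F along γ, whose truncation is built from `cubicTail`.
  set τ : (ι → ℝ) → ℂ := fun s => ∑ j, c j * ((Complex.exp (γ s j) - 1 - γ s j)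
      - 1 / 2 * (γ s j * (Complex.exp (γ s j) - 1)))
    + Q * ((Complex.exp (∑ j, e j * γ s j) - 1 - ∑ j, e j * γ s j)
      - 1 / 2 * ((∑ j, e j * γ s j) * (Complex.exp (∑ j, e j * γ s j) - 1))) with hτ
  have hφ : ∀ {f : (ι → ℝ) → ℂ}, ContDiff ℝ ∞ f → ContDiff ℝ ∞ fun s =>
      (Complex.exp (f s) - 1 - f s) - 1 / 2 * (f s * (Complex.exp (f s) - 1)) :=
    fun hf => ((hf.cexp.sub contDiff_const).sub hf).sub
      (contDiff_const.mul (hf.mul (hf.cexp.sub contDiff_const)))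
  have hτs : ContDiff ℝ ∞ τ :=
    (ContDiff.sum fun j _ => contDiff_const.mul (hφ (hk j))).add
      (contDiff_const.mul (hφ hlin))
  have hdec : ∀ s, (jac γ s).det * phase c Q e (γ s)
      = (1 / 2 * ∑ k, (jac γ s).det * (phaseGrad c Q e (γ s) k * γ s k))
        + (jac γ s).det * τ s := by
    intro s
    rw [← Finset.mul_sum]
    have : phase c Q e (γ s) = 1 / 2 * ∑ k, phaseGrad c Q e (γ s) k * γ s k + τ s := by
      have h1 : ∑ k, phaseGrad c Q e (γ s) k * γ s k
          = ∑ k, c k * (γ s k * (Complex.exp (γ s k) - 1))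
            + Q * ((∑ j, e j * γ s j) * (Complex.exp (∑ j, e j * γ s j) - 1)) := by
        rw [Finset.sum_mul, Finset.mul_sum, ← Finset.sum_add_distrib]
        refine Finset.sum_congr rfl fun k _ => ?_
        simp only [phaseGrad]
        ring
      rw [h1]
      simp only [phase, hτ, mul_sub (c _), Finset.sum_sub_distrib, Finset.mul_sum, mul_add]
      simp only [mul_left_comm (c _) (1 / 2 : ℂ)]
      simp only [← Finset.mul_sum]
      ring
    rw [this]
    ring
  have hE := gaussCoeff_sumSq_mul hD m
  have hE' : gaussCoeff (fun s => (jac γ s).det * phase c Q e (γ s)) (m + 1)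
      = -κ * ((Fintype.card ι / 2 + m) * polyCoeff γ hγ m 1) := by
    have hsq : ContDiff ℝ ∞ fun s : ι → ℝ => (sumSq s : ℂ) :=
      Complex.ofRealCLM.contDiff.comp contDiff_sumSq
    rw [hone, ← hE, ← gaussCoeff_const_mul (hsq.mul hD)]
    congr 1
    funext s
    rw [hF]
    ring
  simp_rw [hdec] at hE'
  have hGs : ∀ k, ContDiff ℝ ∞ fun s => (jac γ s).det * (phaseGrad c Q e (γ s) k * γ s k) :=
    fun k => hD.mul ((hG k).mul (hk k))
  rw [gaussCoeff_add (contDiff_const.mul (ContDiff.sum fun k _ => hGs k)) (hD.mul hτs),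
    gaussCoeff_const_mul (ContDiff.sum fun k _ => hGs k), gaussCoeff_sum _ hGs] at hE'
  simp only [hgrad, Finset.sum_const, Finset.card_univ, nsmul_eq_mul] at hE'
  have hT : gaussCoeff (fun s => (jac γ s).det * τ s) (m + 1)
      = ∑ j, c j * polyCoeff γ hγ (m + 1) (cubicTail K (MvPolynomial.X j))
        + Q * polyCoeff γ hγ (m + 1) (cubicTail K (linearForm e)) := by
    rw [gaussCoeff_det_mul_congr hγ hτs (K := K) (by omega)
      (∑ j, c j • cubicTail K (MvPolynomial.X j) + Q • cubicTail K (linearForm e))]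
    · simp only [map_add, map_sum, map_smul, smul_eq_mul]
    · have h2 : ∀ s, τ s - MvPolynomial.eval (γ s)
          (∑ j, c j • cubicTail K (MvPolynomial.X j) + Q • cubicTail K (linearForm e))
          = ∑ j, c j * ((1 - 1 / 2 * γ s j) * expRem K (γ s j))
            + Q * ((1 - 1 / 2 * ∑ j, e j * γ s j) * expRem K (∑ j, e j * γ s j)) := by
        intro s
        simp only [map_add, map_sum, MvPolynomial.smul_eval, eval_cubicTail, MvPolynomial.eval_X,
          eval_linearForm, hτ]
        rw [add_sub_add_comm, ← Finset.sum_sub_distrib]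
        congr 1
        · refine Finset.sum_congr rfl fun j _ => ?_
          simp only [cubicTail, expRem, smul_eq_mul]
          ring
        · simp only [cubicTail, expRem, smul_eq_mul]
          ring
      simp_rw [h2]
      have hr : ∀ {f : (ι → ℝ) → ℂ}, ContDiff ℝ ∞ f → f 0 = 0 → (fun s =>
          (1 - 1 / 2 * f s) * expRem K (f s)) =O[𝓝 0] fun s => ‖s‖ ^ K := fun hf h0 =>
        isBigO_mul_left (contDiff_const.sub (contDiff_const.mul hf)).continuous
          (expRem_isBigO (isBigO_norm_of_contDiff hf h0) hf.continuous (by omega))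
      refine (IsBigO.fun_sum fun j _ => ?_).add ?_
      · exact (hr (hk j) (by rw [h0]; rfl)).const_mul_left _
      · exact (hr hlin (by simp [h0])).const_mul_left _
  rw [← hT]
  linear_combination -hE'

/-- The normalized expansion coefficients satisfy the recursion relations. -/
theorem isExpansionFunctional_polyCoeff (hγ : ContDiff ℝ ∞ γ) (h0 : γ 0 = 0)
    (hF : ∀ s, phase c Q e (γ s) = -κ * sumSq s) (hκ : κ ≠ 0) :
    IsExpansionFunctional c Q e
      fun m => ((κ ^ m)⁻¹ * (polyCoeff γ hγ 0 1)⁻¹) • polyCoeff γ hγ m := by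
  have hne : polyCoeff γ hγ 0 1 ≠ 0 := by
    have h1 : polyCoeff γ hγ 0 1 = (Real.sqrt Real.pi : ℂ) ^ Fintype.card ι * (jac γ 0).det := by
      simp [polyCoeff, gaussCoeff_apply_zero]
    rw [h1]
    refine mul_ne_zero (pow_ne_zero _ ?_) (det_jac_ne_zero hγ h0 hF hκ)
    exact_mod_cast (Real.sqrt_pos.2 Real.pi_pos).ne'
  refine ⟨fun m h hh => ?_, ?_, fun m K hK η k => ?_, fun m K hK => ?_⟩
  · have hD := contDiff_det (contDiff_jac hγ)
    have : polyCoeff γ hγ m h = 0 :=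
      gaussCoeff_eq_zero_of_isBigO (hD.mul (contDiff_eval hγ h))
        (isBigO_mul_left hD.continuous (eval_isBigO hγ h0 _ h hh))
    simp [this]
  · simp [hne]
  · have h := polyCoeff_parts hγ h0 hF hκ hK η k
    simp only [LinearMap.smul_apply, smul_eq_mul]
    simp_rw [mul_left_comm _ ((κ ^ (m + 1))⁻¹ * (polyCoeff γ hγ 0 1)⁻¹)]
    rw [← Finset.mul_sum, ← mul_add, ← mul_add, h]
    field_simp
    ring
  · have h := polyCoeff_euler hγ h0 hF hκ hK
    simp only [LinearMap.smul_apply, smul_eq_mul]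
    simp_rw [mul_left_comm _ ((κ ^ (m + 1))⁻¹ * (polyCoeff γ hγ 0 1)⁻¹)]
    rw [← Finset.mul_sum, ← mul_add, ← h]
    field_simp
    ring

end Pullback

end GaussianExpansion

/-! ### The potential and its Hessian in logarithmic coordinates -/

namespace DegreeOneMirror
open GaussianExpansion
open scoped ContDiff

variable {N n : ℕ} {w₀ : ℂ} {w : Fin (N - 1) → ℂ} {lam : Fin n → ℂ} {t : ℂ} {P : Vars N n → ℂ}

/-- The exponents of the monomial `v_1 ⋯ v_n / (u_1 ⋯ u_{N-1})`. -/
def expo : Vars N n → ℂ := Sum.elim (fun _ => -1) fun _ => 1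

/-- The coefficients `w_i`, `-λ_a` of the logarithms. -/
def logCoeff (w : Fin (N - 1) → ℂ) (lam : Fin n → ℂ) : Vars N n → ℂ :=
  Sum.elim w fun a => -lam a

/-- The second derivatives `u_i`, `-v_a` of the linear terms in logarithmic coordinates. -/
noncomputable def diagCoeff (P : Vars N n → ℂ) (j : Vars N n) : ℂ := -expo j * coords P j

/-- The monomial `v_1 ⋯ v_n / (u_1 ⋯ u_{N-1}) * x`. -/
noncomputable def monomial (t : ℂ) (P : Vars N n → ℂ) : ℂ := Complex.exp (logMonomial t P)

lemma coords_ne_zero (P : Vars N n → ℂ) (j : Vars N n) : coords P j ≠ 0 := Complex.exp_ne_zero _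

lemma expo_mul_self (j : Vars N n) : (expo j : ℂ) * expo j = 1 := by
  cases j <;> simp [expo]

lemma logMonomial_eq (t : ℂ) (P : Vars N n → ℂ) : logMonomial t P = ∑ j, expo j * P j + t := by
  simp only [logMonomial, expo, Fintype.sum_sum_type, Sum.elim_inl, Sum.elim_inr, neg_one_mul,
    one_mul, Finset.sum_neg_distrib]
  ring

lemma potential_eq (t : ℂ) (P : Vars N n → ℂ) :
    potential w₀ w lam t P = ∑ j, (-expo j * Complex.exp (P j) + logCoeff w lam j * P j)
      + Complex.exp (logMonomial t P) + w₀ * logMonomial t P := by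
  simp only [potential, coords, expo, logCoeff, Fintype.sum_sum_type, Sum.elim_inl, Sum.elim_inr,
    neg_neg, one_mul]
  have h : ∀ a : Fin n, -1 * Complex.exp (P (Sum.inr a)) + -lam a * P (Sum.inr a)
      = -(Complex.exp (P (Sum.inr a)) + lam a * P (Sum.inr a)) := fun a => by ring
  simp_rw [h, Finset.sum_neg_distrib]
  ring

/-- The derivative of the potential in the logarithm of the `j`-th coordinate. -/
noncomputable def logDeriv (w₀ : ℂ) (w : Fin (N - 1) → ℂ) (lam : Fin n → ℂ) (t : ℂ)
    (P : Vars N n → ℂ) (j : Vars N n) : ℂ :=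
  diagCoeff P j + logCoeff w lam j + expo j * (monomial t P + w₀)

section Derivatives

variable {p : ℂ → Vars N n → ℂ} {p' : Vars N n → ℂ} {x : ℂ}

lemma hasDerivAt_logMonomial (hp : ∀ i, HasDerivAt (fun h => p h i) (p' i) x) :
    HasDerivAt (fun h => logMonomial t (p h)) (∑ j, expo j * p' j) x := by
  simp only [logMonomial_eq]
  exact (HasDerivAt.fun_sum fun j _ => (hp j).const_mul (expo j)).add_const t

lemma hasDerivAt_potential (hp : ∀ i, HasDerivAt (fun h => p h i) (p' i) x) :
    HasDerivAt (fun h => potential w₀ w lam t (p h)) (∑ j, logDeriv w₀ w lam t (p x) j * p' j) x := by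
  simp only [potential_eq]
  have hL := hasDerivAt_logMonomial (t := t) hp
  convert! ((HasDerivAt.fun_sum fun j _ => ((hp j).cexp.const_mul (-expo j)).fun_add
    ((hp j).const_mul (logCoeff w lam j))).fun_add hL.cexp).fun_add (hL.const_mul w₀) using 1
  rw [Finset.mul_sum, Finset.mul_sum, ← Finset.sum_add_distrib, ← Finset.sum_add_distrib]
  refine Finset.sum_congr rfl fun j _ => ?_
  simp only [logDeriv, diagCoeff, coords, monomial]
  ring

end Derivatives

lemma coords_lift {z : Vars N n → ℂ} {j : Vars N n} (hz : z j ≠ 0) :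
    coords (lift P z) j = z j := by
  have h := coords_ne_zero P j
  rw [coords, lift, Complex.exp_add, Complex.exp_log (div_ne_zero hz h)]
  exact mul_div_cancel₀ _ h

lemma lift_coords : lift P (coords P) = P := by
  funext j
  simp [lift, coords_ne_zero]

/-- The points near `coords P` where the branches of the logarithms are smooth. -/
def IsNear (P z : Vars N n → ℂ) : Prop := ∀ j, z j / coords P j ∈ Complex.slitPlane

lemma IsNear.ne_zero {z : Vars N n → ℂ} (h : IsNear P z) (j : Vars N n) : z j ≠ 0 := by
  intro h0
  have := Complex.slitPlane_ne_zero (h j)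
  rw [h0, zero_div] at this
  exact this rfl

lemma isNear_coords : IsNear P (coords P) := fun j => by
  rw [div_self (coords_ne_zero P j)]
  exact Complex.one_mem_slitPlane

lemma hasDerivAt_lift {z : Vars N n → ℂ} (hz : IsNear P z) (j i : Vars N n) :
    HasDerivAt (fun h => lift P (Function.update z j h) i) (if i = j then (z j)⁻¹ else 0) (z j) := by
  by_cases hij : i = j
  · subst hij
    simp only [lift, Function.update_self, if_true]
    have h1 := ((hasDerivAt_id (z i)).div_const (coords P i)).clog (hz i)
    convert! h1.const_add (P i) using 1
    have := coords_ne_zero P i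
    have := hz.ne_zero i
    simp only [id]
    field_simp
  · simp only [lift, Function.update_of_ne hij, if_neg hij]
    exact hasDerivAt_const _ _

lemma pderiv_localPotential {z : Vars N n → ℂ} (hz : IsNear P z) (j : Vars N n) :
    pderiv j (localPotential w₀ w lam t P) z = logDeriv w₀ w lam t (lift P z) j * (z j)⁻¹ := by
  have h := hasDerivAt_potential (w₀ := w₀) (w := w) (lam := lam) (t := t)
    (p := fun h => lift P (Function.update z j h)) (hasDerivAt_lift hz j)
  simp only [Function.update_eq_self, mul_ite, mul_zero, Finset.sum_ite_eq', Finset.mem_univ,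
    if_true] at h
  exact h.deriv

lemma IsCriticalPoint.logDeriv_eq_zero (h : IsCriticalPoint w₀ w lam t P) (j : Vars N n) :
    logDeriv w₀ w lam t P j = 0 := by
  have h1 := h j
  rw [pderiv_localPotential isNear_coords, lift_coords] at h1
  exact (mul_eq_zero.1 h1).resolve_right (inv_ne_zero (coords_ne_zero P j))

lemma eventually_isNear_update (i : Vars N n) :
    ∀ᶠ h in 𝓝 (coords P i), IsNear P (Function.update (coords P) i h) := by
  have : ∀ᶠ h in 𝓝 (coords P i), h / coords P i ∈ Complex.slitPlane := by
    have hc : ContinuousAt (fun h => h / coords P i) (coords P i) :=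
      continuousAt_id.div_const _
    refine hc.eventually_mem (Complex.isOpen_slitPlane.mem_nhds ?_)
    rw [div_self (coords_ne_zero P i)]
    exact Complex.one_mem_slitPlane
  filter_upwards [this] with h hh j
  by_cases hj : j = i
  · subst hj
    simpa using hh
  · rw [Function.update_of_ne hj]
    exact isNear_coords j

/-- The first derivative is the logarithmic derivative times 1/z_j. At a critical point the
derivative of 1/z_j multiplies zero, so the Hessian is the logarithmic one scaled by 1/z_i and
1/z_j. -/
lemma pderiv_pderiv_localPotential (h : IsCriticalPoint w₀ w lam t P) (i j : Vars N n) :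
    pderiv i (pderiv j (localPotential w₀ w lam t P)) (coords P)
      = (coords P i)⁻¹ * (quadMatrix (diagCoeff P) (monomial t P) expo i j * (coords P j)⁻¹) := by
  have hz := isNear_coords (P := P)
  have hne := coords_ne_zero P
  have he : (fun y => pderiv j (localPotential w₀ w lam t P) (Function.update (coords P) i y))
      =ᶠ[𝓝 (coords P i)] fun y =>
        (-expo j * Function.update (coords P) i y j + logCoeff w lam j
          + expo j * (monomial t (lift P (Function.update (coords P) i y)) + w₀))
          * (Function.update (coords P) i y j)⁻¹ := by
    filter_upwards [eventually_isNear_update i] with y hy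
    rw [pderiv_localPotential hy, logDeriv, diagCoeff, coords_lift (hy.ne_zero j)]
  rw [pderiv, he.deriv_eq]
  have hL := hasDerivAt_logMonomial (t := t)
    (p := fun h => lift P (Function.update (coords P) i h)) (hasDerivAt_lift hz i)
  simp only [mul_ite, mul_zero, Finset.sum_ite_eq', Finset.mem_univ, if_true] at hL
  have hU : HasDerivAt (fun y => Function.update (coords P) i y j) (if j = i then 1 else 0)
      (coords P i) := by
    by_cases hj : j = i
    · subst hj
      simpa using hasDerivAt_id' (coords P j)
    · simp only [Function.update_of_ne hj, if_neg hj]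
      exact hasDerivAt_const _ _
  have hzero := h.logDeriv_eq_zero j
  have hnum := ((hU.const_mul (-expo j)).add_const (logCoeff w lam j)).fun_add
    ((hL.cexp.add_const w₀).const_mul (expo j))
  have hinv := hU.fun_inv (by rw [Function.update_eq_self]; exact hne j)
  have hd := (hnum.fun_mul hinv).deriv
  simp only [Function.update_eq_self, lift_coords] at hd
  simp only [logDeriv, diagCoeff, monomial] at hzero
  simp only [monomial]
  rw [hd, hzero, zero_mul, add_zero]
  simp only [quadMatrix, Matrix.add_apply, Matrix.of_apply, Matrix.diagonal_apply, diagCoeff,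
    eq_comm (a := j) (b := i)]
  split_ifs with hij
  · subst hij
    have := hne i
    field_simp
  · ring

/-- The product `v_1 ⋯ v_n`. -/
noncomputable def vProd (P : Vars N n → ℂ) : ℂ := ∏ a : Fin n, coords P (Sum.inr a)

lemma prod_coords (P : Vars N n → ℂ) : ∏ j, coords P j = uProd P * vProd P := by
  rw [Fintype.prod_sum_type, uProd, vProd]

lemma uProd_ne_zero (P : Vars N n → ℂ) : uProd P ≠ 0 :=
  Finset.prod_ne_zero_iff.2 fun _ _ => coords_ne_zero P _

lemma vProd_ne_zero (P : Vars N n → ℂ) : vProd P ≠ 0 :=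
  Finset.prod_ne_zero_iff.2 fun _ _ => coords_ne_zero P _

lemma hess_mul (h : IsCriticalPoint w₀ w lam t P) :
    hess w₀ w lam t P * (uProd P * vProd P) ^ 2
      = (quadMatrix (diagCoeff P) (monomial t P) expo).det := by
  have h1 : (Matrix.of fun i j : Vars N n =>
      pderiv i (pderiv j (localPotential w₀ w lam t P)) (coords P))
      = Matrix.of fun i j => (coords P i)⁻¹ * (Matrix.of fun i j =>
          (coords P j)⁻¹ * quadMatrix (diagCoeff P) (monomial t P) expo i j) i j := by
    ext i j
    rw [Matrix.of_apply, pderiv_pderiv_localPotential h, Matrix.of_apply, Matrix.of_apply,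
      mul_comm (quadMatrix _ _ _ _ _)]
  rw [hess, h1, Matrix.det_mul_column, Matrix.det_mul_row, Finset.prod_inv_distrib, prod_coords]
  have := uProd_ne_zero P
  have := vProd_ne_zero P
  field_simp

/-- The critical equations express each logarithm coefficient through c_j, Q and w₀; after
substitution w₀ cancels as well. -/
lemma phase_eq (h : IsCriticalPoint w₀ w lam t P) (p : Vars N n → ℂ) :
    phase (diagCoeff P) (monomial t P) expo p
      = potential w₀ w lam t (P + p) - potential w₀ w lam t P := by
  have hL : logMonomial t (P + p) = logMonomial t P + ∑ j, expo j * p j := by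
    simp only [logMonomial_eq, Pi.add_apply, mul_add, Finset.sum_add_distrib]
    ring
  have h1 : ∀ j, logCoeff w lam j = -diagCoeff P j - expo j * (monomial t P + w₀) := fun j => by
    have := h.logDeriv_eq_zero j
    rw [logDeriv] at this
    linear_combination this
  rw [potential_eq, potential_eq, hL, phase]
  have h2 : ∑ j, (-expo j * Complex.exp ((P + p) j) + logCoeff w lam j * (P + p) j)
      - ∑ j, (-expo j * Complex.exp (P j) + logCoeff w lam j * P j)
      = ∑ j, diagCoeff P j * (Complex.exp (p j) - 1 - p j)
        - (monomial t P + w₀) * ∑ j, expo j * p j := by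
    rw [Finset.mul_sum, ← Finset.sum_sub_distrib, ← Finset.sum_sub_distrib]
    refine Finset.sum_congr rfl fun j _ => ?_
    rw [h1, Pi.add_apply, Complex.exp_add, diagCoeff, coords]
    ring
  rw [Complex.exp_add, ← monomial]
  linear_combination -h2

end DegreeOneMirror

/-! ### The oscillatory integral as a Gaussian integral; its saddle point expansion -/

namespace DegreeOneMirror
open GaussianExpansion
open scoped ContDiff

variable {N n : ℕ} {w₀ : ℂ} {w : Fin (N - 1) → ℂ} {lam : Fin n → ℂ} {t : ℂ} {P : Vars N n → ℂ}
  {θ : ℝ} {γ : (Vars N n → ℝ) → (Vars N n → ℂ)}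

lemma card_vars (N n : ℕ) : Fintype.card (Vars N n) = N - 1 + n := by simp

/-- The exponents of `v_1 ⋯ v_n`. -/
def vExpo : Vars N n → ℂ := Sum.elim (fun _ => 0) fun _ => 1

/-- The pull-back by `γ` of the holomorphic volume form, divided by its coefficient at `0`. -/
noncomputable def amplitude (γ : (Vars N n → ℝ) → (Vars N n → ℂ)) (s : Vars N n → ℝ) : ℂ :=
  (jac γ s).det * Complex.exp (∑ j, vExpo j * γ s j)

lemma contDiff_amplitude (hγ : ContDiff ℝ ∞ γ) : ContDiff ℝ ∞ (amplitude γ) :=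
  (contDiff_det (contDiff_jac hγ)).mul (contDiff_linear hγ).cexp

lemma jac_sub_const (γ : (Vars N n → ℝ) → (Vars N n → ℂ)) (P : Vars N n → ℂ) (s : Vars N n → ℝ) :
    jac (fun s => γ s - P) s = jac γ s := by
  ext i j
  simp only [jac, Matrix.of_apply, Pi.sub_apply, pd_sub_const]

lemma IsLefschetzThimble.contDiff_sub (h : IsLefschetzThimble w₀ w lam t P θ γ) :
    ContDiff ℝ ∞ fun s => γ s - P :=
  h.smooth.sub contDiff_const

lemma exp_I_mul_pi_add (θ : ℝ) :
    Complex.exp (Complex.I * (Real.pi + θ)) = -Complex.exp (Complex.I * θ) := by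
  rw [mul_add, Complex.exp_add, mul_comm Complex.I Real.pi, Complex.exp_pi_mul_I, neg_one_mul]

lemma IsLefschetzThimble.phase_sub (h : IsLefschetzThimble w₀ w lam t P θ γ)
    (hP : IsCriticalPoint w₀ w lam t P) (s : Vars N n → ℝ) :
    phase (diagCoeff P) (monomial t P) expo (γ s - P)
      = -Complex.exp (Complex.I * θ) * sumSq s := by
  rw [phase_eq hP, add_sub_cancel, h.fibre, exp_I_mul_pi_add, sumSq]
  ring

/-- Along the thimble (W - W(P))/ħ = -|s|²/ε, since the phases of the ray and of ħ cancel. Passing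
to logarithms cancels the factors 1/u_i of the form and leaves the product of the v_a. -/
lemma oscIntegrand_eq (h : IsLefschetzThimble w₀ w lam t P θ γ) {ε : ℝ} (hε : 0 < ε)
    (s : Vars N n → ℝ) :
    Complex.exp (-(potential w₀ w lam t P / hbar θ ε)) * oscIntegrand w₀ w lam t γ (hbar θ ε) s
      = (gauss ε s : ℂ) * (vProd P * amplitude (fun s => γ s - P) s) := by
  have hsm : ContDiff ℝ ∞ γ := h.smooth
  have h1 : Complex.exp (-(potential w₀ w lam t P / hbar θ ε))
      * Complex.exp (potential w₀ w lam t (γ s) / hbar θ ε) = (gauss ε s : ℂ) := by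
    rw [← Complex.exp_add, h.fibre, exp_I_mul_pi_add, gauss, Complex.ofReal_exp]
    congr 1
    have h2 : (ε : ℂ) ≠ 0 := by exact_mod_cast hε.ne'
    have h3 := Complex.exp_ne_zero (Complex.I * θ)
    rw [hbar, sumSq]
    push_cast
    field_simp
    ring
  have h2 : (Matrix.of fun i j : Vars N n =>
        fderiv ℝ (fun s' => coords (γ s') i) s (Pi.single j (1 : ℝ)))
      = Matrix.of fun i j => coords (γ s) i * jac γ s i j := by
    ext i j
    exact pd_exp (contDiff_pi.1 hsm i) j s
  have h3 : vProd (γ s) = vProd P * Complex.exp (∑ j, vExpo j * (γ s - P) j) := by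
    rw [Complex.exp_sum, Fintype.prod_sum_type, vProd, vProd]
    simp only [vExpo, Sum.elim_inl, Sum.elim_inr, zero_mul, Complex.exp_zero, Finset.prod_const_one,
      one_mul]
    rw [← Finset.prod_mul_distrib]
    refine Finset.prod_congr rfl fun a _ => ?_
    rw [coords, coords, ← Complex.exp_add, Pi.sub_apply, add_sub_cancel]
  rw [oscIntegrand, h2, Matrix.det_mul_column, prod_coords, amplitude, jac_sub_const, ← h1, h3]
  have := uProd_ne_zero (γ s)
  field_simp

/-- The coefficients of the Gaussian expansion of the oscillatory integral. -/
noncomputable def oscCoeff (γ : (Vars N n → ℝ) → (Vars N n → ℂ)) (P : Vars N n → ℂ) (m : ℕ) : ℂ :=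
  vProd P * gaussCoeff (amplitude fun s => γ s - P) m

lemma hasGaussExpansion_oscIntegral (h : IsLefschetzThimble w₀ w lam t P θ γ)
    (hc : Converges w₀ w lam t θ γ) :
    HasGaussExpansion (N - 1 + n) (fun ε => Complex.exp (-(potential w₀ w lam t P / hbar θ ε))
      * oscIntegral w₀ w lam t γ (hbar θ ε)) (oscCoeff γ P) := by
  obtain ⟨ε₀, hi, hε₀⟩ := (hc.and self_mem_nhdsWithin).exists
  have hε₀ : 0 < ε₀ := hε₀
  have hs := contDiff_amplitude h.contDiff_sub
  have hf : ContDiff ℝ ∞ fun s => vProd P * amplitude (fun s => γ s - P) s :=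
    contDiff_const.mul hs
  have hint : Integrable fun s => (gauss ε₀ s : ℂ) * (vProd P * amplitude (fun s => γ s - P) s) := by
    refine (hi.const_mul (Complex.exp (-(potential w₀ w lam t P / hbar θ ε₀)))).congr
      (Eventually.of_forall fun s => ?_)
    exact oscIntegrand_eq h hε₀ s
  have hg := hasGaussExpansion hf hε₀ hint
  rw [card_vars] at hg
  intro M
  refine (hg M).congr' ?_ EventuallyEq.rfl
  filter_upwards [self_mem_nhdsWithin] with ε (hε : 0 < ε)
  simp only [oscIntegral]
  rw [← integral_const_mul]
  simp_rw [oscIntegrand_eq h hε, oscCoeff, gaussCoeff_const_mul hs]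

lemma gaussCoeff_amplitude_zero (h0 : γ 0 = 0) :
    gaussCoeff (amplitude γ) 0 = (Real.sqrt Real.pi : ℂ) ^ (N - 1 + n) * (jac γ 0).det := by
  rw [gaussCoeff_apply_zero, card_vars, amplitude, h0]
  simp

lemma oscCoeff_zero (h : IsLefschetzThimble w₀ w lam t P θ γ) :
    oscCoeff γ P 0
      = vProd P * ((Real.sqrt Real.pi : ℂ) ^ (N - 1 + n) * (jac (fun s => γ s - P) 0).det) := by
  rw [oscCoeff, gaussCoeff_amplitude_zero (by rw [h.base, sub_self])]

lemma oscCoeff_zero_ne_zero (h : IsLefschetzThimble w₀ w lam t P θ γ)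
    (hP : IsCriticalPoint w₀ w lam t P) : oscCoeff γ P 0 ≠ 0 := by
  rw [oscCoeff_zero h]
  refine mul_ne_zero (vProd_ne_zero P) (mul_ne_zero (pow_ne_zero _ ?_) ?_)
  · exact_mod_cast (Real.sqrt_pos.2 Real.pi_pos).ne'
  · exact det_jac_ne_zero h.contDiff_sub (by rw [h.base, sub_self]) (h.phase_sub hP)
      (Complex.exp_ne_zero _)

/-- The square of the leading coefficient is determined by the Hessian. -/
lemma oscCoeff_zero_sq_mul_hess (h : IsLefschetzThimble w₀ w lam t P θ γ)
    (hP : IsCriticalPoint w₀ w lam t P) :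
    oscCoeff γ P 0 ^ 2 * (uProd P ^ 2 * hess w₀ w lam t P)
      = (-2 * Real.pi * Complex.exp (Complex.I * θ)) ^ (N - 1 + n) := by
  have h1 := det_jac_sq_mul h.contDiff_sub (by rw [h.base, sub_self]) (h.phase_sub hP)
  have h2 := hess_mul hP
  rw [← h2, card_vars] at h1
  have h3 : ((Real.sqrt Real.pi : ℂ) ^ (N - 1 + n)) ^ 2 = (Real.pi : ℂ) ^ (N - 1 + n) := by
    rw [← pow_mul, mul_comm, pow_mul, ← Complex.ofReal_pow, Real.sq_sqrt Real.pi_pos.le]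
  rw [oscCoeff_zero h]
  calc _ = ((Real.sqrt Real.pi : ℂ) ^ (N - 1 + n)) ^ 2 *
        ((jac (fun s => γ s - P) 0).det ^ 2 * (hess w₀ w lam t P * (uProd P * vProd P) ^ 2)) := by
        ring
    _ = _ := by
      rw [h1, h3, ← mul_pow]
      congr 1
      ring

/-- The coefficients `I_m` of the saddle point expansion. -/
noncomputable def saddleCoeff (θ : ℝ) (γ : (Vars N n → ℝ) → (Vars N n → ℂ)) (P : Vars N n → ℂ)
    (m : ℕ) : ℂ := (Complex.exp (Complex.I * θ) ^ m)⁻¹ * (oscCoeff γ P m / oscCoeff γ P 0)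

lemma hasSaddleExpansion_saddleCoeff (h : IsLefschetzThimble w₀ w lam t P θ γ)
    (hP : IsCriticalPoint w₀ w lam t P) (hc : Converges w₀ w lam t θ γ) :
    HasSaddleExpansion w₀ w lam t P θ γ (saddleCoeff θ γ P) := by
  obtain ⟨q, hq⟩ := IsAlgClosed.exists_pow_nat_eq
    (-2 * Real.pi * Complex.exp (Complex.I * θ)) two_pos
  have hq0 : q ≠ 0 := by
    rintro rfl
    have hpi : (Real.pi : ℂ) ≠ 0 := by exact_mod_cast Real.pi_ne_zero
    exact mul_ne_zero (mul_ne_zero (by norm_num) hpi) (Complex.exp_ne_zero _)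
      (hq.symm.trans (zero_pow two_ne_zero))
  have ha := oscCoeff_zero_ne_zero h hP
  have hu := uProd_ne_zero P
  -- The root of the Hessian is chosen so that the prefactor is exactly the leading coefficient;
  -- `oscCoeff_zero_sq_mul_hess` shows that it squares to the Hessian.
  refine ⟨q, q ^ (N - 1 + n) / (uProd P * oscCoeff γ P 0), hq, ?_, ?_, fun M => ?_⟩
  · rw [div_pow, div_eq_iff (by positivity), ← pow_mul, mul_comm (N - 1 + n), pow_mul, hq,
      ← oscCoeff_zero_sq_mul_hess h hP]
    ring
  · positivity
  · refine (hasGaussExpansion_oscIntegral h hc M).congr_left fun ε => ?_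
    congr 1
    have h1 : (q * (Real.sqrt ε : ℂ)) ^ (N - 1 + n)
        / (uProd P * (q ^ (N - 1 + n) / (uProd P * oscCoeff γ P 0)))
        = (Real.sqrt ε : ℂ) ^ (N - 1 + n) * oscCoeff γ P 0 := by
      rw [mul_pow]
      field_simp
    have h2 : Finset.range (M + 1) = insert 0 (Finset.Icc 1 M) := by
      ext k; simp; omega
    rw [h1, mul_assoc, h2, Finset.sum_insert (by simp), pow_zero, one_mul]
    congr 1
    rw [mul_add, mul_one, Finset.mul_sum]
    congr 1
    refine Finset.sum_congr rfl fun m _ => ?_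
    have := Complex.exp_ne_zero (Complex.I * θ)
    rw [saddleCoeff, hbar, mul_pow]
    field_simp

/-- The coefficients of a saddle point expansion are unique. -/
lemma HasSaddleExpansion.eq_saddleCoeff {I : ℕ → ℂ}
    (hI : HasSaddleExpansion w₀ w lam t P θ γ I) (h : IsLefschetzThimble w₀ w lam t P θ γ)
    (hc : Converges w₀ w lam t θ γ) {m : ℕ} (hm : 1 ≤ m) : I m = saddleCoeff θ γ P m := by
  obtain ⟨q, r, hq, hr, hr0, hM⟩ := hI
  have hq0 : q ≠ 0 := by
    rintro rfl
    have hpi : (Real.pi : ℂ) ≠ 0 := by exact_mod_cast Real.pi_ne_zero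
    exact mul_ne_zero (mul_ne_zero (by norm_num) hpi) (Complex.exp_ne_zero _)
      (hq.symm.trans (zero_pow two_ne_zero))
  have hu := uProd_ne_zero P
  -- The given expansion in Gaussian form, with the prefactor as its coefficient of index 0.
  -- Uniqueness applies, and the ratio b_m / b_0 no longer involves q or r.
  set b : ℕ → ℂ := fun k => q ^ (N - 1 + n) / (uProd P * r)
    * (Complex.exp (Complex.I * θ) ^ k * if k = 0 then 1 else I k) with hb
  have hexp : HasGaussExpansion (N - 1 + n)
      (fun ε => Complex.exp (-(potential w₀ w lam t P / hbar θ ε))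
      * oscIntegral w₀ w lam t γ (hbar θ ε)) b := fun M => by
    refine (hM M).congr_left fun ε => ?_
    congr 1
    have h2 : Finset.range (M + 1) = insert 0 (Finset.Icc 1 M) := by
      ext k; simp; omega
    rw [h2, Finset.sum_insert (by simp), mul_add, mul_add, mul_one, mul_pow, Finset.mul_sum,
      Finset.mul_sum]
    congr 1
    · simp only [hb, pow_zero, if_true]
      ring
    · refine Finset.sum_congr rfl fun m hm => ?_
      have : m ≠ 0 := by have := (Finset.mem_Icc.1 hm).1; omega
      simp only [hb, if_neg this, hbar, mul_pow]
      ring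
  have heq := (hasGaussExpansion_oscIntegral h hc).unique hexp
  have := Complex.exp_ne_zero (Complex.I * θ)
  have hm0 : m ≠ 0 := by omega
  rw [saddleCoeff, heq]
  simp only [hb, if_true, if_neg hm0, pow_zero]
  field_simp

/-- The coefficients in terms of the normalized functional, for the phase divided by `y`. -/
lemma saddleCoeff_eq (h : IsLefschetzThimble w₀ w lam t P θ γ)
    (hP : IsCriticalPoint w₀ w lam t P) {y : ℂ} (hy : y ≠ 0) :
    ∃ B : ℕ → MvPolynomial (Vars N n) ℂ →ₗ[ℂ] ℂ,
      IsExpansionFunctional (fun j => diagCoeff P j / y) (monomial t P / y) expo B ∧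
      ∀ m, saddleCoeff θ γ P m = (y ^ m)⁻¹
        * B m (1 + linearForm vExpo + expTail (2 * m + 2) (linearForm vExpo)) := by
  have hγ := h.contDiff_sub
  have h0 : (fun s => γ s - P) 0 = 0 := by simp only [h.base, sub_self]
  -- Dividing the phase by y replaces κ = exp(iθ) by exp(iθ)/y, so the normalization κ^{-m} of the
  -- functional contributes y^m, to be compensated by y^{-m}.
  have hκ : Complex.exp (Complex.I * θ) / y ≠ 0 := div_ne_zero (Complex.exp_ne_zero _) hy
  have hF : ∀ s, phase (fun j => diagCoeff P j / y) (monomial t P / y) expo (γ s - P)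
      = -(Complex.exp (Complex.I * θ) / y) * sumSq s := by
    intro s
    have h1 := h.phase_sub hP s
    have h2 : phase (fun j => diagCoeff P j / y) (monomial t P / y) expo (γ s - P)
        = phase (diagCoeff P) (monomial t P) expo (γ s - P) / y := by
      simp only [phase, add_div, Finset.sum_div, div_mul_eq_mul_div]
    rw [h2, h1]
    ring
  refine ⟨_, isExpansionFunctional_polyCoeff hγ h0 hF hκ, fun m => ?_⟩
  -- The exponential in the amplitude may be truncated at order 2m + 2, beyond the degree 2m that
  -- the coefficient sees.
  have h1 : gaussCoeff (amplitude fun s => γ s - P) m = polyCoeff (fun s => γ s - P) hγ m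
      (1 + linearForm vExpo + expTail (2 * m + 2) (linearForm vExpo)) := by
    have hlin := contDiff_linear (e := vExpo) hγ
    refine gaussCoeff_det_mul_congr hγ hlin.cexp (K := 2 * m + 2) (by omega) _ ?_
    have h2 : ∀ s, Complex.exp (∑ j, vExpo j * (γ s - P) j)
        - MvPolynomial.eval (γ s - P)
          (1 + linearForm vExpo + expTail (2 * m + 2) (linearForm vExpo))
        = expRem (2 * m + 2) (∑ j, vExpo j * (γ s - P) j) := by
      intro s
      simp only [map_add, map_one, eval_linearForm, eval_expTail, expRem]
      ring
    simp_rw [h2]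
    exact expRem_isBigO (isBigO_norm_of_contDiff hlin (by simp [h.base])) hlin.continuous (by omega)
  have h3 : gaussCoeff (amplitude fun s => γ s - P) 0 = polyCoeff (fun s => γ s - P) hγ 0 1 := by
    rw [gaussCoeff_amplitude_zero h0]
    simp only [polyCoeff, LinearMap.coe_mk, AddHom.coe_mk, map_one, mul_one]
    rw [gaussCoeff_apply_zero, card_vars]
  have := vProd_ne_zero P
  have := Complex.exp_ne_zero (Complex.I * θ)
  rw [saddleCoeff, oscCoeff, oscCoeff, h1, h3, mul_div_mul_left _ _ (vProd_ne_zero P)]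
  simp only [LinearMap.smul_apply, smul_eq_mul, div_pow, inv_div]
  field_simp

end DegreeOneMirror

/-! ### Bounds from a nondegenerate rescaled limit -/

namespace DegreeOneMirror
open GaussianExpansion

variable {N n : ℕ} {w₀ : ℂ} {w : Fin (N - 1) → ℂ} {lam : Fin n → ℂ} {l : Filter ℂ}
  {P : ℂ → Vars N n → ℂ} {y : ℂ → ℂ} {c : Vars N n → ℂ} {Q : ℂ}

lemma det_quadMatrix_div (d : Vars N n → ℂ) (q : ℂ) {z : ℂ} (hz : z ≠ 0) :
    (quadMatrix d q expo).det
      = z ^ (N - 1 + n) * (quadMatrix (fun j => d j / z) (q / z) expo).det := by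
  rw [← card_vars, ← Matrix.det_smul]
  congr 1
  ext i j
  simp only [quadMatrix, Matrix.add_apply, Matrix.smul_apply, Matrix.of_apply,
    Matrix.diagonal_apply, smul_eq_mul]
  split_ifs
  · field_simp
  · field_simp
    ring

lemma tendsto_quadMatrix {α : Type*} {l : Filter α} {d : α → Vars N n → ℂ} {q : α → ℂ}
    (hc : ∀ j, Tendsto (fun t => d t j) l (𝓝 (c j))) (hQ : Tendsto q l (𝓝 Q)) :
    Tendsto (fun t => quadMatrix (d t) (q t) expo) l (𝓝 (quadMatrix c Q expo)) := by
  have hcont : Continuous fun z : (Vars N n → ℂ) × ℂ => quadMatrix z.1 z.2 expo := by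
    refine continuous_matrix fun i j => ?_
    simp only [quadMatrix, Matrix.add_apply, Matrix.of_apply, Matrix.diagonal_apply]
    split_ifs <;> fun_prop
  have hd : Tendsto d l (𝓝 c) := tendsto_pi_nhds.2 hc
  have h := (hcont.tendsto (c, Q)).comp (hd.prodMk_nhds hQ)
  exact h

lemma tendsto_det_quadMatrix {α : Type*} {l : Filter α} {d : α → Vars N n → ℂ} {q : α → ℂ}
    (hc : ∀ j, Tendsto (fun t => d t j) l (𝓝 (c j))) (hQ : Tendsto q l (𝓝 Q)) :
    Tendsto (fun t => (quadMatrix (d t) (q t) expo).det) l (𝓝 (quadMatrix c Q expo).det) :=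
  ((continuous_id.matrix_det).tendsto _).comp (tendsto_quadMatrix hc hQ)

/-- The bound for the prefactor, for a family of critical points at which the quadratic part of
the potential, divided by `y`, has a nondegenerate limit. -/
theorem prefactorBound_of_tendsto (hP : ∀ᶠ t in l, IsCriticalPoint w₀ w lam t (P t))
    (hy : ∀ᶠ t in l, y t ≠ 0)
    (hc : ∀ j, Tendsto (fun t => diagCoeff (P t) j / y t) l (𝓝 (c j)))
    (hQ : Tendsto (fun t => monomial t (P t) / y t) l (𝓝 Q))
    (hdet : (quadMatrix c Q expo).det ≠ 0) {α : ℝ}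
    (hv : (fun t => vProd (P t) ^ 2 / y t ^ (N - 1 + n))
      =O[l] fun t => (‖Complex.exp t‖ ^ α) ^ 2) :
    PrefactorBound w₀ w lam l P α := by
  have hD := tendsto_det_quadMatrix hc hQ
  have hne := hD.eventually_ne hdet
  have hhess : ∀ᶠ t in l, hess w₀ w lam t (P t) * (uProd (P t) * vProd (P t)) ^ 2
      = y t ^ (N - 1 + n)
        * (quadMatrix (fun j => diagCoeff (P t) j / y t) (monomial t (P t) / y t) expo).det := by
    filter_upwards [hP, hy] with t ht hyt
    rw [hess_mul ht, det_quadMatrix_div _ _ hyt]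
  refine ⟨?_, fun r hr => ?_⟩
  · filter_upwards [hhess, hne, hy] with t h1 h2 hyt h0
    rw [h0, zero_mul] at h1
    exact mul_ne_zero (pow_ne_zero _ hyt) h2 h1.symm
  -- Comparing squares makes the choice of root irrelevant: the square of the prefactor is `vProd`²
  -- / (y^d det), d = N - 1 + n, with det the rescaled determinant, whose limit is nonzero.
  · refine IsBigO.of_pow two_ne_zero ?_
    have h1 : (fun t => vProd (P t) ^ 2 / y t ^ (N - 1 + n) *
        ((quadMatrix (fun j => diagCoeff (P t) j / y t)
          (monomial t (P t) / y t) expo).det)⁻¹) =O[l] fun t => (‖Complex.exp t‖ ^ α) ^ 2 := by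
      simpa using hv.mul ((hD.inv₀ hdet).isBigO_one ℝ)
    refine h1.congr' ?_ EventuallyEq.rfl
    filter_upwards [hhess, hne, hy, hr] with t h2 h3 hyt hrt
    have hu := uProd_ne_zero (P t)
    have hvp := vProd_ne_zero (P t)
    have hyn := pow_ne_zero (N - 1 + n) hyt
    rw [Pi.pow_apply, inv_pow, mul_pow, hrt, div_mul_eq_mul_div, div_eq_iff hyn,
      mul_inv_eq_iff_eq_mul₀ h3, inv_mul_eq_div, div_mul_eq_mul_div, ← h2,
      eq_div_iff]
    · ring
    · intro h0
      rw [mul_eq_zero] at h0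
      have := h0.resolve_left (pow_ne_zero 2 hu)
      rw [this, zero_mul] at h2
      exact mul_ne_zero hyn h3 h2.symm

/-- The bound for the coefficients, for a family of critical points at which the quadratic part of
the potential, divided by `y`, has a nondegenerate limit. -/
theorem coefficientBound_of_tendsto (hP : ∀ᶠ t in l, IsCriticalPoint w₀ w lam t (P t))
    (hy : ∀ᶠ t in l, y t ≠ 0)
    (hc : ∀ j, Tendsto (fun t => diagCoeff (P t) j / y t) l (𝓝 (c j)))
    (hQ : Tendsto (fun t => monomial t (P t) / y t) l (𝓝 Q))
    (hdet : (quadMatrix c Q expo).det ≠ 0) {β : ℝ}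
    (hβ : ∀ m : ℕ, 1 ≤ m → (fun t => (y t ^ m)⁻¹) =O[l] fun t => ‖Complex.exp t‖ ^ β) :
    CoefficientBound w₀ w lam l P β := by
  intro θ γ hγ
  refine ⟨⟨fun m t => saddleCoeff (θ t) (γ t) (P t) m, ?_⟩, fun I hI m hm => ?_⟩
  · filter_upwards [hP, hγ] with t ht hγt
    exact hasSaddleExpansion_saddleCoeff hγt.1 ht hγt.2
  have hB : ∀ t, ∃ B : ℕ → MvPolynomial (Vars N n) ℂ →ₗ[ℂ] ℂ,
      IsLefschetzThimble w₀ w lam t (P t) (θ t) (γ t) → IsCriticalPoint w₀ w lam t (P t) →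
      y t ≠ 0 →
      IsExpansionFunctional (fun j => diagCoeff (P t) j / y t) (monomial t (P t) / y t) expo B ∧
      ∀ m, saddleCoeff (θ t) (γ t) (P t) m = (y t ^ m)⁻¹
        * B m (1 + linearForm vExpo + expTail (2 * m + 2) (linearForm vExpo)) := by
    intro t
    by_cases h : IsLefschetzThimble w₀ w lam t (P t) (θ t) (γ t)
        ∧ IsCriticalPoint w₀ w lam t (P t) ∧ y t ≠ 0
    · obtain ⟨B, hB⟩ := saddleCoeff_eq h.1 h.2.1 h.2.2
      exact ⟨B, fun _ _ _ => hB⟩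
    · exact ⟨0, fun h1 h2 h3 => absurd ⟨h1, h2, h3⟩ h⟩
  choose B hB using hB
  have hD := tendsto_det_quadMatrix hc hQ
  have hbdd := expansion_bounded (l := l) (B := B)
    (c := fun t j => diagCoeff (P t) j / y t) (Q := fun t => monomial t (P t) / y t) (e := expo)
    (by filter_upwards [hP, hγ, hy] with t h1 h2 h3 using (hB t h2.1 h1 h3).1)
    (fun j => (hc j).isBigO_one ℝ) (hQ.isBigO_one ℝ)
    (by filter_upwards [hD.eventually_ne hdet] with t ht using isUnit_iff_ne_zero.2 ht)
    (fun i j => by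
      have hadj := ((continuous_id.matrix_adjugate).tendsto _).comp (tendsto_quadMatrix hc hQ)
      have hij := ((hD.inv₀ hdet).mul
        (((continuous_apply_apply i j).tendsto _).comp hadj)).isBigO_one ℝ
      refine hij.congr_left fun t => ?_
      rw [Matrix.inv_def, Ring.inverse_eq_inv', Matrix.smul_apply, smul_eq_mul]
      rfl)
    m (1 + linearForm vExpo + expTail (2 * m + 2) (linearForm vExpo))
  have h1 : (fun t => (y t ^ m)⁻¹ * B t m
      (1 + linearForm vExpo + expTail (2 * m + 2) (linearForm vExpo)))
      =O[l] fun t => ‖Complex.exp t‖ ^ β := by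
    simpa using (hβ m hm).mul hbdd
  refine h1.congr' ?_ EventuallyEq.rfl
  filter_upwards [hP, hγ, hy, hI] with t h2 h3 h4 h5
  rw [h5.eq_saddleCoeff h3.1 h3.2 hm, (hB t h3.1 h2 h4).2]

lemma det_quadMatrix_ne_zero_of_injective
    (h : ∀ v : Vars N n → ℂ, (∀ j, c j * v j + Q * expo j * ∑ i, expo i * v i = 0) → v = 0) :
    (quadMatrix c Q expo).det ≠ 0 := by
  intro h0
  obtain ⟨v, hv, hv0⟩ := Matrix.exists_mulVec_eq_zero_iff.2 h0
  refine hv (h v fun j => ?_)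
  rw [← quadMatrix_sum]
  exact congrFun hv0 j

lemma expo_ne_zero (j : Vars N n) : expo j ≠ 0 := left_ne_zero_of_mul_eq_one (expo_mul_self j)

/-- For a kernel vector v and μ = e·v, each row gives v_j = μ. Summing, μ = (n - (N - 1)) μ, so (N -
n) μ = 0. -/
lemma det_quadMatrix_neg_expo (hn : n < N) :
    (quadMatrix (fun j : Vars N n => -expo j) 1 expo).det ≠ 0 := by
  refine det_quadMatrix_ne_zero_of_injective fun v hv => ?_
  set μ := ∑ i, expo i * v i with hμ
  have h1 : ∀ j, v j = μ := fun j => by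
    have := hv j
    have h2 : expo j * (μ - v j) = 0 := by linear_combination this
    exact (sub_eq_zero.1 ((mul_eq_zero.1 h2).resolve_left (expo_ne_zero j))).symm
  have h2 : μ = (n - (N - 1 : ℕ)) * μ := by
    conv_lhs => rw [hμ]
    simp_rw [h1]
    rw [← Finset.sum_mul, Fintype.sum_sum_type]
    congr 1
    simp only [expo, Sum.elim_inl, Sum.elim_inr, Finset.sum_const, Finset.card_univ,
      Fintype.card_fin, nsmul_eq_mul]
    ring
  have h3 : ((N : ℂ) - n) * μ = 0 := by
    rw [Nat.cast_sub (by omega)] at h2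
    push_cast at h2
    linear_combination h2
  have h4 : (N : ℂ) - n ≠ 0 := sub_ne_zero.2 (by exact_mod_cast hn.ne')
  funext j
  rw [h1 j, (mul_eq_zero.1 h3).resolve_left h4]
  rfl

/-- The row b forces e·v = 0, then every other row gives v_j = 0, and e·v = 0 leaves v_b = 0. -/
lemma det_quadMatrix_ne_zero_of_one_zero {b : Vars N n} (hb : c b = 0)
    (hc : ∀ j, j ≠ b → c j ≠ 0) (hQ : Q ≠ 0) : (quadMatrix c Q expo).det ≠ 0 := by
  refine det_quadMatrix_ne_zero_of_injective fun v hv => ?_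
  have h1 : ∑ i, expo i * v i = 0 := by
    have := hv b
    rw [hb, zero_mul, zero_add] at this
    exact (mul_eq_zero.1 this).resolve_left (mul_ne_zero hQ (expo_ne_zero b))
  have h2 : ∀ j, j ≠ b → v j = 0 := fun j hj => by
    have := hv j
    rw [h1, mul_zero, add_zero] at this
    exact (mul_eq_zero.1 this).resolve_left (hc j hj)
  rw [Finset.sum_eq_single b (fun j _ hj => by rw [h2 j hj, mul_zero]) (by simp)] at h1
  funext j
  by_cases hj : j = b
  · rw [hj]
    exact (mul_eq_zero.1 h1).resolve_left (expo_ne_zero b)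
  · exact h2 j hj

lemma monomial_mul_uProd (t : ℂ) (P : Vars N n → ℂ) :
    monomial t P * uProd P = Complex.exp t * vProd P := by
  simp only [monomial, logMonomial, uProd, vProd, coords]
  rw [← Complex.exp_sum, ← Complex.exp_sum, ← Complex.exp_add, ← Complex.exp_add]
  congr 1
  ring

lemma IsCriticalPoint.monomial_eq_u {t : ℂ} {P : Vars N n → ℂ}
    (h : IsCriticalPoint w₀ w lam t P) (i : Fin (N - 1)) :
    monomial t P = coords P (Sum.inl i) + (w i - w₀) := by
  have := h.logDeriv_eq_zero (Sum.inl i)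
  simp only [logDeriv, diagCoeff, expo, logCoeff, Sum.elim_inl] at this
  linear_combination -this

lemma IsCriticalPoint.monomial_eq_v {t : ℂ} {P : Vars N n → ℂ}
    (h : IsCriticalPoint w₀ w lam t P) (a : Fin n) :
    monomial t P = coords P (Sum.inr a) + (lam a - w₀) := by
  have := h.logDeriv_eq_zero (Sum.inr a)
  simp only [logDeriv, diagCoeff, expo, logCoeff, Sum.elim_inr] at this
  linear_combination this

lemma norm_exp_rpow (t : ℂ) (a : ℝ) : ‖Complex.exp t‖ ^ a = Real.exp (t.re * a) := by
  rw [Complex.norm_exp, Real.exp_mul]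

lemma tendsto_re (hl : Tendsto (fun t : ℂ => ‖Complex.exp t‖) l atTop) :
    Tendsto (fun t : ℂ => t.re) l atTop := by
  simp only [Complex.norm_exp] at hl
  exact Real.tendsto_exp_comp_atTop.1 hl

lemma tendsto_norm_exp_rpow (hl : Tendsto (fun t : ℂ => ‖Complex.exp t‖) l atTop) {a : ℝ}
    (ha : a < 0) : Tendsto (fun t : ℂ => ‖Complex.exp t‖ ^ a) l (𝓝 0) := by
  simp only [norm_exp_rpow]
  exact Real.tendsto_exp_atBot.comp ((tendsto_re hl).atTop_mul_const_of_neg ha)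

/-- The leading term `ζ^p x^{1 / (N - n)}` of the coordinates for the first type. -/
noncomputable def leadingTerm (N n p : ℕ) (t : ℂ) : ℂ :=
  Complex.exp (2 * Real.pi * Complex.I / ((N : ℂ) - n)) ^ p * Complex.exp (t / ((N : ℂ) - n))

lemma leadingTerm_ne_zero (p : ℕ) (t : ℂ) : leadingTerm N n p t ≠ 0 :=
  mul_ne_zero (pow_ne_zero _ (Complex.exp_ne_zero _)) (Complex.exp_ne_zero _)

lemma norm_leadingTerm (p : ℕ) (t : ℂ) :
    ‖leadingTerm N n p t‖ = Real.exp (t.re / ((N : ℝ) - n)) := by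
  have h1 : (2 * Real.pi * Complex.I / ((N : ℂ) - n)) = ((2 * Real.pi / ((N : ℝ) - n) : ℝ) : ℂ)
      * Complex.I := by
    push_cast; ring
  have h2 : t / ((N : ℂ) - n) = t / (((N : ℝ) - n : ℝ) : ℂ) := by push_cast; ring
  rw [leadingTerm, norm_mul, norm_pow, h1, Complex.norm_exp_ofReal_mul_I, one_pow, one_mul, h2,
    Complex.norm_exp, Complex.div_ofReal_re]

/-! ### Critical points of the first type -/

section TypeOne

variable {p : ℕ}

lemma IsTypeOne.tendsto_coords (h : IsTypeOne l P p) (hn : n < N)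
    (hl : Tendsto (fun t : ℂ => ‖Complex.exp t‖) l atTop) (j : Vars N n) :
    Tendsto (fun t => coords (P t) j / leadingTerm N n p t) l (𝓝 1) := by
  have hN : (0 : ℝ) < (N : ℝ) - n := sub_pos.2 (by exact_mod_cast hn)
  have h1 := (h j).trans_tendsto (tendsto_norm_exp_rpow hl
    (div_neg_of_neg_of_pos (by norm_num : (-1 : ℝ) < 0) hN))
  simpa [leadingTerm] using h1.add_const 1

lemma IsTypeOne.tendsto_monomial (h : IsTypeOne l P p) (hn : n < N) (hp : p ∈ Finset.Icc 1 (N - n))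
    (hl : Tendsto (fun t : ℂ => ‖Complex.exp t‖) l atTop)
    (hP : ∀ᶠ t in l, IsCriticalPoint w₀ w lam t (P t)) :
    Tendsto (fun t => monomial t (P t) / leadingTerm N n p t) l (𝓝 1) := by
  have hN : (0 : ℝ) < (N : ℝ) - n := sub_pos.2 (by exact_mod_cast hn)
  -- For N = 1 there are no variables at all: n = 0 and p = 1, and the monomial is x, equal to the
  -- leading term. Otherwise the critical equation for some u_i gives the monomial up to a constant.
  by_cases h1 : N = 1
  · subst h1
    obtain rfl : n = 0 := by omega
    obtain rfl : p = 1 := by simpa using hp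
    have h2 : ∀ t, monomial t (P t) / leadingTerm 1 0 1 t = 1 := fun t => by
      have : monomial t (P t) = Complex.exp t := by
        simp [monomial, logMonomial]
      rw [this]
      simp [leadingTerm, Complex.exp_two_pi_mul_I, Complex.exp_ne_zero]
    simp only [h2]
    exact tendsto_const_nhds
  · let i : Fin (N - 1) := ⟨0, by omega⟩
    have h2 : Tendsto (fun t => (leadingTerm N n p t)⁻¹) l (𝓝 0) := by
      rw [tendsto_zero_iff_norm_tendsto_zero]
      simp only [norm_inv, norm_leadingTerm, ← Real.exp_neg]
      refine Real.tendsto_exp_atBot.comp (tendsto_neg_atTop_atBot.comp ?_)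
      exact (tendsto_re hl).atTop_div_const hN
    have h3 := (h.tendsto_coords hn hl (Sum.inl i)).add (h2.const_mul (w i - w₀))
    rw [mul_zero, add_zero] at h3
    refine h3.congr' ?_
    filter_upwards [hP] with t ht
    rw [ht.monomial_eq_u i, add_div, div_eq_mul_inv (w i - w₀)]

/-- With y the leading term, `vProd` ~ y^n, so the squared prefactor has size |y|^(2n - (N-1+n)) =
|y|^(-(N-n-1)). The coefficients are even O(|y|^{-m}), and |y|^{-m} ≤ |y|^{-1/2} once |x| ≥ 1. -/
theorem IsTypeOne.bounds (h : IsTypeOne l P p) (hn : n < N) (hp : p ∈ Finset.Icc 1 (N - n))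
    (hl : Tendsto (fun t : ℂ => ‖Complex.exp t‖) l atTop)
    (hP : ∀ᶠ t in l, IsCriticalPoint w₀ w lam t (P t)) :
    PrefactorBound w₀ w lam l P (-((N : ℝ) - n - 1) / (2 * ((N : ℝ) - n))) ∧
    CoefficientBound w₀ w lam l P (-1 / (2 * ((N : ℝ) - n))) := by
  have hN : (0 : ℝ) < (N : ℝ) - n := sub_pos.2 (by exact_mod_cast hn)
  have hco := h.tendsto_coords hn hl
  have hy : ∀ᶠ t in l, leadingTerm N n p t ≠ 0 := Eventually.of_forall (leadingTerm_ne_zero p)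
  have hc : ∀ j, Tendsto (fun t => diagCoeff (P t) j / leadingTerm N n p t) l (𝓝 (-expo j)) := by
    intro j
    simpa only [diagCoeff, mul_div_assoc, mul_one] using (hco j).const_mul (-expo j)
  have hQ := h.tendsto_monomial hn hp hl hP
  have hdet := det_quadMatrix_neg_expo (N := N) hn
  refine ⟨prefactorBound_of_tendsto hP hy hc hQ hdet ?_,
    coefficientBound_of_tendsto hP hy hc hQ hdet fun m hm => ?_⟩
  · have hv : Tendsto (fun t => vProd (P t) / leadingTerm N n p t ^ n) l (𝓝 1) := by
      have := tendsto_finsetProd Finset.univ fun (a : Fin n) _ => hco (Sum.inr a)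
      simpa [vProd, Finset.prod_div_distrib] using this
    have h1 : (fun t => leadingTerm N n p t ^ (2 * n) / leadingTerm N n p t ^ (N - 1 + n))
        =O[l] fun t => (‖Complex.exp t‖ ^ (-((N : ℝ) - n - 1) / (2 * ((N : ℝ) - n)))) ^ 2 := by
      refine isBigO_of_le _ fun t => le_of_eq ?_
      rw [norm_div, norm_pow, norm_pow, norm_leadingTerm, norm_exp_rpow,
        Real.norm_of_nonneg (by positivity), ← Real.exp_nat_mul, ← Real.exp_nat_mul,
        ← Real.exp_nat_mul, ← Real.exp_sub]
      congr 1
      rw [Nat.cast_add, Nat.cast_sub (by omega : 1 ≤ N)]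
      push_cast
      field_simp
      ring
    have h2 := ((hv.pow 2).isBigO_one ℝ).mul h1
    simp only [one_mul] at h2
    refine h2.congr_left fun t => ?_
    have := leadingTerm_ne_zero (N := N) (n := n) p t
    rw [div_pow, ← pow_mul, mul_comm n 2, div_mul_div_cancel₀ (pow_ne_zero _ this)]
  · refine IsBigO.of_bound 1 ?_
    filter_upwards [(tendsto_re hl).eventually_ge_atTop 0] with t ht
    rw [norm_inv, norm_pow, norm_leadingTerm, norm_exp_rpow, one_mul,
      Real.norm_of_nonneg (by positivity), ← Real.exp_nat_mul, ← Real.exp_neg, Real.exp_le_exp]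
    have h1 : t.re * (-1 / (2 * ((N : ℝ) - n))) = -(1 / 2 * (t.re / ((N : ℝ) - n))) := by
      field_simp
    have h2 : 0 ≤ t.re / ((N : ℝ) - n) := by positivity
    have h3 : (1 : ℝ) ≤ m := by exact_mod_cast hm
    rw [h1, neg_le_neg_iff]
    nlinarith

end TypeOne

/-! ### Critical points of the second type -/

section TypeTwo

variable {b : Fin n}

/-- The limits of the coordinates for the second type. -/
def limitCoords (w : Fin (N - 1) → ℂ) (lam : Fin n → ℂ) (b : Fin n) : Vars N n → ℂ :=
  Sum.elim (fun i => lam b - w i) fun a => lam b - lam a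

lemma tendsto_exp_inv (hl : Tendsto (fun t : ℂ => ‖Complex.exp t‖) l atTop) :
    Tendsto (fun t : ℂ => (Complex.exp t)⁻¹) l (𝓝 0) := by
  rw [tendsto_zero_iff_norm_tendsto_zero]
  simp only [norm_inv]
  exact tendsto_inv_atTop_zero.comp hl

lemma IsTypeTwo.tendsto_coords (h : IsTypeTwo w₀ w lam l P b)
    (hl : Tendsto (fun t : ℂ => ‖Complex.exp t‖) l atTop) (j : Vars N n) :
    Tendsto (fun t => coords (P t) j) l (𝓝 (limitCoords w lam b j)) := by
  have h1 := tendsto_norm_exp_rpow hl (by norm_num : (-2 : ℝ) < 0)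
  have h2 : ∀ a : ℂ, Tendsto (fun t => a + cCoeff w₀ w lam b * (Complex.exp t)⁻¹) l (𝓝 a) :=
    fun a => by simpa using ((tendsto_exp_inv hl).const_mul (cCoeff w₀ w lam b)).const_add a
  cases j with
  | inl i => simpa [limitCoords] using ((h.1 i).trans_tendsto h1).add (h2 (lam b - w i))
  | inr a => simpa [limitCoords] using ((h.2 a).trans_tendsto h1).add (h2 (lam b - lam a))

lemma IsTypeTwo.tendsto_monomial (h : IsTypeTwo w₀ w lam l P b)
    (hl : Tendsto (fun t : ℂ => ‖Complex.exp t‖) l atTop)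
    (hP : ∀ᶠ t in l, IsCriticalPoint w₀ w lam t (P t)) :
    Tendsto (fun t => monomial t (P t)) l (𝓝 (lam b - w₀)) := by
  have h1 := (h.tendsto_coords hl (Sum.inr b)).add_const (lam b - w₀)
  simp only [limitCoords, Sum.elim_inr, sub_self, zero_add] at h1
  refine h1.congr' ?_
  filter_upwards [hP] with t ht
  rw [ht.monomial_eq_v b]

/-- If `f t * v_b = e^t * ∏ v_a` with a convergent `f`, then `t` cannot tend to infinity. -/
lemma IsTypeTwo.false_of_tendsto [l.NeBot] (h : IsTypeTwo w₀ w lam l P b)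
    (hb : ∀ a : Fin n, a ≠ b → lam a ≠ lam b)
    (hl : Tendsto (fun t : ℂ => ‖Complex.exp t‖) l atTop) {f : ℂ → ℂ} {L : ℂ}
    (hf : Tendsto f l (𝓝 L))
    (heq : ∀ᶠ t in l, f t * coords (P t) (Sum.inr b) = Complex.exp t * vProd (P t)) : False := by
  have hd : Tendsto (fun t => ∏ a ∈ Finset.univ.erase b, coords (P t) (Sum.inr a)) l
      (𝓝 (∏ a ∈ Finset.univ.erase b, (lam b - lam a))) :=
    tendsto_finsetProd _ fun a _ => h.tendsto_coords hl (Sum.inr a)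
  have hd0 : ∏ a ∈ Finset.univ.erase b, (lam b - lam a) ≠ 0 :=
    Finset.prod_ne_zero_iff.2 fun a ha =>
      sub_ne_zero.2 (hb a (Finset.ne_of_mem_erase ha)).symm
  -- After cancelling v_b, this quotient is e^t itself, so |x| would have a finite limit.
  have h1 := (hf.div hd hd0).norm
  refine not_tendsto_nhds_of_tendsto_atTop hl _ (h1.congr' ?_)
  filter_upwards [heq] with t ht
  congr 1
  have h2 : ∏ a ∈ Finset.univ.erase b, coords (P t) (Sum.inr a) ≠ 0 :=
    Finset.prod_ne_zero_iff.2 fun a _ => coords_ne_zero _ _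
  have h3 := coords_ne_zero (P t) (Sum.inr b)
  rw [Pi.div_apply, div_eq_iff h2]
  refine mul_right_cancel₀ h3 ?_
  rw [ht, vProd, ← Finset.prod_erase_mul _ _ (Finset.mem_univ b), mul_assoc]

/-- The critical equations give Q = v_b + λ_b - w₀ = u_i + w_i - w₀. If λ_b were w₀ or w_i, then v_b
would equal Q or u_i and could be cancelled from Q ∏ u = x ∏ v, leaving a convergent left side
against x times a product with nonzero limit. -/
lemma IsTypeTwo.lam_ne [l.NeBot] (h : IsTypeTwo w₀ w lam l P b)
    (hb : ∀ a : Fin n, a ≠ b → lam a ≠ lam b)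
    (hl : Tendsto (fun t : ℂ => ‖Complex.exp t‖) l atTop)
    (hP : ∀ᶠ t in l, IsCriticalPoint w₀ w lam t (P t)) :
    lam b ≠ w₀ ∧ ∀ i, lam b ≠ w i := by
  have hco := h.tendsto_coords hl
  constructor
  · intro h0
    have hf : Tendsto (fun t => uProd (P t)) l (𝓝 (∏ i, (lam b - w i))) :=
      tendsto_finsetProd _ fun i _ => hco (Sum.inl i)
    refine h.false_of_tendsto hb hl hf ?_
    filter_upwards [hP] with t ht
    rw [← monomial_mul_uProd, ht.monomial_eq_v b, h0, sub_self, add_zero, mul_comm]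
  · intro i hi
    have hf : Tendsto (fun t => monomial t (P t)
        * ∏ k ∈ Finset.univ.erase i, coords (P t) (Sum.inl k)) l
        (𝓝 ((lam b - w₀) * ∏ k ∈ Finset.univ.erase i, (lam b - w k))) :=
      (h.tendsto_monomial hl hP).mul (tendsto_finsetProd _ fun k _ => hco (Sum.inl k))
    refine h.false_of_tendsto hb hl hf ?_
    filter_upwards [hP] with t ht
    have h1 : coords (P t) (Sum.inr b) = coords (P t) (Sum.inl i) := by
      have h2 := ht.monomial_eq_u i
      rw [ht.monomial_eq_v b, hi] at h2
      exact add_right_cancel h2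
    rw [← monomial_mul_uProd, uProd, ← Finset.prod_erase_mul _ _ (Finset.mem_univ i), h1, mul_assoc]

/-- No rescaling is needed. Only v_b tends to zero, and at rate O(x⁻¹): it supplies both the single
vanishing diagonal entry of the limit and the size of the prefactor. -/
theorem IsTypeTwo.bounds (h : IsTypeTwo w₀ w lam l P b)
    (hb : ∀ a : Fin n, a ≠ b → lam a ≠ lam b)
    (hl : Tendsto (fun t : ℂ => ‖Complex.exp t‖) l atTop)
    (hP : ∀ᶠ t in l, IsCriticalPoint w₀ w lam t (P t)) :
    PrefactorBound w₀ w lam l P (-1) ∧ CoefficientBound w₀ w lam l P 0 := by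
  -- The contradiction that separates λ_b from the w_i needs a nontrivial filter; for the trivial
  -- one every claim is vacuous.
  rcases l.eq_or_neBot with rfl | hne
  · exact ⟨⟨eventually_bot, fun _ _ => isBigO_bot _ _⟩,
      fun _ _ _ => ⟨⟨fun _ _ => 0, eventually_bot⟩, fun _ _ _ _ => isBigO_bot _ _⟩⟩
  obtain ⟨hw₀, hw⟩ := h.lam_ne hb hl hP
  have hco := h.tendsto_coords hl
  have hy : ∀ᶠ _ in l, (1 : ℂ) ≠ 0 := Eventually.of_forall fun _ => one_ne_zero
  have hc : ∀ j, Tendsto (fun t => diagCoeff (P t) j / 1) l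
      (𝓝 (-expo j * limitCoords w lam b j)) := by
    intro j
    simpa [diagCoeff] using (hco j).const_mul (-expo j)
  have hQ : Tendsto (fun t => monomial t (P t) / 1) l (𝓝 (lam b - w₀)) := by
    simpa using h.tendsto_monomial hl hP
  have hdet : (quadMatrix (fun j => -expo j * limitCoords w lam b j) (lam b - w₀) expo).det ≠ 0 := by
    refine det_quadMatrix_ne_zero_of_one_zero (b := Sum.inr b) (by simp [limitCoords]) ?_
      (sub_ne_zero.2 hw₀)
    intro j hj
    refine mul_ne_zero (neg_ne_zero.2 (expo_ne_zero j)) ?_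
    cases j with
    | inl i => exact sub_ne_zero.2 (hw i)
    | inr a => exact sub_ne_zero.2 (hb a fun hab => hj (by rw [hab])).symm
  refine ⟨prefactorBound_of_tendsto hP hy hc hQ hdet ?_,
    coefficientBound_of_tendsto hP hy hc hQ hdet fun m _ => ?_⟩
  · have hvb : (fun t => coords (P t) (Sum.inr b)) =O[l] fun t => ‖Complex.exp t‖ ^ (-1 : ℝ) := by
      have h1 : (fun t : ℂ => ‖Complex.exp t‖ ^ (-2 : ℝ))
          =O[l] fun t : ℂ => ‖Complex.exp t‖ ^ (-1 : ℝ) := by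
        refine IsBigO.of_bound 1 ?_
        filter_upwards [(tendsto_re hl).eventually_ge_atTop 0] with t ht
        rw [norm_exp_rpow, norm_exp_rpow, Real.norm_of_nonneg (Real.exp_pos _).le,
          Real.norm_of_nonneg (Real.exp_pos _).le, one_mul, Real.exp_le_exp]
        linarith
      have h2 : (fun t : ℂ => cCoeff w₀ w lam b * (Complex.exp t)⁻¹)
          =O[l] fun t : ℂ => ‖Complex.exp t‖ ^ (-1 : ℝ) := by
        refine IsBigO.const_mul_left (isBigO_of_le _ fun t => ?_) _
        rw [norm_inv, Real.rpow_neg_one, norm_inv, norm_norm]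
      simpa using ((h.2 b).trans h1).add h2
    have hrest : (fun t => ∏ a ∈ Finset.univ.erase b, coords (P t) (Sum.inr a))
        =O[l] fun _ => (1 : ℝ) :=
      (tendsto_finsetProd _ fun a _ => hco (Sum.inr a)).isBigO_one ℝ
    have hv : (fun t => vProd (P t)) =O[l] fun t => ‖Complex.exp t‖ ^ (-1 : ℝ) := by
      have h1 := hrest.mul hvb
      simp only [one_mul] at h1
      refine h1.congr_left fun t => ?_
      rw [vProd, Finset.prod_erase_mul _ _ (Finset.mem_univ b)]
    simpa using hv.pow 2
  · simpa using isBigO_const_const (1 : ℂ) (one_ne_zero (α := ℝ)) l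

end TypeTwo

end DegreeOneMirror

/-- `x = exp t` tends to infinity along an arbitrary filter `l` on the universal covering of
`ℂ^*`, and `P t` is a family of critical points. -/
theorem mainTheorem11 (N n : ℕ) (hn : n < N)
    (w₀ : ℂ) (w : Fin (N - 1) → ℂ) (lam : Fin n → ℂ)
    (l : Filter ℂ) (hl : Tendsto (fun t : ℂ => ‖Complex.exp t‖) l atTop)
    (P : ℂ → DegreeOneMirror.Vars N n → ℂ)
    (hP : ∀ᶠ t in l, DegreeOneMirror.IsCriticalPoint w₀ w lam t (P t)) :
    (∀ p ∈ Finset.Icc 1 (N - n), DegreeOneMirror.IsTypeOne l P p →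
      DegreeOneMirror.PrefactorBound w₀ w lam l P
        (-((N : ℝ) - n - 1) / (2 * ((N : ℝ) - n))) ∧
      DegreeOneMirror.CoefficientBound w₀ w lam l P (-1 / (2 * ((N : ℝ) - n)))) ∧
    (∀ b : Fin n, (∀ a : Fin n, a ≠ b → lam a ≠ lam b) →
      DegreeOneMirror.IsTypeTwo w₀ w lam l P b →
      DegreeOneMirror.PrefactorBound w₀ w lam l P (-1) ∧
      DegreeOneMirror.CoefficientBound w₀ w lam l P 0) :=
  ⟨fun _ hp h => h.bounds hn hp hl hP, fun _ hb h => h.bounds hb hl hP⟩
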